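/- **Theorem (Zung's theorem, fixed point case).** Let $\mathcal G \rightrightarrows M$ be a (smooth, finite-dimensional) Lie groupoid with source and target maps $s,t:\mathcal G\to M$, where the manifold of objects $M$ and the manifold of arrows $\mathcal G$ are Hausdorff and second countable. Let $x\in M$ be a fixed point of $\mathcal G$, i.e. the orbit $\{t(g) : s(g)=x\}$ equals $\{x\}$, and suppose that $\mathcal G$ is proper at $x$: every sequence $(g_n)$ in $\mathcal G$ with $s(g_n)\to x$ and $t(g_n)\to x$ has a convergent subsequence. Then $\mathcal G$ is linearizable at $x$, in the following sense. Let $G_x=\{g\in\mathcal G: s(g)=t(g)=x\}$ be the isotropy group at $x$, with the Lie group structure induced from $\mathcal G$ (as $x$ is a fixed point, $G_x=s^{-1}(x)$), acting linearly on the normal space $\mathcal N_x=T_xM/T_x\{x\}=T_xM$ to the orbit by $a\cdot ds_a(w)=dt_a(w)$ for $a\in G_x$, $w\in T_a\mathcal G$. Let $G_x\ltimes\mathcal N_x$ be the associated action groupoid over $\mathcal N_x$: its arrows are the pairs $(a,v)\in G_x\times\mathcal N_x$, with source $v$, target $a\cdot v$ and multiplication $(a,v)(b,w)=(ab,w)$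 for $v=b\cdot w$. Then there are an open neighborhood $U$ of $x$ in $M$, an open neighborhood $V$ of $0$ in $\mathcal N_x$, and an isomorphism of Lie groupoids $$\mathcal G|_U\;\cong\;(G_x\ltimes \mathcal N_x)|_V$$ which is the identity on $G_x$, i.e. sends $a\in G_x$ to $(a,0)$. Here $|_U$ and $|_V$ denote the restriction to the arrows whose source and target lie in $U$, respectively $V$. -/

import Mathlib

open Set Filter Topology
open scoped Manifold ContDiff

noncomputable section

/-- A Lie groupoid with manifold of arrows `G` (modelled on `F`) and manifold of objects `M`
(modelled on `E`): source and target `s t : G → M`, units `u : M → G`, inversion `inv : G → G` and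
multiplication `mul`, where `mul g h = gh` is meaningful for composable arrows, `s g = t h`, only
(the values of `mul` elsewhere are irrelevant). The set of composable pairs is an embedded
submanifold of `G × G`, since `s` is a submersion, so that `ContMDiffOn` on this set is the
smoothness of the multiplication as a map on that submanifold. The target `t = s ∘ inv` is
a submersion too. -/
structure LieGroupoid
    (E : Type*) [NormedAddCommGroup E] [NormedSpace ℝ E]
    (F : Type*) [NormedAddCommGroup F] [NormedSpace ℝ F]
    (M : Type*) [TopologicalSpace M] [ChartedSpace E M]
    (G : Type*) [TopologicalSpace G] [ChartedSpace F G] where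
  /-- source -/
  s : G → M
  /-- target -/
  t : G → M
  /-- units -/
  u : M → G
  /-- inversion -/
  inv : G → G
  /-- multiplication (of composable arrows) -/
  mul : G → G → G
  s_u : ∀ y, s (u y) = y
  t_u : ∀ y, t (u y) = y
  s_inv : ∀ g, s (inv g) = t g
  t_inv : ∀ g, t (inv g) = s g
  s_mul : ∀ g h, s g = t h → s (mul g h) = s h
  t_mul : ∀ g h, s g = t h → t (mul g h) = t g
  mul_assoc : ∀ g h k, s g = t h → s h = t k → mul (mul g h) k = mul g (mul h k)
  mul_u : ∀ g, mul g (u (s g)) = g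
  u_mul : ∀ g, mul (u (t g)) g = g
  mul_inv : ∀ g, mul g (inv g) = u (t g)
  inv_mul : ∀ g, mul (inv g) g = u (s g)
  submersion_s : Manifold.IsSubmersion 𝓘(ℝ, F) 𝓘(ℝ, E) ∞ s
  smooth_t : ContMDiff 𝓘(ℝ, F) 𝓘(ℝ, E) ∞ t
  smooth_u : ContMDiff 𝓘(ℝ, E) 𝓘(ℝ, F) ∞ u
  smooth_inv : ContMDiff 𝓘(ℝ, F) 𝓘(ℝ, F) ∞ inv
  smooth_mul : ContMDiffOn (𝓘(ℝ, F).prod 𝓘(ℝ, F)) 𝓘(ℝ, F) ∞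
    (fun p : G × G => mul p.1 p.2) {p : G × G | s p.1 = t p.2}

namespace LieGroupoid

variable {E : Type*} [NormedAddCommGroup E] [NormedSpace ℝ E]
  {F : Type*} [NormedAddCommGroup F] [NormedSpace ℝ F]
  {M : Type*} [TopologicalSpace M] [ChartedSpace E M]
  {G : Type*} [TopologicalSpace G] [ChartedSpace F G]

/-- The orbit of `x`: all targets of arrows with source `x`. -/
def orbit (𝒢 : LieGroupoid E F M G) (x : M) : Set M :=
  {y | ∃ g : G, 𝒢.s g = x ∧ 𝒢.t g = y}

/-- `x` is a fixed point: its orbit is `{x}`. -/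
def IsFixedPoint (𝒢 : LieGroupoid E F M G) (x : M) : Prop :=
  𝒢.orbit x = {x}

/-- `𝒢` is proper at `x`: the map `(s, t)` is proper at `(x, x)`, i.e. every sequence of arrows
whose sources and targets converge to `x` has a convergent subsequence. -/
def IsProperAt (𝒢 : LieGroupoid E F M G) (x : M) : Prop :=
  ∀ γ : ℕ → G, Tendsto (fun n => 𝒢.s (γ n)) atTop (𝓝 x) →
    Tendsto (fun n => 𝒢.t (γ n)) atTop (𝓝 x) →
    ∃ (k : ℕ → ℕ) (g : G), StrictMono k ∧ Tendsto (fun n => γ (k n)) atTop (𝓝 g)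

/-- The arrows of the restriction of `𝒢` to `U`. -/
def restrict (𝒢 : LieGroupoid E F M G) (U : Set M) : Set G :=
  {g | 𝒢.s g ∈ U ∧ 𝒢.t g ∈ U}

/-- The isotropy group at `x`, as a subset of `G`. -/
def isotropy (𝒢 : LieGroupoid E F M G) (x : M) : Set G :=
  {g | 𝒢.s g = x ∧ 𝒢.t g = x}

/-- Around each arrow, in suitable charts, `s` is a linear surjection. -/
theorem exists_charts [IsManifold 𝓘(ℝ, E) ∞ M] [IsManifold 𝓘(ℝ, F) ∞ G]
    (𝒢 : LieGroupoid E F M G) (g : G) :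
    ∃ (φ : OpenPartialHomeomorph G F) (ψ : OpenPartialHomeomorph M E) (P : F →L[ℝ] E),
      g ∈ φ.source ∧ 𝒢.s g ∈ ψ.source ∧ φ.MDifferentiable 𝓘(ℝ, F) 𝓘(ℝ, F) ∧
      ψ.MDifferentiable 𝓘(ℝ, E) 𝓘(ℝ, E) ∧ Function.Surjective P ∧
      (∀ h ∈ φ.source, 𝒢.s h ∈ ψ.source) ∧ ∀ z ∈ φ.target, ψ (𝒢.s (φ.symm z)) = P z := by
  have h := 𝒢.submersion_s.isSubmersionAt g
  refine ⟨h.domChart, h.codChart,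
    (ContinuousLinearMap.fst ℝ E h.complement).comp (h.equiv : F →L[ℝ] E × h.complement),
    h.mem_domChart_source, h.mem_codChart_source, ⟨?_, ?_⟩, ⟨?_, ?_⟩, ?_,
    fun y hy => h.source_subset_preimage_source hy, fun z hz => ?_⟩
  · exact (contMDiffOn_of_mem_maximalAtlas h.domChart_mem_maximalAtlas).mdifferentiableOn
      (by simp)
  · exact (contMDiffOn_symm_of_mem_maximalAtlas h.domChart_mem_maximalAtlas).mdifferentiableOn
      (by simp)
  · exact (contMDiffOn_of_mem_maximalAtlas h.codChart_mem_maximalAtlas).mdifferentiableOn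
      (by simp)
  · exact (contMDiffOn_symm_of_mem_maximalAtlas h.codChart_mem_maximalAtlas).mdifferentiableOn
      (by simp)
  · exact Prod.fst_surjective.comp h.equiv.surjective
  · have hz' : z ∈ (h.domChart.extend 𝓘(ℝ, F)).target := by simpa using hz
    simpa using h.writtenInCharts hz'

/-- The differential of the source map is surjective. -/
theorem mfderiv_s_surjective [IsManifold 𝓘(ℝ, E) ∞ M] [IsManifold 𝓘(ℝ, F) ∞ G]
    (𝒢 : LieGroupoid E F M G) (g : G) :
    Function.Surjective (mfderiv 𝓘(ℝ, F) 𝓘(ℝ, E) 𝒢.s g) := by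
  obtain ⟨φ, ψ, P, hg, hsg, hφ, hψ, hP, -, hloc⟩ := 𝒢.exists_charts g
  have hs : MDifferentiableAt 𝓘(ℝ, F) 𝓘(ℝ, E) 𝒢.s g :=
    𝒢.submersion_s.contMDiff.mdifferentiableAt (by simp)
  have hψs : MDifferentiableAt 𝓘(ℝ, E) 𝓘(ℝ, E) ψ (𝒢.s g) := hψ.mdifferentiableAt hsg
  have hφg : MDifferentiableAt 𝓘(ℝ, F) 𝓘(ℝ, F) φ g := hφ.mdifferentiableAt hg
  have e1 : (ψ ∘ 𝒢.s) =ᶠ[𝓝 g] (P ∘ φ) := by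
    filter_upwards [φ.open_source.mem_nhds hg] with h hh
    have := hloc (φ h) (φ.map_source hh)
    rwa [φ.left_inv hh] at this
  have e2 := e1.mfderiv_eq (I := 𝓘(ℝ, F)) (I' := 𝓘(ℝ, E))
  have hPd : MDifferentiableAt 𝓘(ℝ, F) 𝓘(ℝ, E) P (φ g) :=
    P.differentiableAt.mdifferentiableAt
  rw [mfderiv_comp g hψs hs, mfderiv_comp g hPd hφg] at e2
  have hPm : mfderiv 𝓘(ℝ, F) 𝓘(ℝ, E) P (φ g) = P := by
    rw [mfderiv_eq_fderiv]; exact P.fderiv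
  intro v
  obtain ⟨w, hw⟩ := hP (mfderiv 𝓘(ℝ, E) 𝓘(ℝ, E) ψ (𝒢.s g) v)
  obtain ⟨w', hw'⟩ := hφ.mfderiv_surjective hg w
  refine ⟨w', hψ.mfderiv_injective hsg ?_⟩
  have e3 := congrArg (fun L => L w') e2
  rw [hPm] at e3
  refine Eq.trans e3 (Eq.trans ?_ hw)
  exact congrArg P hw'

/-- At an arrow whose source is a fixed point, `ker ds ⊆ ker dt`. -/
theorem mfderiv_t_eq_zero [IsManifold 𝓘(ℝ, E) ∞ M] [IsManifold 𝓘(ℝ, F) ∞ G]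
    (𝒢 : LieGroupoid E F M G) {x : M} (hx : 𝒢.IsFixedPoint x) {g : G} (hg : 𝒢.s g = x)
    (w : TangentSpace 𝓘(ℝ, F) g) (hw : mfderiv 𝓘(ℝ, F) 𝓘(ℝ, E) 𝒢.s g w = 0) :
    mfderiv 𝓘(ℝ, F) 𝓘(ℝ, E) 𝒢.t g w = 0 := by
  obtain ⟨φ, ψ, P, hgφ, hsg, hφ, hψ, -, hsrc, hloc⟩ := 𝒢.exists_charts g
  have hs : MDifferentiableAt 𝓘(ℝ, F) 𝓘(ℝ, E) 𝒢.s g :=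
    𝒢.submersion_s.contMDiff.mdifferentiableAt (by simp)
  have ht : MDifferentiableAt 𝓘(ℝ, F) 𝓘(ℝ, E) 𝒢.t g :=
    𝒢.smooth_t.mdifferentiableAt (by simp)
  have hψs : MDifferentiableAt 𝓘(ℝ, E) 𝓘(ℝ, E) ψ (𝒢.s g) := hψ.mdifferentiableAt hsg
  have hφg : MDifferentiableAt 𝓘(ℝ, F) 𝓘(ℝ, F) φ g := hφ.mdifferentiableAt hgφ
  have e1 : (ψ ∘ 𝒢.s) =ᶠ[𝓝 g] (P ∘ φ) := by
    filter_upwards [φ.open_source.mem_nhds hgφ] with h hh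
    have := hloc (φ h) (φ.map_source hh)
    rwa [φ.left_inv hh] at this
  have e2 := e1.mfderiv_eq (I := 𝓘(ℝ, F)) (I' := 𝓘(ℝ, E))
  have hPd : MDifferentiableAt 𝓘(ℝ, F) 𝓘(ℝ, E) P (φ g) :=
    P.differentiableAt.mdifferentiableAt
  rw [mfderiv_comp g hψs hs, mfderiv_comp g hPd hφg] at e2
  have hPm : mfderiv 𝓘(ℝ, F) 𝓘(ℝ, E) P (φ g) = P := by
    rw [mfderiv_eq_fderiv]; exact P.fderiv
  set w' : F := mfderiv 𝓘(ℝ, F) 𝓘(ℝ, F) φ g w with hw'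
  have hPw : P w' = 0 := by
    have e3 := congrArg (fun L => L w) e2
    rw [hPm] at e3
    refine Eq.trans (Eq.symm e3) ?_
    exact (congrArg (mfderiv 𝓘(ℝ, E) 𝓘(ℝ, E) ψ (𝒢.s g)) hw).trans (map_zero _)
  -- the curve `τ ↦ φ⁻¹(φ(g) + τ w')` lies in the fibre `s⁻¹(x)`, on which `t` is constant
  let c : ℝ → F := fun τ => φ g + τ • w'
  have hc0 : c 0 = φ g := by simp [c]
  have hcd : HasFDerivAt c (ContinuousLinearMap.toSpanSingleton ℝ w') 0 := by
    have := ((hasDerivAt_id (0 : ℝ)).smul_const w').const_add (φ g)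
    simpa [c] using this.hasFDerivAt
  have hsymm : MDifferentiableAt 𝓘(ℝ, F) 𝓘(ℝ, F) φ.symm (φ g) :=
    hφ.mdifferentiableAt_symm (φ.map_source hgφ)
  have hconst : (𝒢.t ∘ φ.symm ∘ c) =ᶠ[𝓝 0] fun _ => x := by
    have hcc : ContinuousAt c 0 := hcd.continuousAt
    have hmem : ∀ᶠ τ in 𝓝 (0 : ℝ), c τ ∈ φ.target :=
      hcc.eventually_mem (by rw [hc0]; exact φ.open_target.mem_nhds (φ.map_source hgφ))
    filter_upwards [hmem] with τ hτ
    have h1 : ψ (𝒢.s (φ.symm (c τ))) = ψ (𝒢.s g) := by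
      have h2 := hloc (φ g) (φ.map_source hgφ)
      rw [φ.left_inv hgφ] at h2
      rw [hloc _ hτ, h2]
      simp [c, hPw]
    have h3 : 𝒢.s (φ.symm (c τ)) = x :=
      (ψ.injOn (hsrc _ (φ.map_target hτ)) hsg h1).trans hg
    have h4 : 𝒢.t (φ.symm (c τ)) ∈ 𝒢.orbit x := ⟨_, h3, rfl⟩
    rw [hx] at h4
    exact h4
  have hT : HasMFDerivAt 𝓘(ℝ, F) 𝓘(ℝ, E) (𝒢.t ∘ φ.symm) (c 0)
      ((mfderiv 𝓘(ℝ, F) 𝓘(ℝ, E) 𝒢.t g).comp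
        (mfderiv 𝓘(ℝ, F) 𝓘(ℝ, F) φ.symm (φ g))) := by
    rw [hc0]
    have ht' : HasMFDerivAt 𝓘(ℝ, F) 𝓘(ℝ, E) 𝒢.t (φ.symm (φ g))
        (mfderiv 𝓘(ℝ, F) 𝓘(ℝ, E) 𝒢.t g) := by
      rw [φ.left_inv hgφ]; exact ht.hasMFDerivAt
    exact ht'.comp (φ g) hsymm.hasMFDerivAt
  have hD := HasMFDerivAt.comp (0 : ℝ) hT hcd.hasMFDerivAt
  have hD0 : HasMFDerivAt 𝓘(ℝ, ℝ) 𝓘(ℝ, E) ((𝒢.t ∘ φ.symm) ∘ c) 0 _ :=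
    (hasMFDerivAt_const x (0 : ℝ)).congr_of_eventuallyEq hconst
  have hE := hasMFDerivAt_unique hD hD0
  have hE1 := congrArg (fun L => L (1 : ℝ)) hE
  have hinv : mfderiv 𝓘(ℝ, F) 𝓘(ℝ, F) φ.symm (φ g) w' = w := by
    have := congrArg (fun L => L w) (hφ.symm_comp_deriv hgφ)
    exact this
  have hw1 : (ContinuousLinearMap.toSpanSingleton ℝ w') (1 : ℝ) = w' := by simp
  have hE2 : mfderiv 𝓘(ℝ, F) 𝓘(ℝ, E) 𝒢.t g
      (mfderiv 𝓘(ℝ, F) 𝓘(ℝ, F) φ.symm (φ g)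
        ((ContinuousLinearMap.toSpanSingleton ℝ w') (1 : ℝ))) = 0 := hE1
  rw [hw1] at hE2
  have hinv' := congrArg (mfderiv 𝓘(ℝ, F) 𝓘(ℝ, E) 𝒢.t g) hinv
  exact hinv'.symm.trans hE2

/-- The isotropy action at a fixed point `x`. Since the orbit is `{x}`, the normal space is
`N_x = T_x M / T_x {x} = T_x M`, and an arrow `a` of the isotropy group acts on it by
`ds(w) ↦ dt(w)`, for `w` tangent to `G` at `a`: if `w` is the velocity at `a` of a curve of arrows
`g(τ) : x(τ) ⟶ y(τ)`, then `ẋ(0)` is sent to `ẏ(0)`. The choice of `w` does not matter, see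
`isotropyAct_eq`. (In Mathlib the type `TangentSpace 𝓘(ℝ, E) x` is `E` by definition, a tangent
vector being represented in the preferred chart at `x`.) -/
def isotropyAct [IsManifold 𝓘(ℝ, E) ∞ M] [IsManifold 𝓘(ℝ, F) ∞ G]
    (𝒢 : LieGroupoid E F M G) (a : G) (v : E) : E :=
  mfderiv 𝓘(ℝ, F) 𝓘(ℝ, E) 𝒢.t a (Function.surjInv (𝒢.mfderiv_s_surjective a) v)

/-- The isotropy action is characterized by `a · ds(w) = dt(w)`. -/
theorem isotropyAct_eq [IsManifold 𝓘(ℝ, E) ∞ M] [IsManifold 𝓘(ℝ, F) ∞ G]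
    (𝒢 : LieGroupoid E F M G) {x : M} (hx : 𝒢.IsFixedPoint x) {a : G} (ha : a ∈ 𝒢.isotropy x)
    (w : TangentSpace 𝓘(ℝ, F) a) :
    𝒢.isotropyAct a (mfderiv 𝓘(ℝ, F) 𝓘(ℝ, E) 𝒢.s a w) =
      mfderiv 𝓘(ℝ, F) 𝓘(ℝ, E) 𝒢.t a w := by
  have h := 𝒢.mfderiv_t_eq_zero hx ha.1 (Function.surjInv (𝒢.mfderiv_s_surjective a)
    (mfderiv 𝓘(ℝ, F) 𝓘(ℝ, E) 𝒢.s a w) - w) (by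
      rw [map_sub, Function.surjInv_eq (𝒢.mfderiv_s_surjective a), sub_self])
  rw [map_sub, sub_eq_zero] at h
  exact h

/-- The arrows of `(G_x ⋉ N_x)|_V`, the restriction to `V ⊆ N_x = T_x M` of the linearization of
`𝒢` at a fixed point `x`, i.e. of the action groupoid of the isotropy action: pairs `(a, v)` with
`a` in the isotropy group and with source `v` and target `a · v` in `V`.

The arrows are seen as a subset of the manifold
`G × E`: `G_x = s⁻¹(x)` carries the smooth structure of an embedded submanifold of `G`, so that
smoothness of maps into or out of the set of arrows is smoothness as maps into, respectively
on a subset of, `G × E`. -/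
def linArrows [IsManifold 𝓘(ℝ, E) ∞ M] [IsManifold 𝓘(ℝ, F) ∞ G]
    (𝒢 : LieGroupoid E F M G) (x : M) (V : Set E) : Set (G × E) :=
  {p | p.1 ∈ 𝒢.isotropy x ∧ p.2 ∈ V ∧ 𝒢.isotropyAct p.1 p.2 ∈ V}

/-- Source in the action groupoid `G_x ⋉ N_x`. -/
def linSrc (_ : LieGroupoid E F M G) (p : G × E) : E := p.2

/-- Target in the action groupoid `G_x ⋉ N_x`. -/
def linTgt [IsManifold 𝓘(ℝ, E) ∞ M] [IsManifold 𝓘(ℝ, F) ∞ G]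
    (𝒢 : LieGroupoid E F M G) (p : G × E) : E := 𝒢.isotropyAct p.1 p.2

/-- Units in the action groupoid `G_x ⋉ N_x`. -/
def linUnit (𝒢 : LieGroupoid E F M G) (x : M) (v : E) : G × E := (𝒢.u x, v)

/-- Multiplication `(a, v)(b, w) = (ab, w)`, for `v = b · w`, in the action groupoid
`G_x ⋉ N_x`. -/
def linMul (𝒢 : LieGroupoid E F M G) (p q : G × E) : G × E := (𝒢.mul p.1 q.1, q.2)

/-- `(Φ, φ)` is an isomorphism of Lie groupoids from the restriction `𝒢|_U` onto the restriction
`(G_x ⋉ N_x)|_V`, where `U` is an open neighbourhood of the fixed point `x` in `M` and `V` is an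
open neighbourhood of the origin in `N_x = T_x M`, which is the identity on `𝒢|_{{x}} = G_x`. -/
structure IsLinearization [IsManifold 𝓘(ℝ, E) ∞ M] [IsManifold 𝓘(ℝ, F) ∞ G]
    (𝒢 : LieGroupoid E F M G) (x : M) (U : Set M) (V : Set E)
    (φ : PartialEquiv M E) (Φ : PartialEquiv G (G × E)) : Prop where
  isOpen_U : IsOpen U
  mem_U : x ∈ U
  isOpen_V : IsOpen V
  zero_mem_V : (0 : E) ∈ V
  -- `φ : U → V` and `Φ : 𝒢|_U → (G_x ⋉ N_x)|_V` are bijections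
  source_obj : φ.source = U
  target_obj : φ.target = V
  source_arr : Φ.source = 𝒢.restrict U
  target_arr : Φ.target = 𝒢.linArrows x V
  -- they are smooth together with their inverses
  smooth_obj : ContMDiffOn 𝓘(ℝ, E) 𝓘(ℝ, E) ∞ φ U
  smooth_obj_symm : ContMDiffOn 𝓘(ℝ, E) 𝓘(ℝ, E) ∞ φ.symm V
  smooth_arr : ContMDiffOn 𝓘(ℝ, F) (𝓘(ℝ, F).prod 𝓘(ℝ, E)) ∞ Φ (𝒢.restrict U)
  smooth_arr_symm : ContMDiffOn (𝓘(ℝ, F).prod 𝓘(ℝ, E)) 𝓘(ℝ, F) ∞ Φ.symm (𝒢.linArrows x V)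
  -- they are compatible with the groupoid structures
  map_s : ∀ g ∈ 𝒢.restrict U, 𝒢.linSrc (Φ g) = φ (𝒢.s g)
  map_t : ∀ g ∈ 𝒢.restrict U, 𝒢.linTgt (Φ g) = φ (𝒢.t g)
  map_u : ∀ y ∈ U, Φ (𝒢.u y) = 𝒢.linUnit x (φ y)
  map_mul : ∀ g ∈ 𝒢.restrict U, ∀ h ∈ 𝒢.restrict U, 𝒢.s g = 𝒢.t h →
    Φ (𝒢.mul g h) = 𝒢.linMul (Φ g) (Φ h)
  -- identity on the isotropy group, which is `{(a, 0)}` in `G_x ⋉ N_x`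
  map_isotropy : ∀ a ∈ 𝒢.isotropy x, Φ a = (a, (0 : E))

/-- `𝒢` is linearizable at the fixed point `x`. -/
def IsLinearizableAt [IsManifold 𝓘(ℝ, E) ∞ M] [IsManifold 𝓘(ℝ, F) ∞ G]
    (𝒢 : LieGroupoid E F M G) (x : M) : Prop :=
  ∃ (U : Set M) (V : Set E) (φ : PartialEquiv M E) (Φ : PartialEquiv G (G × E)),
    𝒢.IsLinearization x U V φ Φ

end LieGroupoid

end

open Set Filter Topology
open scoped Manifold ContDiff

universe uZ uB uX uW

/-! The isotropy group `K = s⁻¹(x)` is compact because `𝒢` is proper at `x`. The heart of the matter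
is a smooth retraction `r` of a neighbourhood of `K` in `G` onto `K` which is multiplicative. Given
`r`, the map `g ↦ (r g, s g)` is a diffeomorphism from a neighbourhood of `K` onto a neighbourhood
of `K × {x}` (`IsRetraction.exists_section`). Multiplicativity says that in these coordinates the
target map is a local action of `K` fixing `x`. Averaging makes this action linear
(`IsLocalAction.exists_linearization`), and properness puts every arrow between points close to `x`
inside the neighbourhood of `K` (`IsProperAt.exists_restrict_subset`). These pieces are assembled in
`IsSection.isLinearizableAt`.

To find `r`, an arbitrary retraction is used to write the arrows near `K` as pairs `(a, y)` in `K ×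
E`, so that the multiplication becomes a deformation, with parameter `y`, of that of `K`
(`LocalGroupoid`). Let `c` be a chart of `K` at `1` and put `e = c⁻¹`. Writing `r(a, y) = a
e(η(a))`, the unknowns at the base point `y` are `η` in `C(K, D)` and a constant `γ` in `D`, and the
equations are `∫ c(b⁻¹ r(ba, y) e(γ) r(a, y)⁻¹) db = 0` for all `a`, and `η(1) = 0`, where `ba` is
the deformed product over `y`. At `y = 0` the linearization is `(η, γ) ↦ (Ad_a(∫ η + γ - η(a)),
η(1))`, which is bijective: `γ` and the normalization at `1` account for the constants
(`fderiv_defectMap_bijective`). The implicit function theorem gives a solution, unique among small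
ones (`exists_solution`). If `(a, y)` is an arrow from `y` to `y'`, then `b ↦ r(ba, y) r(a, y)⁻¹`,
together with the constant conjugated by `r(a, y)`, solves the equations at `y'`. By uniqueness it
is `b ↦ r(b, y')`, so `r` is multiplicative (`exists_homomorphism`).

Two analytic points need care. First, `η` is merely continuous, so `η(ba)` is not differentiable in
`(a, y)`. The integral is smeared over a ball in the chart, and a change of variables moves the
dependence on `(a, y)` out of the argument of `η` into a smooth density (`eventually_defect_eq`).
The defect then becomes a superposition operator followed by a continuous linear functional, and
superposition operators with smooth kernels are smooth (`contDiffOn_superposition`). Second, the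
solution is a priori only continuous in `a`. Its value at `a`, however, solves a finite dimensional
equation, to which the implicit function theorem applies again (`eventually_contMDiffAt_solution`).
-/

noncomputable section


/-! ### Families of maps that are smooth in one variable and continuous in a parameter -/

section SmoothFamily

variable {Z : Type uZ} [TopologicalSpace Z]
  (B : Type uB) [NormedAddCommGroup B] [NormedSpace ℝ B]
  {X : Type uX} [NormedAddCommGroup X] [NormedSpace ℝ X]
  {W : Type uW} [NormedAddCommGroup W] [NormedSpace ℝ W]

/-- Near `(z₀, x₀)`, the family of maps `H z : X → W` is the pullback under a continuous map
`c : Z → B` of a family depending jointly smoothly on `(b, x) ∈ B × X`. -/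
def SmoothFamilyAt (H : Z → X → W) (z₀ : Z) (x₀ : X) : Prop :=
  ∃ (c : Z → B) (Hh : B × X → W), ContinuousAt c z₀ ∧ ContDiffAt ℝ ∞ Hh (c z₀, x₀) ∧
    ∀ᶠ p in 𝓝 (z₀, x₀), H p.1 p.2 = Hh (c p.1, p.2)

variable {B}

theorem SmoothFamilyAt.continuousAt {H : Z → X → W} {z₀ : Z} {x₀ : X}
    (h : SmoothFamilyAt B H z₀ x₀) : ContinuousAt (fun p : Z × X => H p.1 p.2) (z₀, x₀) := by
  obtain ⟨c, Hh, hc, hH, he⟩ := h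
  have hc' : ContinuousAt (fun p : Z × X => (c p.1, p.2)) (z₀, x₀) :=
    (ContinuousAt.comp (f := Prod.fst) (x := (z₀, x₀)) hc continuousAt_fst).prodMk continuousAt_snd
  exact (ContinuousAt.comp (f := fun p : Z × X => (c p.1, p.2)) (x := (z₀, x₀))
    hH.continuousAt hc').congr (he.mono fun p hp => hp.symm)

/-- The derivative of the family is the pullback, under the same `c`, of the partial derivative of
`Hh`. The class is thus closed under differentiation in `x`, although nothing is differentiable in
`z`. -/
theorem SmoothFamilyAt.fderiv {H : Z → X → W} {z₀ : Z} {x₀ : X}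
    (h : SmoothFamilyAt B H z₀ x₀) :
    SmoothFamilyAt B (fun z x => fderiv ℝ (H z) x) z₀ x₀ := by
  obtain ⟨c, Hh, hc, hH, he⟩ := h
  refine ⟨c, fun p => (_root_.fderiv ℝ Hh p).comp (ContinuousLinearMap.inr ℝ B X), hc, ?_, ?_⟩
  · exact (hH.fderiv_right (m := ∞) (by simp)).clm_comp contDiffAt_const
  · have hc' : ContinuousAt (fun p : Z × X => (c p.1, p.2)) (z₀, x₀) :=
      (ContinuousAt.comp (f := Prod.fst) (x := (z₀, x₀)) hc continuousAt_fst).prodMk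
        continuousAt_snd
    have h1 : ∀ᶠ q in 𝓝 (c z₀, x₀), DifferentiableAt ℝ Hh q :=
      ((hH.of_le (m := 1) (by simp)).eventually (by simp)).mono
        fun q hq => hq.differentiableAt (by simp)
    filter_upwards [hc'.eventually h1, he.eventually_nhds] with p hp hq
    have h2 : ∀ᶠ x in 𝓝 p.2, H p.1 x = Hh (c p.1, x) :=
      (Continuous.tendsto (by fun_prop : Continuous fun x => (p.1, x)) p.2).eventually hq
    rw [Filter.EventuallyEq.fderiv_eq h2]
    exact (hp.hasFDerivAt.comp p.2 (hasFDerivAt_prodMk_right (c p.1) p.2)).fderiv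

/-- Strict differentiability of `Hh` at `(c z₀, x₀)` compares two points with the same first
coordinate `c z`, which gives a first order estimate uniform in `z` and in both points. Continuity
of the derivative replaces the derivative at `(z₀, x₀)` by the one at the second point; each
replacement costs `ε / 2`. -/
theorem SmoothFamilyAt.eventually_norm_sub_le {H : Z → X → W} {z₀ : Z} {x₀ : X}
    (h : SmoothFamilyAt B H z₀ x₀) {ε : ℝ} (hε : 0 < ε) :
    ∀ᶠ p : Z × X × X in 𝓝 (z₀, x₀, x₀),
      ‖H p.1 p.2.1 - H p.1 p.2.2 - _root_.fderiv ℝ (H p.1) p.2.2 (p.2.1 - p.2.2)‖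
        ≤ ε * ‖p.2.1 - p.2.2‖ := by
  have hd := h.fderiv.continuousAt
  obtain ⟨c, Hh, hc, hH, he⟩ := h
  set L := _root_.fderiv ℝ Hh (c z₀, x₀)
  have hs : HasStrictFDerivAt Hh L (c z₀, x₀) := hH.hasStrictFDerivAt (by simp)
  have h1 := hs.isLittleO.def (half_pos hε)
  have t1 : Tendsto (fun p : Z × X × X => (p.1, p.2.1)) (𝓝 (z₀, x₀, x₀)) (𝓝 (z₀, x₀)) :=
    Continuous.tendsto (by fun_prop) _
  have t2 : Tendsto (fun p : Z × X × X => (p.1, p.2.2)) (𝓝 (z₀, x₀, x₀)) (𝓝 (z₀, x₀)) :=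
    Continuous.tendsto (by fun_prop) _
  have tc : Tendsto (fun p : Z × X × X => c p.1) (𝓝 (z₀, x₀, x₀)) (𝓝 (c z₀)) :=
    hc.tendsto.comp (Continuous.tendsto (by fun_prop) _)
  have t3 : Tendsto (fun p : Z × X × X => ((c p.1, p.2.1), (c p.1, p.2.2))) (𝓝 (z₀, x₀, x₀))
      (𝓝 ((c z₀, x₀), (c z₀, x₀))) :=
    (tc.prodMk_nhds (Continuous.tendsto (by fun_prop) _)).prodMk_nhds
      (tc.prodMk_nhds (Continuous.tendsto (by fun_prop) _))
  have hL : _root_.fderiv ℝ (H z₀) x₀ = L.comp (ContinuousLinearMap.inr ℝ B X) := by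
    have h2 : ∀ᶠ x in 𝓝 x₀, H z₀ x = Hh (c z₀, x) :=
      (Continuous.tendsto (by fun_prop : Continuous fun x => (z₀, x)) x₀).eventually he
    rw [Filter.EventuallyEq.fderiv_eq h2]
    exact (hs.hasFDerivAt.comp x₀ (hasFDerivAt_prodMk_right (c z₀) x₀)).fderiv
  have h4 := (hd.tendsto.comp t2).eventually (Metric.ball_mem_nhds _ (half_pos hε))
  filter_upwards [t1.eventually he, t2.eventually he, t3.eventually h1, h4] with p e1 e2 e3 e4
  simp only [Function.comp_apply, dist_eq_norm, hL] at e4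
  rw [e1, e2]
  have e5 : L ((c p.1, p.2.1) - (c p.1, p.2.2)) =
      (L.comp (ContinuousLinearMap.inr ℝ B X)) (p.2.1 - p.2.2) := by simp
  have e6 : ‖((c p.1, p.2.1) : B × X) - (c p.1, p.2.2)‖ = ‖p.2.1 - p.2.2‖ := by simp
  rw [e5, e6] at e3
  have e7 := ContinuousLinearMap.le_opNorm (_root_.fderiv ℝ (H p.1) p.2.2 -
    L.comp (ContinuousLinearMap.inr ℝ B X)) (p.2.1 - p.2.2)
  rw [sub_apply] at e7
  have e8 : ‖_root_.fderiv ℝ (H p.1) p.2.2 - L.comp (ContinuousLinearMap.inr ℝ B X)‖ *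
      ‖p.2.1 - p.2.2‖ ≤ ε / 2 * ‖p.2.1 - p.2.2‖ :=
    mul_le_mul_of_nonneg_right e4.le (norm_nonneg _)
  calc _ = ‖(Hh (c p.1, p.2.1) - Hh (c p.1, p.2.2) -
          (L.comp (ContinuousLinearMap.inr ℝ B X)) (p.2.1 - p.2.2)) -
        (_root_.fderiv ℝ (H p.1) p.2.2 (p.2.1 - p.2.2) -
          (L.comp (ContinuousLinearMap.inr ℝ B X)) (p.2.1 - p.2.2))‖ := by congr 1; abel
    _ ≤ _ := norm_sub_le _ _
    _ ≤ ε * ‖p.2.1 - p.2.2‖ := by linarith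

end SmoothFamily

/-! ### Smoothness of superposition operators on spaces of continuous functions -/

section Nemytskii

variable {Z : Type uZ} [TopologicalSpace Z] [CompactSpace Z]
  {B : Type uB} [NormedAddCommGroup B] [NormedSpace ℝ B]
  {X : Type uX} [NormedAddCommGroup X] [NormedSpace ℝ X]

/-- The superposition operator `ξ ↦ (z ↦ H z (ξ z))` on spaces of continuous functions. -/
def superposition {W : Type uW} [NormedAddCommGroup W] (H : Z → X → W) (ξ : C(Z, X)) : C(Z, W) :=
  open Classical in if h : Continuous fun z => H z (ξ z) then ⟨_, h⟩ else 0

/-- A continuous family of continuous linear maps acts pointwise on continuous functions. -/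
def pointwiseCLM (Z : Type uZ) [TopologicalSpace Z] [CompactSpace Z]
    (X : Type uX) [NormedAddCommGroup X] [NormedSpace ℝ X]
    (W : Type uW) [NormedAddCommGroup W] [NormedSpace ℝ W] :
    C(Z, X →L[ℝ] W) →L[ℝ] C(Z, X) →L[ℝ] C(Z, W) :=
  LinearMap.mkContinuous₂
    (LinearMap.mk₂ ℝ (fun (A : C(Z, X →L[ℝ] W)) (ξ : C(Z, X)) =>
        (⟨fun z => A z (ξ z), A.continuous.clm_apply ξ.continuous⟩ : C(Z, W)))
      (fun A A' ξ => by ext z; simp) (fun r A ξ => by ext z; simp)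
      (fun A ξ ζ => by ext z; simp) (fun r A ξ => by ext z; simp)) 1 (fun A ξ => by
        rw [ContinuousMap.norm_le _ (by positivity)]
        intro z
        rw [one_mul]
        exact ((A z).le_opNorm _).trans
          (mul_le_mul (A.norm_coe_le_norm z) (ξ.norm_coe_le_norm z) (norm_nonneg _)
            (norm_nonneg A)))

@[simp] theorem pointwiseCLM_apply {W : Type uW} [NormedAddCommGroup W] [NormedSpace ℝ W]
    (A : C(Z, X →L[ℝ] W)) (ξ : C(Z, X)) (z : Z) : pointwiseCLM Z X W A ξ z = A z (ξ z) := rfl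

variable {W : Type uW} [NormedAddCommGroup W] [NormedSpace ℝ W] {H : Z → X → W} {r : Set X}

theorem continuous_of_smoothFamilyAt (hH : ∀ z, ∀ x ∈ r, SmoothFamilyAt B H z x) {ξ : C(Z, X)}
    (hξ : ∀ z, ξ z ∈ r) : Continuous fun z => H z (ξ z) := by
  rw [continuous_iff_continuousAt]
  intro z
  exact ContinuousAt.comp (f := fun z => (z, ξ z)) (x := z) (hH z _ (hξ z)).continuousAt
    (by fun_prop)

theorem superposition_apply (hH : ∀ z, ∀ x ∈ r, SmoothFamilyAt B H z x) {ξ : C(Z, X)}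
    (hξ : ∀ z, ξ z ∈ r) (z : Z) : superposition H ξ z = H z (ξ z) := by
  rw [superposition, dif_pos (continuous_of_smoothFamilyAt hH hξ)]
  rfl

theorem isOpen_setOf_forall_mem {X : Type*} [TopologicalSpace X] {r : Set X} (hr : IsOpen r) :
    IsOpen {ξ : C(Z, X) | ∀ z, ξ z ∈ r} := by
  have := ContinuousMap.isOpen_setOfPred_mapsTo (X := Z) (Y := X) isCompact_univ hr
  simpa [MapsTo] using this

/-- Compactness of `Z` turns the local estimate of `SmoothFamilyAt.eventually_norm_sub_le` into one
that holds at all `z` at once, which is an estimate in the sup norm. -/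
theorem hasFDerivAt_superposition (hr : IsOpen r) (hH : ∀ z, ∀ x ∈ r, SmoothFamilyAt B H z x)
    {ξ : C(Z, X)} (hξ : ∀ z, ξ z ∈ r) :
    HasFDerivAt (superposition H)
      (pointwiseCLM Z X W (superposition (fun z x => fderiv ℝ (H z) x) ξ)) ξ := by
  rw [hasFDerivAt_iff_isLittleO, Asymptotics.isLittleO_iff]
  intro ε hε
  have hH' : ∀ z, ∀ x ∈ r, SmoothFamilyAt B (fun z x => fderiv ℝ (H z) x) z x :=
    fun z x hx => (hH z x hx).fderiv
  have h1 : ∀ᶠ ζ : C(Z, X) in 𝓝 ξ, ∀ z ∈ (univ : Set Z),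
      ‖H z (ζ z) - H z (ξ z) - fderiv ℝ (H z) (ξ z) (ζ z - ξ z)‖ ≤ ε * ‖ζ z - ξ z‖ := by
    refine isCompact_univ.eventually_forall_of_forall_eventually fun z _ => ?_
    have t : Tendsto (fun q : C(Z, X) × Z => (q.2, q.1 q.2, ξ q.2)) (𝓝 (ξ, z))
        (𝓝 (z, ξ z, ξ z)) := by
      refine Continuous.tendsto (f := fun q : C(Z, X) × Z => (q.2, q.1 q.2, ξ q.2)) ?_ (ξ, z)
      fun_prop
    exact t.eventually ((hH z _ (hξ z)).eventually_norm_sub_le hε)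
  filter_upwards [h1, (isOpen_setOf_forall_mem hr).mem_nhds hξ] with ζ hζ hζr
  rw [ContinuousMap.norm_le _ (by positivity)]
  intro z
  have := hζ z (mem_univ z)
  rw [ContinuousMap.sub_apply, ContinuousMap.sub_apply, pointwiseCLM_apply,
    superposition_apply hH hζr, superposition_apply hH hξ, superposition_apply hH' hξ]
  exact this.trans (mul_le_mul_of_nonneg_left ((ζ - ξ).norm_coe_le_norm z) hε.le)

/-- The derivative is the superposition operator of the family of derivatives followed by a bounded
linear map, so induction on `n` applies. The step replaces `W` by `X →L[ℝ] W`; taking `W` in the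
universe `max uX uW` keeps the induction inside one universe. -/
theorem contDiffOn_superposition_nat (hr : IsOpen r) (n : ℕ) :
    ∀ {W : Type max uX uW} [NormedAddCommGroup W] [NormedSpace ℝ W] {H : Z → X → W},
    (∀ z, ∀ x ∈ r, SmoothFamilyAt B H z x) →
    ContDiffOn ℝ n (superposition H) {ξ : C(Z, X) | ∀ z, ξ z ∈ r} := by
  induction n with
  | zero =>
    intro W _ _ H hH
    rw [Nat.cast_zero, contDiffOn_zero]
    exact fun ξ hξ => (hasFDerivAt_superposition hr hH hξ).continuousAt.continuousWithinAt
  | succ n ih =>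
    intro W _ _ H hH
    rw [Nat.cast_succ, contDiffOn_succ_iff_fderiv_of_isOpen (isOpen_setOf_forall_mem hr)]
    refine ⟨fun ξ hξ =>
      (hasFDerivAt_superposition hr hH hξ).differentiableAt.differentiableWithinAt, by simp, ?_⟩
    have := ih (H := fun z x => fderiv ℝ (H z) x) (fun z x hx => (hH z x hx).fderiv)
    refine ((pointwiseCLM Z X W).contDiff.comp_contDiffOn this).congr fun ξ hξ => ?_
    exact (hasFDerivAt_superposition hr hH hξ).fderiv

theorem contDiffOn_superposition (hr : IsOpen r) (hH : ∀ z, ∀ x ∈ r, SmoothFamilyAt B H z x) :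
    ContDiffOn ℝ ∞ (superposition H) {ξ : C(Z, X) | ∀ z, ξ z ∈ r} := by
  -- Lifting `W` places it in the universe required by `contDiffOn_superposition_nat`.
  let e : ULift.{uX} W ≃L[ℝ] W := ContinuousLinearEquiv.ulift
  have hH' : ∀ z, ∀ x ∈ r, SmoothFamilyAt B (fun z x => e.symm (H z x)) z x := by
    intro z x hx
    obtain ⟨c, Hh, hc, hHh, he⟩ := hH z x hx
    exact ⟨c, fun p => e.symm (Hh p), hc, e.symm.contDiff.contDiffAt.comp _ hHh,
      he.mono fun p hp => congrArg e.symm hp⟩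
  have h2 : ContDiffOn ℝ ∞ (superposition fun z x => e.symm (H z x))
      {ξ : C(Z, X) | ∀ z, ξ z ∈ r} :=
    contDiffOn_infty.2 fun n => contDiffOn_superposition_nat hr n hH'
  refine (((e : ULift.{uX} W →L[ℝ] W).compLeftContinuous ℝ Z).contDiff.comp_contDiffOn h2).congr
    fun ξ hξ => ?_
  ext z
  simp [superposition_apply hH hξ, superposition_apply hH' hξ]

end Nemytskii

/-! ### The implicit function theorem with smoothness on a neighbourhood -/

section Implicit

variable {X : Type*} [NormedAddCommGroup X] [NormedSpace ℝ X] [CompleteSpace X]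
  {V : Type*} [NormedAddCommGroup V] [NormedSpace ℝ V] [CompleteSpace V]
  {W : Type*} [NormedAddCommGroup W] [NormedSpace ℝ W] [CompleteSpace W]

/-- `ContDiffAt ℝ ∞` at one point does not give it nearby, since the neighbourhood may shrink with
the order. Hypothesis and conclusion are therefore both stated on a neighbourhood, and the last
clause records local uniqueness. -/
theorem ContDiffAt.exists_implicit {f : X × V → W} {x₀ : X} {v₀ : V}
    (hf : ∀ᶠ p in 𝓝 (x₀, v₀), ContDiffAt ℝ ∞ f p) (h0 : f (x₀, v₀) = 0)
    {f' : V →L[ℝ] W} (hf' : HasFDerivAt (fun v => f (x₀, v)) f' v₀)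
    (hb : Function.Bijective f') :
    ∃ φ : X → V, φ x₀ = v₀ ∧ (∀ᶠ x in 𝓝 x₀, ContDiffAt ℝ ∞ φ x) ∧
      (∀ᶠ x in 𝓝 x₀, f (x, φ x) = 0) ∧
      ∀ᶠ p in 𝓝 (x₀, v₀), f p = 0 → p.2 = φ p.1 := by
  have hd : ∀ᶠ p in 𝓝 (x₀, v₀), ContinuousAt (fderiv ℝ f) p := by
    filter_upwards [hf] with p hp
    exact (hp.fderiv_right (m := ∞) (by simp)).continuousAt
  have hF : fderiv ℝ f (x₀, v₀) ∘L .inr ℝ X V = f' := by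
    have := (hf.self_of_nhds.differentiableAt (by simp)).hasFDerivAt.comp v₀
      (hasFDerivAt_prodMk_right x₀ v₀)
    exact this.unique hf'
  have hinv0 : (fderiv ℝ f (x₀, v₀) ∘L .inr ℝ X V).IsInvertible := by
    rw [hF]
    exact ⟨ContinuousLinearEquiv.ofBijective f' (LinearMap.ker_eq_bot.2 hb.1)
      (LinearMap.range_eq_top.2 hb.2), by ext; rfl⟩
  have hinv : ∀ᶠ p in 𝓝 (x₀, v₀), (fderiv ℝ f p ∘L .inr ℝ X V).IsInvertible := by
    have hc : ContinuousAt (fun p => fderiv ℝ f p ∘L .inr ℝ X V) (x₀, v₀) :=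
      hd.self_of_nhds.clm_comp continuousAt_const
    obtain ⟨e, he⟩ := hinv0
    have : {L : V →L[ℝ] W | L.IsInvertible} ∈ 𝓝 (fderiv ℝ f (x₀, v₀) ∘L .inr ℝ X V) := by
      rw [← he]
      exact ContinuousLinearEquiv.nhds e
    exact hc.eventually this
  have hn : (∞ : ℕ∞ω) ≠ 0 := by simp
  have cdf := hf.self_of_nhds
  refine ⟨cdf.implicitFunction hn hinv0, cdf.implicitFunction_apply_self hn hinv0, ?_, ?_, ?_⟩
  · have hc : ContinuousAt (cdf.implicitFunction hn hinv0) x₀ :=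
      (cdf.contDiffAt_implicitFunction hn hinv0).continuousAt
    have t : Tendsto (fun x => (x, cdf.implicitFunction hn hinv0 x)) (𝓝 x₀) (𝓝 (x₀, v₀)) := by
      have := continuousAt_id.prodMk hc
      simpa [ContinuousAt, cdf.implicitFunction_apply_self hn hinv0] using this
    have hcc : ∀ᶠ x in 𝓝 x₀, ContinuousAt (cdf.implicitFunction hn hinv0) x :=
      (((cdf.contDiffAt_implicitFunction hn hinv0).of_le (m := 1) (by simp)).eventually
        (by simp)).mono fun x hx => hx.continuousAt
    -- The partial derivative stays invertible nearby, so the implicit function theorem applies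
    -- again at `(x, φ x)`. The function it yields is smooth at `x` and coincides with the original
    -- one near `x` by uniqueness.
    filter_upwards [t.eventually (hf.and hinv), hcc,
      t.eventually (cdf.eventually_apply_eq_iff_implicitFunction hn hinv0).eventually_nhds,
      cdf.eventually_apply_implicitFunction hn hinv0] with x hx hcx hux hfx
    have cdx := hx.1
    have hself := cdx.implicitFunction_apply_self hn hx.2
    refine (cdx.contDiffAt_implicitFunction hn hx.2).congr_of_eventuallyEq ?_
    have t' : Tendsto (fun x' => (x', cdf.implicitFunction hn hinv0 x')) (𝓝 x)
        (𝓝 (x, cdf.implicitFunction hn hinv0 x)) := continuousAt_id.prodMk hcx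
    filter_upwards [t'.eventually (cdx.eventually_apply_eq_iff_implicitFunction hn hx.2),
      t'.eventually hux] with x' h1 h2
    exact (h1.1 ((h2.2 rfl).trans hfx.symm)).symm
  · filter_upwards [cdf.eventually_apply_implicitFunction hn hinv0] with x hx
    rw [hx, h0]
  · filter_upwards [cdf.eventually_apply_eq_iff_implicitFunction hn hinv0] with p hp h
    exact (hp.1 (h.trans h0.symm)).symm

end Implicit

end
-- Maps smooth near a point, and charts of a Lie group at the identity
noncomputable section

section SmoothNear

variable {V : Type*} [NormedAddCommGroup V] [NormedSpace ℝ V]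
  {D : Type*} [NormedAddCommGroup D] [NormedSpace ℝ D] {H : Type*} [TopologicalSpace H]
  {I : ModelWithCorners ℝ D H} {N : Type*} [TopologicalSpace N] [ChartedSpace H N]
  {D' : Type*} [NormedAddCommGroup D'] [NormedSpace ℝ D'] {H' : Type*} [TopologicalSpace H']
  {I' : ModelWithCorners ℝ D' H'} {N' : Type*} [TopologicalSpace N'] [ChartedSpace H' N']

/-- `f` is smooth in a neighbourhood of `p₀`. -/
def SmoothNear (I : ModelWithCorners ℝ D H) (f : V → N) (p₀ : V) : Prop :=
  ∀ᶠ p in 𝓝 p₀, ContMDiffAt 𝓘(ℝ, V) I ∞ f p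

theorem SmoothNear.continuousAt {f : V → N} {p₀ : V} (h : SmoothNear I f p₀) :
    ContinuousAt f p₀ := h.self_of_nhds.continuousAt

theorem SmoothNear.congr {f g : V → N} {p₀ : V} (h : SmoothNear I f p₀)
    (hfg : ∀ᶠ p in 𝓝 p₀, g p = f p) : SmoothNear I g p₀ := by
  filter_upwards [h, hfg.eventually_nhds] with p hp hq
  exact hp.congr_of_eventuallyEq hq

theorem SmoothNear.comp {f : V → N} {p₀ : V} {g : N → N'}
    (hg : ∀ᶠ n in 𝓝 (f p₀), ContMDiffAt I I' ∞ g n) (hf : SmoothNear I f p₀) :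
    SmoothNear I' (fun p => g (f p)) p₀ := by
  filter_upwards [hf, hf.continuousAt.eventually hg] with p h1 h2
  exact ContMDiffAt.comp p h2 h1

theorem SmoothNear.prodMk {f : V → N} {g : V → N'} {p₀ : V} (hf : SmoothNear I f p₀)
    (hg : SmoothNear I' g p₀) : SmoothNear (I.prod I') (fun p => (f p, g p)) p₀ := by
  filter_upwards [hf, hg] with p h1 h2
  exact h1.prodMk h2

theorem ContMDiff.smoothNear {f : V → N} (hf : ContMDiff 𝓘(ℝ, V) I ∞ f) (p₀ : V) :
    SmoothNear I f p₀ := Eventually.of_forall fun p => hf p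

theorem smoothNear_const (n : N) (p₀ : V) : SmoothNear I (fun _ : V => n) p₀ :=
  contMDiff_const.smoothNear p₀

theorem ContDiff.smoothNear {f : V → D} (hf : ContDiff ℝ ∞ f) (p₀ : V) :
    SmoothNear 𝓘(ℝ, D) f p₀ := hf.contMDiff.smoothNear p₀

theorem SmoothNear.contDiffAt {f : V → D} {p₀ : V} (hf : SmoothNear 𝓘(ℝ, D) f p₀) :
    ∀ᶠ p in 𝓝 p₀, ContDiffAt ℝ ∞ f p := hf.mono fun _ hp => hp.contDiffAt

theorem SmoothNear.of_contDiffAt {f : V → D} {p₀ : V} (hf : ∀ᶠ p in 𝓝 p₀, ContDiffAt ℝ ∞ f p) :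
    SmoothNear 𝓘(ℝ, D) f p₀ := hf.mono fun _ hp => hp.contMDiffAt

theorem SmoothNear.comp_contDiff {f : V → D} {p₀ : V} {g : D → D'}
    (hg : ContDiff ℝ ∞ g) (hf : SmoothNear 𝓘(ℝ, D) f p₀) :
    SmoothNear 𝓘(ℝ, D') (fun p => g (f p)) p₀ :=
  hf.comp (Eventually.of_forall fun _ => hg.contMDiff.contMDiffAt)

theorem SmoothNear.smul {f : V → ℝ} {g : V → D} {p₀ : V} (hf : SmoothNear 𝓘(ℝ, ℝ) f p₀)
    (hg : SmoothNear 𝓘(ℝ, D) g p₀) : SmoothNear 𝓘(ℝ, D) (fun p => f p • g p) p₀ := by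
  filter_upwards [hf, hg] with p h1 h2
  exact h1.smul h2

/-- Partial derivatives of smooth maps are smooth. -/
theorem SmoothNear.partial_fderiv {f : V → D} {p₀ : V} (hf : SmoothNear 𝓘(ℝ, D) f p₀)
    (L : D' →L[ℝ] V) {j : V → D' → V} {l : V → D'}
    (hj : ∀ p v, j p v = p + L (v - l p)) :
    SmoothNear 𝓘(ℝ, D' →L[ℝ] D) (fun p => fderiv ℝ (fun v => f (j p v)) (l p)) p₀ := by
  have h1 : ∀ᶠ p in 𝓝 p₀, fderiv ℝ (fun v => f (j p v)) (l p) = (fderiv ℝ f p).comp L := by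
    filter_upwards [hf.contDiffAt] with p hp
    have h2 : HasFDerivAt (j p) L (l p) := by
      have : j p = fun v => p + L (v - l p) := funext (hj p)
      rw [this]
      exact ((L.hasFDerivAt.comp (l p) ((hasFDerivAt_id (l p)).sub_const (l p))).const_add p)
    have h3 : j p (l p) = p := by rw [hj]; simp
    have h4 : HasFDerivAt f (fderiv ℝ f p) (j p (l p)) := by
      rw [h3]; exact (hp.differentiableAt (by simp)).hasFDerivAt
    exact (h4.comp (l p) h2).fderiv
  refine SmoothNear.congr ?_ h1
  refine SmoothNear.of_contDiffAt ?_
  filter_upwards [hf.contDiffAt] with p hp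
  exact (hp.fderiv_right (m := ∞) (by simp)).clm_comp contDiffAt_const

variable {G : Type*} [Group G] [TopologicalSpace G] [ChartedSpace H G] [LieGroup I ∞ G]

theorem SmoothNear.mul {f g : V → G} {p₀ : V} (hf : SmoothNear I f p₀) (hg : SmoothNear I g p₀) :
    SmoothNear I (fun p => f p * g p) p₀ := by
  filter_upwards [hf, hg] with p h1 h2
  exact h1.mul h2

theorem SmoothNear.inv {f : V → G} {p₀ : V} (hf : SmoothNear I f p₀) :
    SmoothNear I (fun p => (f p)⁻¹) p₀ := by
  filter_upwards [hf] with p h1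
  exact h1.inv

end SmoothNear

section SmoothFamilyNear

variable {Z : Type*} [TopologicalSpace Z]
  {B : Type*} [NormedAddCommGroup B] [NormedSpace ℝ B]
  {X : Type*} [NormedAddCommGroup X] [NormedSpace ℝ X]
  {W : Type*} [NormedAddCommGroup W] [NormedSpace ℝ W]

/-- The parameter is placed second in the conclusion so that it can be fed directly to the tube
lemma over a compact `Z`. -/
theorem eventually_smoothFamilyAt {H : Z → X → W} {z₀ : Z} {x₀ : X} {c : Z → B} {Hh : B × X → W}
    (hc : ∀ᶠ z in 𝓝 z₀, ContinuousAt c z) (hH : SmoothNear 𝓘(ℝ, W) Hh (c z₀, x₀))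
    (he : ∀ᶠ p in 𝓝 (z₀, x₀), H p.1 p.2 = Hh (c p.1, p.2)) :
    ∀ᶠ p in 𝓝 (x₀, z₀), SmoothFamilyAt B H p.2 p.1 := by
  have t : Tendsto (fun p : X × Z => (p.2, p.1)) (𝓝 (x₀, z₀)) (𝓝 (z₀, x₀)) :=
    Continuous.tendsto (by fun_prop) _
  have hc' : ContinuousAt (fun p : X × Z => (c p.2, p.1)) (x₀, z₀) :=
    (ContinuousAt.comp (f := Prod.snd) (x := (x₀, z₀)) hc.self_of_nhds continuousAt_snd).prodMk
      continuousAt_fst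
  filter_upwards [t.eventually he.eventually_nhds,
    (continuous_snd.tendsto (x₀, z₀)).eventually hc, hc'.eventually hH.contDiffAt] with p h1 h2 h3
  exact ⟨c, Hh, h2, h3, h1⟩

end SmoothFamilyNear

section ChartAtOne

variable {D : Type*} [NormedAddCommGroup D] [NormedSpace ℝ D]
  {K : Type*} [TopologicalSpace K] [Group K] [ChartedSpace D K]

/-- `c` is a smooth chart of `K` around `1`, centred at `0`. -/
structure IsUnitChart (c : OpenPartialHomeomorph K D) : Prop where
  one_mem : (1 : K) ∈ c.source
  map_one : c 1 = 0
  smooth : ∀ k ∈ c.source, ContMDiffAt 𝓘(ℝ, D) 𝓘(ℝ, D) ∞ c k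
  smooth_symm : ∀ v ∈ c.target, ContMDiffAt 𝓘(ℝ, D) 𝓘(ℝ, D) ∞ c.symm v

theorem exists_isUnitChart (D : Type*) [NormedAddCommGroup D] [NormedSpace ℝ D]
    (K : Type*) [TopologicalSpace K] [Group K] [ChartedSpace D K] [IsManifold 𝓘(ℝ, D) ∞ K] :
    ∃ c : OpenPartialHomeomorph K D, IsUnitChart c := by
  let e := chartAt D (1 : K)
  let c := e.trans (Homeomorph.subRight (e 1)).toOpenPartialHomeomorph
  have hs : c.source = e.source := by simp [c]
  have ht : ∀ v, v ∈ c.target ↔ v + e 1 ∈ e.target := by intro v; simp [c]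
  refine ⟨c, by rw [hs]; exact mem_chart_source D 1, by simp [c], fun k hk => ?_, fun v hv => ?_⟩
  · rw [hs] at hk
    have h1 : ContMDiffAt 𝓘(ℝ, D) 𝓘(ℝ, D) ∞ e k :=
      contMDiffOn_chart.contMDiffAt (e.open_source.mem_nhds hk)
    exact ContMDiffAt.comp (g := fun v : D => v - e 1) k
      (contDiff_id.sub contDiff_const).contMDiff.contMDiffAt h1
  · rw [ht] at hv
    have h1 : ContMDiffAt 𝓘(ℝ, D) 𝓘(ℝ, D) ∞ e.symm (v + e 1) :=
      contMDiffOn_chart_symm.contMDiffAt (e.open_target.mem_nhds hv)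
    exact ContMDiffAt.comp (f := fun v : D => v + e 1) v h1
      (contDiff_id.add contDiff_const).contMDiff.contMDiffAt

variable {c : OpenPartialHomeomorph K D} (hc : IsUnitChart c)
include hc

theorem IsUnitChart.zero_mem : (0 : D) ∈ c.target := hc.map_one ▸ c.map_source hc.one_mem

@[simp] theorem IsUnitChart.symm_zero : c.symm 0 = 1 := by
  rw [← hc.map_one, c.left_inv hc.one_mem]

variable {V : Type*} [NormedAddCommGroup V] [NormedSpace ℝ V]

theorem IsUnitChart.smoothNear {f : V → K} {p₀ : V} (hf : SmoothNear 𝓘(ℝ, D) f p₀)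
    (hp : f p₀ ∈ c.source) : SmoothNear 𝓘(ℝ, D) (fun p => c (f p)) p₀ :=
  hf.comp ((c.open_source.mem_nhds hp : _) |> fun h => Filter.mem_of_superset h hc.smooth)

theorem IsUnitChart.smoothNear_symm {f : V → D} {p₀ : V} (hf : SmoothNear 𝓘(ℝ, D) f p₀)
    (hp : f p₀ ∈ c.target) : SmoothNear 𝓘(ℝ, D) (fun p => c.symm (f p)) p₀ :=
  hf.comp ((c.open_target.mem_nhds hp : _) |> fun h => Filter.mem_of_superset h hc.smooth_symm)

end ChartAtOne

section Det

variable {D : Type*} [NormedAddCommGroup D] [NormedSpace ℝ D] [FiniteDimensional ℝ D]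

/-- The Leibniz formula in a basis exhibits the determinant as a polynomial in continuous linear
functionals. -/
theorem contDiff_clm_det : ContDiff ℝ ∞ (fun A : D →L[ℝ] D => A.det) := by
  classical
  let b := Module.finBasis ℝ D
  have h : ∀ A : D →L[ℝ] D, A.det =
      ∑ σ : Equiv.Perm (Fin (Module.finrank ℝ D)), (Equiv.Perm.sign σ : ℝ) *
        ∏ i, LinearMap.toContinuousLinearMap (b.coord (σ i)) (A (b i)) := by
    intro A
    rw [ContinuousLinearMap.det, ← LinearMap.det_toMatrix b, Matrix.det_apply']
    simp [LinearMap.toMatrix_apply]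
  simp_rw [h]
  refine ContDiff.sum fun σ _ => contDiff_const.mul (contDiff_prod fun i _ => ?_)
  exact (LinearMap.toContinuousLinearMap (b.coord (σ i))).contDiff.comp
    (ContinuousLinearMap.apply ℝ D (b i)).contDiff

end Det

end
-- Integration, change of variables, and smearing over a chart ball
noncomputable section

open MeasureTheory

section Integration

variable {Z : Type*} [TopologicalSpace Z] [CompactSpace Z] [MeasurableSpace Z]
  [OpensMeasurableSpace Z]
  {W : Type*} [NormedAddCommGroup W] [NormedSpace ℝ W]

theorem ContinuousMap.integrable_of_compactSpace (φ : C(Z, W)) (μ : Measure Z)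
    [IsFiniteMeasure μ] : Integrable φ μ :=
  φ.continuous.integrable_of_hasCompactSupport (HasCompactSupport.of_compactSpace _)

/-- Integration as a continuous linear functional on continuous functions. -/
def integralCLM (μ : Measure Z) [IsFiniteMeasure μ] : C(Z, W) →L[ℝ] W :=
  LinearMap.mkContinuous
    { toFun := fun φ => ∫ z, φ z ∂μ
      map_add' := fun φ ψ =>
        integral_add (φ.integrable_of_compactSpace μ) (ψ.integrable_of_compactSpace μ)
      map_smul' := fun r φ => integral_smul r φ } (μ.real univ) (fun φ => by
        rw [mul_comm]
        exact norm_integral_le_of_norm_le_const (Eventually.of_forall φ.norm_coe_le_norm))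

theorem integralCLM_apply (μ : Measure Z) [IsFiniteMeasure μ] (φ : C(Z, W)) :
    integralCLM μ φ = ∫ z, φ z ∂μ := rfl

variable {D : Type*} [NormedAddCommGroup D] [NormedSpace ℝ D] [FiniteDimensional ℝ D]
  [MeasurableSpace D] [BorelSpace D] (ν : Measure D) [ν.IsAddHaarMeasure]

/-- `f` need not preserve the ball of radius `R`. It is enough that its image covers the ball of
radius `R / 2`, outside which `θ` vanishes: both sides then equal the integral over the whole space.
-/
theorem setIntegral_closedBall_comp {R : ℝ} {θ : D → ℝ} {Φ : D → W} {f : D → D}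
    (hθ : ∀ v, v ∉ Metric.closedBall (0 : D) (R / 2) → θ v = 0) (hR : 0 < R)
    (hd : ∀ v ∈ Metric.closedBall (0 : D) R, DifferentiableAt ℝ f v)
    (hdet : ∀ v ∈ Metric.closedBall (0 : D) R, 0 < (fderiv ℝ f v).det)
    (hinj : InjOn f (Metric.closedBall (0 : D) R))
    (hsurj : ∀ v ∈ Metric.closedBall (0 : D) (R / 2), ∃ v' ∈ Metric.closedBall (0 : D) R,
      f v' = v) :
    ∫ v in Metric.closedBall (0 : D) R, θ v • Φ v ∂ν =
      ∫ v in Metric.closedBall (0 : D) R, ((fderiv ℝ f v).det * θ (f v)) • Φ (f v) ∂ν := by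
  have h1 := integral_image_eq_integral_abs_det_fderiv_smul ν
    (Metric.isClosed_closedBall (x := (0 : D)) (ε := R)).measurableSet
    (fun v hv => (hd v hv).hasFDerivAt.hasFDerivWithinAt) hinj (fun v => θ v • Φ v)
  have h2 : ∫ v in f '' Metric.closedBall (0 : D) R, θ v • Φ v ∂ν = ∫ v, θ v • Φ v ∂ν := by
    refine setIntegral_eq_integral_of_forall_compl_eq_zero fun v hv => ?_
    rw [hθ v fun h => hv (by obtain ⟨v', h1, h2⟩ := hsurj v h; exact ⟨v', h1, h2⟩), zero_smul]
  have h3 : ∫ v in Metric.closedBall (0 : D) R, θ v • Φ v ∂ν = ∫ v, θ v • Φ v ∂ν := by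
    refine setIntegral_eq_integral_of_forall_compl_eq_zero fun v hv => ?_
    rw [hθ v fun h => hv (Metric.closedBall_subset_closedBall (by linarith) h), zero_smul]
  rw [h3, ← h2, h1]
  refine setIntegral_congr_fun Metric.isClosed_closedBall.measurableSet fun v hv => ?_
  simp only [abs_of_pos (hdet v hv), smul_smul]

variable {K : Type*} [TopologicalSpace K] [Group K] [IsTopologicalGroup K] [CompactSpace K]
  [SecondCountableTopology K] [MeasurableSpace K] [BorelSpace K]
  (m : Measure K) [IsProbabilityMeasure m] [m.IsMulLeftInvariant] [CompleteSpace W]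

/-- By left invariance, each translate `b ↦ Φ (τ v * b)` has the same integral as `Φ`; averaging
over `v` with total weight `1` changes nothing, and Fubini exchanges the integrals. The extra
variable `v` makes a Euclidean change of variables possible. -/
theorem integral_eq_integral_smear {R : ℝ} {τ : D → K} {θ : D → ℝ}
    (hτ : ContinuousOn τ (Metric.closedBall (0 : D) R)) (hθc : Continuous θ)
    (hθ : ∫ v in Metric.closedBall (0 : D) R, θ v ∂ν = 1) {Φ : K → W} (hΦ : Continuous Φ) :
    ∫ b, Φ b ∂m = ∫ b, ∫ v in Metric.closedBall (0 : D) R, θ v • Φ (τ v * b) ∂ν ∂m := by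
  let S := Metric.closedBall (0 : D) R
  have hS : MeasurableSet S := Metric.isClosed_closedBall.measurableSet
  have : CompactSpace S := isCompact_iff_compactSpace.1 (isCompact_closedBall _ _)
  let σ : Measure S := ν.comap Subtype.val
  have : IsFiniteMeasure σ := ⟨by
    rw [comap_subtype_coe_apply hS]
    simpa using (isCompact_closedBall (0 : D) R).measure_lt_top⟩
  have hσ : ∀ f : D → W, ∫ v in S, f v ∂ν = ∫ v : S, f v ∂σ :=
    fun f => (integral_subtype_comap hS f).symm
  have hσ1 : ∫ v : S, θ v ∂σ = 1 := (integral_subtype_comap hS θ).trans hθ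
  have hτ' : Continuous fun v : S => τ v := hτ.domRestrict
  have hF : Continuous fun p : K × S => θ p.2 • Φ (τ p.2 * p.1) :=
    (hθc.comp (continuous_subtype_val.comp continuous_snd)).smul
      (hΦ.comp ((hτ'.comp continuous_snd).mul continuous_fst))
  have hint : Integrable (fun p : K × S => θ p.2 • Φ (τ p.2 * p.1)) (m.prod σ) :=
    hF.integrable_of_hasCompactSupport (HasCompactSupport.of_compactSpace _)
  calc ∫ b, Φ b ∂m = ∫ v : S, θ v • ∫ b, Φ b ∂m ∂σ := by
        rw [integral_smul_const, hσ1, one_smul]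
    _ = ∫ v : S, ∫ b, θ v • Φ (τ v * b) ∂m ∂σ := by
        congr 1 with v
        rw [integral_smul, integral_mul_left_eq_self]
    _ = ∫ b, ∫ v : S, θ v • Φ (τ v * b) ∂σ ∂m := (integral_integral_swap hint).symm
    _ = _ := by
        congr 1 with b
        exact (hσ fun v => θ v • Φ (τ v * b)).symm

end Integration

/-! ### Local groupoids and the averaged defect of multiplicativity -/

/-- A family of smooth multiplications on a group `K`, parametrized by `y ∈ E` near `0`, deforming
the group multiplication. It models a Lie groupoid near the isotropy group `K` of a fixed point:
`(a, y)` is an arrow from `y` to `tgt a y`, and `(b, tgt a y) (a, y) = (mul b a y, y)`. -/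
structure LocalGroupoid (D : Type*) [NormedAddCommGroup D] [NormedSpace ℝ D]
    (E : Type*) [NormedAddCommGroup E] [NormedSpace ℝ E]
    (K : Type*) [TopologicalSpace K] [Group K] [ChartedSpace D K] where
  dom : Set E
  isOpen_dom : IsOpen dom
  zero_mem : (0 : E) ∈ dom
  mul : K → K → E → K
  div : K → K → E → K
  tgt : K → E → E
  smooth_mul : ∀ b a, ∀ y ∈ dom, ContMDiffAt (𝓘(ℝ, D).prod (𝓘(ℝ, D).prod 𝓘(ℝ, E))) 𝓘(ℝ, D) ∞
    (fun p : K × K × E => mul p.1 p.2.1 p.2.2) (b, a, y)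
  smooth_div : ∀ b a, ∀ y ∈ dom, ContMDiffAt (𝓘(ℝ, D).prod (𝓘(ℝ, D).prod 𝓘(ℝ, E))) 𝓘(ℝ, D) ∞
    (fun p : K × K × E => div p.1 p.2.1 p.2.2) (b, a, y)
  continuousAt_tgt : ∀ a, ContinuousAt (fun p : E × K => tgt p.2 p.1) (0, a)
  mul_at_zero : ∀ b a, mul b a 0 = b * a
  div_at_zero : ∀ b a, div b a 0 = b * a⁻¹
  tgt_at_zero : ∀ a, tgt a 0 = 0
  mul_assoc_near : ∀ᶠ y in 𝓝 0, ∀ a b c, mul c (mul b a y) y = mul (mul c b (tgt a y)) a y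
  mul_div_near : ∀ᶠ y in 𝓝 0, ∀ h a, mul (div h a y) a y = h
  div_mul_near : ∀ᶠ y in 𝓝 0, ∀ b a, div (mul b a y) a y = b
  one_mul_near : ∀ᶠ y in 𝓝 0, ∀ a, mul 1 a y = a

section Defect

variable {D : Type*} [NormedAddCommGroup D] [NormedSpace ℝ D]
  {E : Type*} [NormedAddCommGroup E] [NormedSpace ℝ E]
  {K : Type*} [TopologicalSpace K] [Group K] [ChartedSpace D K]

namespace LocalGroupoid

theorem continuousAt_mul (Γ : LocalGroupoid D E K) {b a : K} {y : E} (hy : y ∈ Γ.dom) :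
    ContinuousAt (fun p : K × K × E => Γ.mul p.1 p.2.1 p.2.2) (b, a, y) :=
  (Γ.smooth_mul b a y hy).continuousAt

theorem continuousAt_div (Γ : LocalGroupoid D E K) {b a : K} {y : E} (hy : y ∈ Γ.dom) :
    ContinuousAt (fun p : K × K × E => Γ.div p.1 p.2.1 p.2.2) (b, a, y) :=
  (Γ.smooth_div b a y hy).continuousAt

variable {V : Type*} [NormedAddCommGroup V] [NormedSpace ℝ V]

theorem smoothNear_div (Γ : LocalGroupoid D E K) {fb fa : V → K} {fy : V → E} {p₀ : V}
    (hb : SmoothNear 𝓘(ℝ, D) fb p₀) (ha : SmoothNear 𝓘(ℝ, D) fa p₀)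
    (hy : SmoothNear 𝓘(ℝ, E) fy p₀) (h0 : fy p₀ ∈ Γ.dom) :
    SmoothNear 𝓘(ℝ, D) (fun p => Γ.div (fb p) (fa p) (fy p)) p₀ := by
  refine SmoothNear.comp (g := fun p : K × K × E => Γ.div p.1 p.2.1 p.2.2) ?_
    (hb.prodMk (ha.prodMk hy))
  have : (fun p : K × K × E => p.2.2) ⁻¹' Γ.dom ∈ 𝓝 (fb p₀, fa p₀, fy p₀) :=
    (Γ.isOpen_dom.preimage (by fun_prop)).mem_nhds h0
  filter_upwards [this] with q hq
  exact Γ.smooth_div _ _ _ hq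

/-- The element `b⁻¹ (k e(w)) e(γ) (a e(e))⁻¹`, where `e = c⁻¹`. -/
def defectArg (c : OpenPartialHomeomorph K D) (a b k : K) (e γ w : D) : K :=
  b⁻¹ * (k * c.symm w) * c.symm γ * (a * c.symm e)⁻¹

/-- The averaged failure of `k ↦ k e(η k)` to be multiplicative (up to the constant `e(γ)`). -/
def defect (Γ : LocalGroupoid D E K) (c : OpenPartialHomeomorph K D) [MeasurableSpace K]
    (m : Measure K) (a : K) (y : E) (e γ : D) (η : C(K, D)) : D :=
  ∫ b, c (defectArg c a b (Γ.mul b a y) e γ (η (Γ.mul b a y))) ∂m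

/-- The coordinate of `b` such that `mul (c⁻¹(coordinate) * b) a y = c⁻¹(v) * b * a₀`. -/
def quotCoord (Γ : LocalGroupoid D E K) (c : OpenPartialHomeomorph K D) (a₀ b : K) (v : D)
    (a : K) (y : E) : D :=
  c (Γ.div (c.symm v * b * a₀) a y * b⁻¹)

variable [LieGroup 𝓘(ℝ, D) ∞ K] {c : OpenPartialHomeomorph K D}

theorem smoothNear_defectArg (hc : IsUnitChart c) {fa fb fk : V → K} {fe fγ fw : V → D} {p₀ : V}
    (ha : SmoothNear 𝓘(ℝ, D) fa p₀) (hb : SmoothNear 𝓘(ℝ, D) fb p₀)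
    (hk : SmoothNear 𝓘(ℝ, D) fk p₀)
    (he : SmoothNear 𝓘(ℝ, D) fe p₀) (hγ : SmoothNear 𝓘(ℝ, D) fγ p₀)
    (hw : SmoothNear 𝓘(ℝ, D) fw p₀) (he0 : fe p₀ = 0) (hγ0 : fγ p₀ = 0) (hw0 : fw p₀ = 0) :
    SmoothNear 𝓘(ℝ, D) (fun p => defectArg c (fa p) (fb p) (fk p) (fe p) (fγ p) (fw p)) p₀ :=
  (((hb.inv.mul (hk.mul (hc.smoothNear_symm hw (hw0 ▸ hc.zero_mem)))).mul
    (hc.smoothNear_symm hγ (hγ0 ▸ hc.zero_mem))).mul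
      (ha.mul (hc.smoothNear_symm he (he0 ▸ hc.zero_mem))).inv)

theorem smoothNear_quotCoord (Γ : LocalGroupoid D E K) (hc : IsUnitChart c) {a₀ : K}
    {fb fa : V → K} {fv : V → D} {fy : V → E} {p₀ : V}
    (hb : SmoothNear 𝓘(ℝ, D) fb p₀) (hv : SmoothNear 𝓘(ℝ, D) fv p₀)
    (ha : SmoothNear 𝓘(ℝ, D) fa p₀) (hy : SmoothNear 𝓘(ℝ, E) fy p₀)
    (ha0 : fa p₀ = a₀) (hy0 : fy p₀ = 0) (hv0 : fv p₀ ∈ c.target) :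
    SmoothNear 𝓘(ℝ, D) (fun p => Γ.quotCoord c a₀ (fb p) (fv p) (fa p) (fy p)) p₀ := by
  have h1 : SmoothNear 𝓘(ℝ, D) (fun p => Γ.div (c.symm (fv p) * fb p * a₀) (fa p) (fy p)) p₀ :=
    Γ.smoothNear_div (((hc.smoothNear_symm hv hv0).mul hb).mul (smoothNear_const a₀ p₀)) ha hy
      (hy0 ▸ Γ.zero_mem)
  refine hc.smoothNear (h1.mul hb.inv) ?_
  rw [ha0, hy0, Γ.div_at_zero]
  simpa using c.map_target hv0

end LocalGroupoid

end Defect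

end
-- The change of variables in the chart ball
noncomputable section

open MeasureTheory

namespace LocalGroupoid

variable {D : Type*} [NormedAddCommGroup D] [NormedSpace ℝ D] [FiniteDimensional ℝ D]
  {E : Type*} [NormedAddCommGroup E] [NormedSpace ℝ E]
  {K : Type*} [TopologicalSpace K] [Group K] [ChartedSpace D K] [LieGroup 𝓘(ℝ, D) ∞ K]
  {c : OpenPartialHomeomorph K D}

theorem _root_.IsUnitChart.eventually_mul_inv_mem (hc : IsUnitChart c) (b₀ : K) :
    ∀ᶠ b in 𝓝 b₀, b * b₀⁻¹ ∈ c.source := by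
  have := topologicalGroup_of_lieGroup 𝓘(ℝ, D) ∞ (G := K)
  have : ContinuousAt (fun b => b * b₀⁻¹) b₀ := by fun_prop
  exact this.eventually_mem (c.open_source.mem_nhds (by simpa using hc.one_mem))

theorem _root_.OpenPartialHomeomorph.continuousAt_mul_inv {c : OpenPartialHomeomorph K D} {b b₀ : K} (h : b * b₀⁻¹ ∈ c.source) :
    ContinuousAt (fun b => c (b * b₀⁻¹)) b := by
  have := topologicalGroup_of_lieGroup 𝓘(ℝ, D) ∞ (G := K)
  exact ContinuousAt.comp (f := fun b => b * b₀⁻¹) (c.continuousAt h) (by fun_prop)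

/-- Right translation by `b₀⁻¹` and `a₀⁻¹` followed by `c` gives coordinates for the parameters `b`
and `a`, in which the expression is jointly smooth. -/
theorem eventually_smoothFamilyAt_quotCoord (Γ : LocalGroupoid D E K) (hc : IsUnitChart c)
    (a₀ b₀ : K) {v₀ : D} (hv : v₀ ∈ c.target) :
    ∀ᶠ p in 𝓝 (v₀, ((b₀, a₀, 0) : K × K × E)), SmoothFamilyAt (D × D × E)
      (fun (z : K × K × E) v => Γ.quotCoord c a₀ z.1 v z.2.1 z.2.2) p.2 p.1 := by
  have e1 : ∀ᶠ z : K × K × E in 𝓝 (b₀, a₀, 0), z.1 * b₀⁻¹ ∈ c.source :=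
    (continuous_fst.tendsto (b₀, a₀, (0 : E))).eventually (hc.eventually_mul_inv_mem b₀)
  have e2 : ∀ᶠ z : K × K × E in 𝓝 (b₀, a₀, 0), z.2.1 * a₀⁻¹ ∈ c.source :=
    ((continuous_fst.comp continuous_snd).tendsto (b₀, a₀, (0 : E))).eventually
      (hc.eventually_mul_inv_mem a₀)
  refine eventually_smoothFamilyAt
    (c := fun z : K × K × E => (c (z.1 * b₀⁻¹), c (z.2.1 * a₀⁻¹), z.2.2))
    (Hh := fun q : (D × D × E) × D =>
      Γ.quotCoord c a₀ (c.symm q.1.1 * b₀) q.2 (c.symm q.1.2.1 * a₀) q.1.2.2) ?_ ?_ ?_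
  · filter_upwards [e1, e2] with z h1 h2
    exact (ContinuousAt.comp (f := Prod.fst) (c.continuousAt_mul_inv h1) continuousAt_fst).prodMk
      ((ContinuousAt.comp (f := fun z : K × K × E => z.2.1) (c.continuousAt_mul_inv h2)
        (by fun_prop)).prodMk (by fun_prop))
  · simp only [mul_inv_cancel, hc.map_one]
    refine Γ.smoothNear_quotCoord hc ?_ ((by fun_prop :
      ContDiff ℝ ∞ fun q : (D × D × E) × D => q.2).smoothNear _) ?_ ((by fun_prop :
      ContDiff ℝ ∞ fun q : (D × D × E) × D => q.1.2.2).smoothNear _) (by simp [hc.symm_zero]) rfl hv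
    · exact (hc.smoothNear_symm ((by fun_prop :
        ContDiff ℝ ∞ fun q : (D × D × E) × D => q.1.1).smoothNear _) hc.zero_mem).mul
          (smoothNear_const _ _)
    · exact (hc.smoothNear_symm ((by fun_prop :
        ContDiff ℝ ∞ fun q : (D × D × E) × D => q.1.2.1).smoothNear _) hc.zero_mem).mul
          (smoothNear_const _ _)
  · filter_upwards [(continuous_fst.tendsto _).eventually e1,
      (continuous_fst.tendsto _).eventually e2] with p h1 h2
    simp [c.left_inv h1, c.left_inv h2]

variable [CompactSpace K]

/-- For `a = a₀` and `y = 0` the coordinate change is the identity in `v`, with determinant `1`.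
Positivity persists nearby, uniformly in `b` and `v` by compactness. -/
theorem eventually_det_pos (Γ : LocalGroupoid D E K) (hc : IsUnitChart c) (a₀ : K) {R : ℝ}
    (hR : Metric.closedBall (0 : D) R ⊆ c.target) :
    ∀ᶠ z : K × E in 𝓝 (a₀, 0), ∀ b, ∀ v ∈ Metric.closedBall (0 : D) R,
      DifferentiableAt ℝ (fun v => Γ.quotCoord c a₀ b v z.1 z.2) v ∧
        0 < (fderiv ℝ (fun v => Γ.quotCoord c a₀ b v z.1 z.2) v).det := by
  have key : ∀ᶠ z : K × E in 𝓝 (a₀, 0), ∀ w ∈ (univ : Set K) ×ˢ Metric.closedBall (0 : D) R,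
      DifferentiableAt ℝ (fun v => Γ.quotCoord c a₀ w.1 v z.1 z.2) w.2 ∧
        0 < (fderiv ℝ (fun v => Γ.quotCoord c a₀ w.1 v z.1 z.2) w.2).det := by
    refine (isCompact_univ.prod (isCompact_closedBall _ _)).eventually_forall_of_forall_eventually
      ?_
    rintro ⟨b₀, v₀⟩ ⟨-, hv₀⟩
    have h1 := Γ.eventually_smoothFamilyAt_quotCoord hc a₀ b₀ (hR hv₀)
    have h2 := h1.self_of_nhds.fderiv.continuousAt
    have h3 : fderiv ℝ (fun v => Γ.quotCoord c a₀ b₀ v a₀ 0) v₀ = ContinuousLinearMap.id ℝ D := by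
      have : (fun v => Γ.quotCoord c a₀ b₀ v a₀ 0) =ᶠ[𝓝 v₀] id := by
        filter_upwards [c.open_target.mem_nhds (hR hv₀)] with v hv
        simp [quotCoord, Γ.div_at_zero, c.right_inv hv]
      rw [this.fderiv_eq, fderiv_id]
    have h4 : ∀ᶠ p : (K × K × E) × D in 𝓝 ((b₀, a₀, 0), v₀),
        0 < (fderiv ℝ (fun v => Γ.quotCoord c a₀ p.1.1 v p.1.2.1 p.1.2.2) p.2).det := by
      have h5 := ContinuousAt.comp (f := fun p : (K × K × E) × D =>
        fderiv ℝ (fun v => Γ.quotCoord c a₀ p.1.1 v p.1.2.1 p.1.2.2) p.2)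
        (x := ((b₀, a₀, 0), v₀))
        (contDiff_clm_det (D := D)).continuous.continuousAt h2
      refine h5.eventually_mem (Ioi_mem_nhds ?_)
      change 0 < (fderiv ℝ (fun v => Γ.quotCoord c a₀ b₀ v a₀ 0) v₀).det
      rw [h3]
      simp [ContinuousLinearMap.det]
    have t1 : Tendsto (fun p : (K × E) × K × D => (p.2.2, ((p.2.1, p.1.1, p.1.2) : K × K × E)))
        (𝓝 ((a₀, 0), (b₀, v₀))) (𝓝 (v₀, (b₀, a₀, 0))) := Continuous.tendsto (by fun_prop) _
    have t2 : Tendsto (fun p : (K × E) × K × D => (((p.2.1, p.1.1, p.1.2) : K × K × E), p.2.2))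
        (𝓝 ((a₀, 0), (b₀, v₀))) (𝓝 ((b₀, a₀, 0), v₀)) := Continuous.tendsto (by fun_prop) _
    filter_upwards [t1.eventually h1, t2.eventually h4] with p hp1 hp2
    refine ⟨?_, hp2⟩
    obtain ⟨c', Hh, hc', hH, he⟩ := hp1
    have h2 : ∀ᶠ x in 𝓝 p.2.2, Γ.quotCoord c a₀ p.2.1 x p.1.1 p.1.2 = Hh (c' (p.2.1, p.1), x) :=
      (Continuous.tendsto (by fun_prop : Continuous fun x : D =>
        (((p.2.1, p.1.1, p.1.2) : K × K × E), x)) p.2.2).eventually he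
    refine DifferentiableAt.congr_of_eventuallyEq ?_ h2
    exact DifferentiableAt.comp p.2.2 (hH.differentiableAt (by simp)) (by fun_prop)
  filter_upwards [key] with z hz b v hv
  exact hz (b, v) ⟨mem_univ _, hv⟩

/-- The third clause says that the inverse `v ↦ c (mul (c⁻¹ v * b) a y * (b * a₀)⁻¹)` of the
coordinate change moves points by less than `R / 2`, so that it maps the ball of radius `R / 2` into
that of radius `R`. -/
theorem eventually_mem_source (Γ : LocalGroupoid D E K) (a₀ : K) {R : ℝ}
    (hR0 : 0 < R) (hR : Metric.closedBall (0 : D) R ⊆ c.target) :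
    ∀ᶠ z : K × E in 𝓝 (a₀, 0), ∀ b, ∀ v ∈ Metric.closedBall (0 : D) R,
      Γ.div (c.symm v * b * a₀) z.1 z.2 * b⁻¹ ∈ c.source ∧
      Γ.mul (c.symm v * b) z.1 z.2 * (b * a₀)⁻¹ ∈ c.source ∧
      ‖c (Γ.mul (c.symm v * b) z.1 z.2 * (b * a₀)⁻¹) - v‖ < R / 2 := by
  have := topologicalGroup_of_lieGroup 𝓘(ℝ, D) ∞ (G := K)
  have key : ∀ᶠ z : K × E in 𝓝 (a₀, 0), ∀ w ∈ (univ : Set K) ×ˢ Metric.closedBall (0 : D) R,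
      Γ.div (c.symm w.2 * w.1 * a₀) z.1 z.2 * w.1⁻¹ ∈ c.source ∧
      Γ.mul (c.symm w.2 * w.1) z.1 z.2 * (w.1 * a₀)⁻¹ ∈ c.source ∧
      ‖c (Γ.mul (c.symm w.2 * w.1) z.1 z.2 * (w.1 * a₀)⁻¹) - w.2‖ < R / 2 := by
    refine (isCompact_univ.prod (isCompact_closedBall _ _)).eventually_forall_of_forall_eventually
      ?_
    rintro ⟨b₀, v₀⟩ ⟨-, hv₀⟩
    have hv := hR hv₀
    have hs : ContinuousAt (fun p : (K × E) × K × D => c.symm p.2.2) ((a₀, 0), (b₀, v₀)) :=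
      ContinuousAt.comp (f := fun p : (K × E) × K × D => p.2.2) (c.continuousAt_symm hv)
        (by fun_prop)
    have hd : ContinuousAt (fun p : (K × E) × K × D =>
        Γ.div (c.symm p.2.2 * p.2.1 * a₀) p.1.1 p.1.2 * p.2.1⁻¹) ((a₀, 0), (b₀, v₀)) := by
      refine ContinuousAt.mul ?_ (by fun_prop)
      exact ContinuousAt.comp (f := fun p : (K × E) × K × D =>
        (c.symm p.2.2 * p.2.1 * a₀, p.1.1, p.1.2)) (Γ.continuousAt_div Γ.zero_mem)
        (((hs.mul (by fun_prop)).mul (by fun_prop)).prodMk (by fun_prop))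
    have hm : ContinuousAt (fun p : (K × E) × K × D =>
        Γ.mul (c.symm p.2.2 * p.2.1) p.1.1 p.1.2 * (p.2.1 * a₀)⁻¹) ((a₀, 0), (b₀, v₀)) := by
      refine ContinuousAt.mul ?_ (by fun_prop)
      exact ContinuousAt.comp (f := fun p : (K × E) × K × D =>
        (c.symm p.2.2 * p.2.1, p.1.1, p.1.2)) (Γ.continuousAt_mul Γ.zero_mem)
        ((hs.mul (by fun_prop)).prodMk (by fun_prop))
    have hd0 : Γ.div (c.symm v₀ * b₀ * a₀) a₀ 0 * b₀⁻¹ = c.symm v₀ := by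
      rw [Γ.div_at_zero]; group
    have hm0 : Γ.mul (c.symm v₀ * b₀) a₀ 0 * (b₀ * a₀)⁻¹ = c.symm v₀ := by
      rw [Γ.mul_at_zero]; group
    have hcm := ContinuousAt.comp (f := fun p : (K × E) × K × D =>
        Γ.mul (c.symm p.2.2 * p.2.1) p.1.1 p.1.2 * (p.2.1 * a₀)⁻¹) (x := ((a₀, 0), (b₀, v₀)))
        (c.continuousAt (by simp only [hm0]; exact c.map_target hv)) hm
    have hn := (hcm.sub (continuous_snd.comp continuous_snd).continuousAt).norm
    refine (hd.eventually_mem (c.open_source.mem_nhds ?_)).and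
      ((hm.eventually_mem (c.open_source.mem_nhds ?_)).and
      (hn.eventually_mem (Iio_mem_nhds ?_)))
    · rw [hd0]; exact c.map_target hv
    · rw [hm0]; exact c.map_target hv
    · change ‖c (Γ.mul (c.symm v₀ * b₀) a₀ 0 * (b₀ * a₀)⁻¹) - v₀‖ < R / 2
      rw [hm0, c.right_inv hv]
      simpa using hR0
  filter_upwards [key] with z hz b v hv
  exact hz (b, v) ⟨mem_univ _, hv⟩

variable [MeasurableSpace D] [BorelSpace D] (ν : Measure D) [ν.IsAddHaarMeasure]

/-- The substitution is `v ↦ quotCoord v`, chosen so that `c⁻¹(quotCoord v) * b = div (c⁻¹ v * b *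
a₀) a y`. Right multiplication by `a` in the deformed product then sends this element to `c⁻¹ v * b
* a₀`, which depends on neither `a` nor `y`. -/
theorem eventually_setIntegral_subst (Γ : LocalGroupoid D E K) (hc : IsUnitChart c) (a₀ : K)
    {R : ℝ} (hR0 : 0 < R) (hR : Metric.closedBall (0 : D) R ⊆ c.target) {θ : D → ℝ}
    (hθ : ∀ v, v ∉ Metric.closedBall (0 : D) (R / 2) → θ v = 0) :
    ∀ᶠ z : K × E in 𝓝 (a₀, 0), ∀ (b : K) (Φ : K → D),
      ∫ v in Metric.closedBall (0 : D) R, θ v • Φ (c.symm v * b) ∂ν =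
      ∫ v in Metric.closedBall (0 : D) R,
        ((fderiv ℝ (fun v => Γ.quotCoord c a₀ b v z.1 z.2) v).det *
          θ (Γ.quotCoord c a₀ b v z.1 z.2)) • Φ (Γ.div (c.symm v * b * a₀) z.1 z.2) ∂ν := by
  have hsnd : Tendsto (fun z : K × E => z.2) (𝓝 (a₀, 0)) (𝓝 0) := continuous_snd.tendsto _
  filter_upwards [Γ.eventually_det_pos hc a₀ hR, Γ.eventually_mem_source a₀ hR0 hR,
    hsnd.eventually Γ.mul_div_near, hsnd.eventually Γ.div_mul_near] with z h1 h2 h3 h4 b Φ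
  have hV : ∀ v ∈ Metric.closedBall (0 : D) R,
      c.symm (Γ.quotCoord c a₀ b v z.1 z.2) * b = Γ.div (c.symm v * b * a₀) z.1 z.2 := by
    intro v hv
    rw [quotCoord, c.left_inv (h2 b v hv).1]
    group
  rw [setIntegral_closedBall_comp ν (Φ := fun v => Φ (c.symm v * b))
    (f := fun v => Γ.quotCoord c a₀ b v z.1 z.2) hθ hR0 (fun v hv => (h1 b v hv).1)
    (fun v hv => (h1 b v hv).2)]
  · refine setIntegral_congr_fun Metric.isClosed_closedBall.measurableSet fun v hv => ?_
    simp only [hV v hv]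
  · intro v hv v' hv' h
    have h5 : Γ.div (c.symm v * b * a₀) z.1 z.2 = Γ.div (c.symm v' * b * a₀) z.1 z.2 := by
      rw [← hV v hv, ← hV v' hv']
      simp only at h
      rw [h]
    have h6 := congrArg (fun k => Γ.mul k z.1 z.2) h5
    simp only [h3] at h6
    have h7 : c.symm v = c.symm v' := by simpa using h6
    exact c.symm.injOn (hR hv) (hR hv') h7
  · intro v hv
    have hv' : v ∈ Metric.closedBall (0 : D) R :=
      Metric.closedBall_subset_closedBall (by linarith) hv
    obtain ⟨-, h5, h6⟩ := h2 b v hv'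
    -- The preimage of `v` is the inverse coordinate change; it stays in the ball of radius `R`
    -- because it moves `v` by less than `R / 2`.
    refine ⟨c (Γ.mul (c.symm v * b) z.1 z.2 * (b * a₀)⁻¹), ?_, ?_⟩
    · rw [mem_closedBall_zero_iff] at hv ⊢
      calc _ = ‖(c (Γ.mul (c.symm v * b) z.1 z.2 * (b * a₀)⁻¹) - v) + v‖ := by simp
        _ ≤ _ := norm_add_le _ _
        _ ≤ R := by linarith
    · rw [quotCoord, c.left_inv h5]
      have : Γ.mul (c.symm v * b) z.1 z.2 * (b * a₀)⁻¹ * b * a₀ =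
        Γ.mul (c.symm v * b) z.1 z.2 := by group
      rw [this, h4, mul_inv_cancel_right, c.right_inv (hR hv')]

end LocalGroupoid

end
-- The defect rewritten with the unknown function evaluated at fixed points
noncomputable section

open MeasureTheory

/-- The tube lemma over the compact parameter space gives one neighbourhood of `x₀` for all
parameters. -/
theorem exists_open_smoothFamilyAt {Z : Type*} [TopologicalSpace Z] [CompactSpace Z]
    {B : Type*} [NormedAddCommGroup B] [NormedSpace ℝ B]
    {X : Type*} [NormedAddCommGroup X] [NormedSpace ℝ X]
    {W : Type*} [NormedAddCommGroup W] [NormedSpace ℝ W] {H : Z → X → W} {x₀ : X}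
    (h : ∀ z, ∀ᶠ p in 𝓝 (x₀, z), SmoothFamilyAt B H p.2 p.1) :
    ∃ r : Set X, IsOpen r ∧ x₀ ∈ r ∧ ∀ z, ∀ x ∈ r, SmoothFamilyAt B H z x := by
  have h1 : ∀ᶠ x in 𝓝 x₀, ∀ z ∈ (univ : Set Z), SmoothFamilyAt B H z x :=
    isCompact_univ.eventually_forall_of_forall_eventually fun z _ => h z
  obtain ⟨r, hr, ho, hx⟩ := mem_nhds_iff.1 h1
  exact ⟨r, ho, hx, fun z x hxr => hr hxr z (mem_univ z)⟩

theorem exists_contDiff_integral_eq_one {D : Type*} [NormedAddCommGroup D] [NormedSpace ℝ D]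
    [FiniteDimensional ℝ D] [MeasurableSpace D] [BorelSpace D] (ν : Measure D)
    [ν.IsAddHaarMeasure] {R : ℝ} (hR : 0 < R) :
    ∃ θ : D → ℝ, ContDiff ℝ ∞ θ ∧ (∀ v, v ∉ Metric.closedBall (0 : D) (R / 2) → θ v = 0) ∧
      ∫ v in Metric.closedBall (0 : D) R, θ v ∂ν = 1 := by
  let f : ContDiffBump (0 : D) := ⟨R / 4, R / 2, by linarith, by linarith⟩
  have h0 : ∀ v, v ∉ Metric.closedBall (0 : D) (R / 2) → f.normed ν v = 0 := fun v hv => by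
    have : v ∉ Function.support (f.normed ν) := by
      rw [f.support_normed_eq]
      exact fun h => hv (Metric.ball_subset_closedBall h)
    simpa using this
  refine ⟨f.normed ν, f.contDiff_normed, h0, ?_⟩
  rw [setIntegral_eq_integral_of_forall_compl_eq_zero, f.integral_normed]
  exact fun v hv => h0 v fun h => hv (Metric.closedBall_subset_closedBall (by linarith) h)

namespace LocalGroupoid

variable {D : Type*} [NormedAddCommGroup D] [NormedSpace ℝ D] [FiniteDimensional ℝ D]
  {E : Type*} [NormedAddCommGroup E] [NormedSpace ℝ E]
  {K : Type*} [TopologicalSpace K] [Group K] [ChartedSpace D K] [LieGroup 𝓘(ℝ, D) ∞ K]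
  [CompactSpace K] {c : OpenPartialHomeomorph K D}

/-- This makes the integrand of the defect continuous on `K`, as smearing requires: for small data
its argument is uniformly near `1`, hence in the domain of `c`. -/
theorem eventually_defectArg (Γ : LocalGroupoid D E K) (hc : IsUnitChart c) (a₀ : K) :
    ∀ᶠ p : K × E × D × D × C(K, D) in 𝓝 (a₀, 0, 0, 0, 0), ∀ b,
      defectArg c p.1 b (Γ.mul b p.1 p.2.1) p.2.2.1 p.2.2.2.1 (p.2.2.2.2 (Γ.mul b p.1 p.2.1)) ∈
        c.source ∧ ContinuousAt (fun b => defectArg c p.1 b (Γ.mul b p.1 p.2.1) p.2.2.1 p.2.2.2.1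
          (p.2.2.2.2 (Γ.mul b p.1 p.2.1))) b := by
  have := topologicalGroup_of_lieGroup 𝓘(ℝ, D) ∞ (G := K)
  have hdom : ∀ᶠ p : K × E × D × D × C(K, D) in 𝓝 (a₀, 0, 0, 0, 0), p.2.1 ∈ Γ.dom :=
    Tendsto.eventually (f := fun p : K × E × D × D × C(K, D) => p.2.1)
      (Continuous.tendsto (by fun_prop) _) (Γ.isOpen_dom.mem_nhds Γ.zero_mem)
  have key : ∀ᶠ p : K × E × D × D × C(K, D) in 𝓝 (a₀, 0, 0, 0, 0), ∀ b ∈ (univ : Set K),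
      defectArg c p.1 b (Γ.mul b p.1 p.2.1) p.2.2.1 p.2.2.2.1 (p.2.2.2.2 (Γ.mul b p.1 p.2.1)) ∈
        c.source ∧ p.2.2.2.2 (Γ.mul b p.1 p.2.1) ∈ c.target := by
    refine isCompact_univ.eventually_forall_of_forall_eventually fun b₀ _ => ?_
    have hm : ContinuousAt (fun q : (K × E × D × D × C(K, D)) × K => Γ.mul q.2 q.1.1 q.1.2.1)
        ((a₀, 0, 0, 0, 0), b₀) :=
      ContinuousAt.comp (f := fun q : (K × E × D × D × C(K, D)) × K => (q.2, q.1.1, q.1.2.1))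
        (Γ.continuousAt_mul Γ.zero_mem) (by fun_prop)
    have hη : ContinuousAt (fun q : (K × E × D × D × C(K, D)) × K =>
        q.1.2.2.2.2 (Γ.mul q.2 q.1.1 q.1.2.1)) ((a₀, 0, 0, 0, 0), b₀) :=
      ContinuousAt.comp (f := fun q : (K × E × D × D × C(K, D)) × K =>
        (q.1.2.2.2.2, Γ.mul q.2 q.1.1 q.1.2.1)) (g := fun q : C(K, D) × K => q.1 q.2)
        (ContinuousEval.continuous_eval.continuousAt) (ContinuousAt.prodMk (by fun_prop) hm)
    have hs : ContinuousAt c.symm 0 := c.continuousAt_symm hc.zero_mem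
    have h1 : ContinuousAt (fun q : (K × E × D × D × C(K, D)) × K =>
        c.symm (q.1.2.2.2.2 (Γ.mul q.2 q.1.1 q.1.2.1))) ((a₀, 0, 0, 0, 0), b₀) :=
      ContinuousAt.comp (g := c.symm) (by simpa using hs) hη
    have h2 : ContinuousAt (fun q : (K × E × D × D × C(K, D)) × K => c.symm q.1.2.2.1)
        ((a₀, 0, 0, 0, 0), b₀) :=
      ContinuousAt.comp (g := c.symm) (f := fun q : (K × E × D × D × C(K, D)) × K => q.1.2.2.1)
        hs (by fun_prop)
    have h3 : ContinuousAt (fun q : (K × E × D × D × C(K, D)) × K => c.symm q.1.2.2.2.1)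
        ((a₀, 0, 0, 0, 0), b₀) :=
      ContinuousAt.comp (g := c.symm) (f := fun q : (K × E × D × D × C(K, D)) × K => q.1.2.2.2.1)
        hs (by fun_prop)
    have h4 : ContinuousAt (fun q : (K × E × D × D × C(K, D)) × K =>
        defectArg c q.1.1 q.2 (Γ.mul q.2 q.1.1 q.1.2.1) q.1.2.2.1 q.1.2.2.2.1
          (q.1.2.2.2.2 (Γ.mul q.2 q.1.1 q.1.2.1))) ((a₀, 0, 0, 0, 0), b₀) := by
      unfold defectArg
      exact ((ContinuousAt.mul (by fun_prop) (hm.mul h1)).mul h3).mul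
        ((ContinuousAt.mul (by fun_prop) h2).inv)
    refine (h4.eventually_mem (c.open_source.mem_nhds ?_)).and
      (hη.eventually_mem (c.open_target.mem_nhds ?_))
    · simp [defectArg, hc.symm_zero, Γ.mul_at_zero, hc.one_mem]
    · simpa using hc.zero_mem
  filter_upwards [key, hdom] with p hp hd b
  refine ⟨(hp b (mem_univ b)).1, ?_⟩
  have hm : ContinuousAt (fun b => Γ.mul b p.1 p.2.1) b :=
    ContinuousAt.comp (f := fun b => (b, p.1, p.2.1)) (Γ.continuousAt_mul hd) (by fun_prop)
  have h1 : ContinuousAt (fun b => c.symm (p.2.2.2.2 (Γ.mul b p.1 p.2.1))) b :=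
    ContinuousAt.comp (g := c.symm) (c.continuousAt_symm (hp b (mem_univ b)).2)
      (ContinuousAt.comp (p.2.2.2.2.continuous.continuousAt) hm)
  unfold defectArg
  exact ((ContinuousAt.mul (by fun_prop) (hm.mul h1)).mul continuousAt_const).mul continuousAt_const

variable [MeasurableSpace D] [BorelSpace D] (ν : Measure D) [ν.IsAddHaarMeasure]
  [SecondCountableTopology K] [MeasurableSpace K] [BorelSpace K]
  (m : Measure K) [IsProbabilityMeasure m] [m.IsMulLeftInvariant]

/-- Smearing and then substituting moves all dependence on `(a, y)` in the argument of `η` into the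
density. On the right, `η` is evaluated at `c⁻¹ v * b * a₀`, so the value depends linearly on `η`
and not on `a` or `y`. -/
theorem eventually_defect_eq (Γ : LocalGroupoid D E K) (hc : IsUnitChart c) (a₀ : K)
    {R : ℝ} (hR0 : 0 < R) (hR : Metric.closedBall (0 : D) R ⊆ c.target) {θ : D → ℝ}
    (hθ : ∀ v, v ∉ Metric.closedBall (0 : D) (R / 2) → θ v = 0) (hθc : Continuous θ)
    (hθ1 : ∫ v in Metric.closedBall (0 : D) R, θ v ∂ν = 1) :
    ∀ᶠ p : K × E × D × D × C(K, D) in 𝓝 (a₀, 0, 0, 0, 0),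
      Γ.defect c m p.1 p.2.1 p.2.2.1 p.2.2.2.1 p.2.2.2.2 =
      ∫ b, ∫ v in Metric.closedBall (0 : D) R,
        ((fderiv ℝ (fun v => Γ.quotCoord c a₀ b v p.1 p.2.1) v).det *
          θ (Γ.quotCoord c a₀ b v p.1 p.2.1)) •
          c (defectArg c p.1 (Γ.div (c.symm v * b * a₀) p.1 p.2.1) (c.symm v * b * a₀)
            p.2.2.1 p.2.2.2.1 (p.2.2.2.2 (c.symm v * b * a₀))) ∂ν ∂m := by
  have := topologicalGroup_of_lieGroup 𝓘(ℝ, D) ∞ (G := K)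
  have t1 : Tendsto (fun p : K × E × D × D × C(K, D) => (p.1, p.2.1)) (𝓝 (a₀, 0, 0, 0, 0))
    (𝓝 (a₀, 0)) := Continuous.tendsto (by fun_prop) _
  have t2 : Tendsto (fun p : K × E × D × D × C(K, D) => p.2.1) (𝓝 (a₀, 0, 0, 0, 0))
    (𝓝 0) := Continuous.tendsto (by fun_prop) _
  filter_upwards [Γ.eventually_defectArg hc a₀,
    t1.eventually (Γ.eventually_setIntegral_subst ν hc a₀ hR0 hR hθ),
    t2.eventually Γ.mul_div_near] with p h1 h2 h3
  have hΦ : Continuous fun b => c (defectArg c p.1 b (Γ.mul b p.1 p.2.1) p.2.2.1 p.2.2.2.1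
      (p.2.2.2.2 (Γ.mul b p.1 p.2.1))) := continuous_iff_continuousAt.2 fun b =>
    ContinuousAt.comp (g := c) (c.continuousAt (h1 b).1) (h1 b).2
  rw [defect, integral_eq_integral_smear ν m (c.continuousOn_symm.mono hR) hθc hθ1 hΦ]
  congr 1 with b
  rw [h2 b (fun b => c (defectArg c p.1 b (Γ.mul b p.1 p.2.1) p.2.2.1 p.2.2.2.1
      (p.2.2.2.2 (Γ.mul b p.1 p.2.1))))]
  simp only [h3]

/-- The integrand of the defect in coordinates. -/
def defectIntegrand (Γ : LocalGroupoid D E K) (c : OpenPartialHomeomorph K D) (a₀ : K) (θ : D → ℝ)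
    (b : K) (v : D) (x : D × E × D × D × D) : D :=
  ((fderiv ℝ (fun v => Γ.quotCoord c a₀ b v (c.symm x.1 * a₀) x.2.1) v).det *
    θ (Γ.quotCoord c a₀ b v (c.symm x.1 * a₀) x.2.1)) •
    c (defectArg c (c.symm x.1 * a₀) (Γ.div (c.symm v * b * a₀) (c.symm x.1 * a₀) x.2.1)
      (c.symm v * b * a₀) x.2.2.1 x.2.2.2.1 x.2.2.2.2)

-- In the integrand the value of `η` has become an independent vector, the last component of `x`;
-- everything else is built from smooth operations, the Jacobian being a partial derivative of
-- `quotCoord`.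
omit [CompactSpace K] [MeasurableSpace D] [BorelSpace D] [SecondCountableTopology K]
  [MeasurableSpace K] [BorelSpace K] in
theorem eventually_smoothFamilyAt_defectIntegrand (Γ : LocalGroupoid D E K) (hc : IsUnitChart c)
    (a₀ : K) {S : Set D} (hS : S ⊆ c.target) {θ : D → ℝ} (hθ : ContDiff ℝ ∞ θ) (z₀ : K × S) :
    ∀ᶠ p : (D × E × D × D × D) × (K × S) in 𝓝 (0, z₀), SmoothFamilyAt (D × D)
      (fun (z : K × S) x => Γ.defectIntegrand c a₀ θ z.1 z.2 x) p.2 p.1 := by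
  obtain ⟨b₀, v₀, hv₀⟩ := z₀
  have e1 : ∀ᶠ z : K × S in 𝓝 (b₀, ⟨v₀, hv₀⟩), z.1 * b₀⁻¹ ∈ c.source :=
    (continuous_fst.tendsto (b₀, (⟨v₀, hv₀⟩ : S))).eventually (hc.eventually_mul_inv_mem b₀)
  refine eventually_smoothFamilyAt
    (c := fun z : K × S => (c (z.1 * b₀⁻¹), (z.2 : D)))
    (Hh := fun q : (D × D) × (D × E × D × D × D) =>
      Γ.defectIntegrand c a₀ θ (c.symm q.1.1 * b₀) q.1.2 q.2) ?_ ?_ ?_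
  · filter_upwards [e1] with z h1
    exact (ContinuousAt.comp (f := Prod.fst) (c.continuousAt_mul_inv h1) continuousAt_fst).prodMk
      (by fun_prop)
  · simp only [mul_inv_cancel, hc.map_one]
    let Q := (D × D) × (D × E × D × D × D)
    let q₀ : Q := ((0, v₀), 0)
    have sβ : SmoothNear 𝓘(ℝ, D) (fun q : Q => q.1.1) q₀ := ContDiff.smoothNear (by fun_prop) _
    have sv : SmoothNear 𝓘(ℝ, D) (fun q : Q => q.1.2) q₀ := ContDiff.smoothNear (by fun_prop) _
    have sα : SmoothNear 𝓘(ℝ, D) (fun q : Q => q.2.1) q₀ := ContDiff.smoothNear (by fun_prop) _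
    have sy : SmoothNear 𝓘(ℝ, E) (fun q : Q => q.2.2.1) q₀ := ContDiff.smoothNear (by fun_prop) _
    have se : SmoothNear 𝓘(ℝ, D) (fun q : Q => q.2.2.2.1) q₀ := ContDiff.smoothNear (by fun_prop) _
    have sγ : SmoothNear 𝓘(ℝ, D) (fun q : Q => q.2.2.2.2.1) q₀ :=
      ContDiff.smoothNear (by fun_prop) _
    have sw : SmoothNear 𝓘(ℝ, D) (fun q : Q => q.2.2.2.2.2) q₀ :=
      ContDiff.smoothNear (by fun_prop) _
    have sb : SmoothNear 𝓘(ℝ, D) (fun q : Q => c.symm q.1.1 * b₀) q₀ :=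
      (hc.smoothNear_symm sβ hc.zero_mem).mul (smoothNear_const _ _)
    have sa : SmoothNear 𝓘(ℝ, D) (fun q : Q => c.symm q.2.1 * a₀) q₀ :=
      (hc.smoothNear_symm sα hc.zero_mem).mul (smoothNear_const _ _)
    have sk : SmoothNear 𝓘(ℝ, D) (fun q : Q => c.symm q.1.2 * (c.symm q.1.1 * b₀) * a₀) q₀ :=
      ((hc.smoothNear_symm sv (hS hv₀)).mul sb).mul (smoothNear_const _ _)
    have sd := Γ.smoothNear_div sk sa sy Γ.zero_mem
    have sq := Γ.smoothNear_quotCoord hc (a₀ := a₀) sb sv sa sy (by simp [q₀, hc.symm_zero]) rfl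
      (hS hv₀)
    have sf := sq.partial_fderiv (D' := D)
      ((ContinuousLinearMap.inl ℝ (D × D) (D × E × D × D × D)).comp
        (ContinuousLinearMap.inr ℝ D D)) (j := fun q v => ((q.1.1, v), q.2)) (l := fun q => q.1.2)
        (fun q v => Prod.ext (Prod.ext (add_zero q.1.1).symm (add_sub_cancel q.1.2 v).symm)
          (add_zero q.2).symm)
    have sarg := smoothNear_defectArg hc sa sd sk se sγ sw rfl rfl rfl
    refine ((sf.comp_contDiff contDiff_clm_det).smul (sq.comp_contDiff hθ)).smul
      (hc.smoothNear sarg ?_)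
    have : Γ.div (c.symm v₀ * (1 * b₀) * a₀) (1 * a₀) 0 = c.symm v₀ * b₀ := by
      rw [Γ.div_at_zero]; group
    simp only [q₀, defectArg, Prod.fst_zero, Prod.snd_zero, hc.symm_zero, this]
    have h1 : (c.symm v₀ * b₀)⁻¹ * (c.symm v₀ * (1 * b₀) * a₀ * 1) * 1 * (1 * a₀ * 1)⁻¹ = 1 := by
      group
    rw [h1]
    exact hc.one_mem
  · filter_upwards [(continuous_fst.tendsto _).eventually e1] with p h1
    simp only [c.left_inv h1, inv_mul_cancel_right]

end LocalGroupoid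

end
-- Smoothness of the defect on the Banach space of unknowns
noncomputable section

open MeasureTheory

namespace LocalGroupoid

variable {D : Type*} [NormedAddCommGroup D] [NormedSpace ℝ D] [FiniteDimensional ℝ D]
  {E : Type*} [NormedAddCommGroup E] [NormedSpace ℝ E]
  {K : Type*} [TopologicalSpace K] [Group K] [ChartedSpace D K] [LieGroup 𝓘(ℝ, D) ∞ K]
  [CompactSpace K] {c : OpenPartialHomeomorph K D}
  [SecondCountableTopology K] [MeasurableSpace K] [BorelSpace K]
  (m : Measure K) [IsProbabilityMeasure m] [m.IsMulLeftInvariant]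

/-- After the substitution, the defect is a composite of a continuous linear map into continuous
functions on `K × S`, a superposition operator, and integration. Each of these is smooth. -/
theorem smoothNear_defect (Γ : LocalGroupoid D E K) (hc : IsUnitChart c) (a₀ : K) :
    SmoothNear 𝓘(ℝ, D) (fun p : D × (E × D × D × C(K, D)) =>
      Γ.defect c m (c.symm p.1 * a₀) p.2.1 p.2.2.1 p.2.2.2.1 p.2.2.2.2) 0 := by
  have := topologicalGroup_of_lieGroup 𝓘(ℝ, D) ∞ (G := K)
  borelize D
  let ν : Measure D := Measure.addHaar
  obtain ⟨R, hR0, hR⟩ := Metric.nhds_basis_closedBall.mem_iff.1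
    (c.open_target.mem_nhds hc.zero_mem)
  obtain ⟨θ, hθs, hθ, hθ1⟩ := exists_contDiff_integral_eq_one ν hR0
  let S := Metric.closedBall (0 : D) R
  have hS : MeasurableSet S := Metric.isClosed_closedBall.measurableSet
  have : CompactSpace S := isCompact_iff_compactSpace.1 (isCompact_closedBall _ _)
  let σ : Measure S := ν.comap Subtype.val
  have : IsFiniteMeasure σ := ⟨by
    rw [comap_subtype_coe_apply hS]
    simpa using (isCompact_closedBall (0 : D) R).measure_lt_top⟩
  let H : K × S → D × E × D × D × D → D := fun z x => Γ.defectIntegrand c a₀ θ z.1 z.2 x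
  obtain ⟨r, hr, h0r, hH⟩ := exists_open_smoothFamilyAt
    (fun z => Γ.eventually_smoothFamilyAt_defectIntegrand hc a₀ hR hθs z)
  have hτ : Continuous fun v : S => c.symm (v : D) := (c.continuousOn_symm.mono hR).domRestrict
  -- This is linear precisely because `η` is evaluated at points that do not involve the variables
  -- `p`.
  let ξ : (D × (E × D × D × C(K, D))) →L[ℝ] C(K × S, D × E × D × D × D) :=
    LinearMap.mkContinuous
      { toFun := fun p => ⟨fun z => (p.1, p.2.1, p.2.2.1, p.2.2.2.1,
          p.2.2.2.2 (c.symm (z.2 : D) * z.1 * a₀)), by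
            have : Continuous fun z : K × S => c.symm (z.2 : D) * z.1 * a₀ :=
              ((hτ.comp continuous_snd).mul continuous_fst).mul continuous_const
            fun_prop⟩
        map_add' := fun p q => by ext z <;> simp
        map_smul' := fun s p => by ext z <;> simp } 1 (fun p => by
          rw [ContinuousMap.norm_le _ (by positivity), one_mul]
          intro z
          change ‖(p.1, p.2.1, p.2.2.1, p.2.2.2.1, p.2.2.2.2 (c.symm (z.2 : D) * z.1 * a₀))‖ ≤ ‖p‖
          simp only [Prod.norm_def]
          gcongr
          exact p.2.2.2.2.norm_coe_le_norm _)
  have hξ : ∀ p z, ξ p z = (p.1, p.2.1, p.2.2.1, p.2.2.2.1,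
    p.2.2.2.2 (c.symm (z.2 : D) * z.1 * a₀)) := fun p z => rfl
  have hopen : IsOpen {p | ∀ z, ξ p z ∈ r} := (isOpen_setOf_forall_mem hr).preimage ξ.continuous
  have hmem : ∀ᶠ p in 𝓝 0, ∀ z, ξ p z ∈ r := hopen.mem_nhds fun z => by simpa using h0r
  have hsm : SmoothNear 𝓘(ℝ, D) (fun p => integralCLM (m.prod σ) (superposition H (ξ p))) 0 := by
    refine SmoothNear.of_contDiffAt ?_
    filter_upwards [hmem] with p hp
    refine ContDiffAt.comp p (integralCLM (W := D) (m.prod σ)).contDiff.contDiffAt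
      (ContDiffAt.comp p (g := superposition H) ?_ ξ.contDiff.contDiffAt)
    exact (contDiffOn_superposition hr hH).contDiffAt ((isOpen_setOf_forall_mem hr).mem_nhds hp)
  refine hsm.congr ?_
  have t : Tendsto (fun p : D × (E × D × D × C(K, D)) =>
      ((c.symm p.1 * a₀, p.2) : K × E × D × D × C(K, D))) (𝓝 0) (𝓝 (a₀, 0, 0, 0, 0)) := by
    have h1 : ContinuousAt (fun p : D × (E × D × D × C(K, D)) => c.symm p.1) 0 :=
      ContinuousAt.comp (g := c.symm) (f := fun p : D × (E × D × D × C(K, D)) => p.1)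
        (c.continuousAt_symm hc.zero_mem) (by fun_prop)
    have h2 : ContinuousAt (fun p : D × (E × D × D × C(K, D)) =>
      ((c.symm p.1 * a₀, p.2) : K × E × D × D × C(K, D))) 0 :=
      (h1.mul continuousAt_const).prodMk continuousAt_snd
    have h3 := h2.tendsto
    rw [Prod.fst_zero, hc.symm_zero, one_mul] at h3
    exact h3
  filter_upwards [t.eventually (Γ.eventually_defect_eq ν m hc a₀ hR0 hR hθ hθs.continuous hθ1),
    hmem] with p hp hpr
  rw [hp, integralCLM_apply, integral_prod _ (ContinuousMap.integrable_of_compactSpace _ _)]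
  refine integral_congr_ae (Eventually.of_forall fun b => ?_)
  refine (integral_subtype_comap hS _).symm.trans ?_
  refine integral_congr_ae (Eventually.of_forall fun v => ?_)
  exact (superposition_apply hH hpr (b, v)).symm

/-- The variables of the defect at the elements of `K`. -/
def defectVars (D E K : Type*) [NormedAddCommGroup D] [NormedSpace ℝ D]
    [NormedAddCommGroup E] [NormedSpace ℝ E] [TopologicalSpace K] [CompactSpace K] :
    (E × (C(K, D) × D)) →L[ℝ] C(K, E × D × D × C(K, D)) :=
  LinearMap.mkContinuous
    { toFun := fun p => ⟨fun a => (p.1, p.2.1 a, p.2.2, p.2.1), by fun_prop⟩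
      map_add' := fun p q => by ext z <;> simp
      map_smul' := fun s p => by ext z <;> simp } 1 (fun p => by
        rw [ContinuousMap.norm_le _ (by positivity), one_mul]
        intro a
        change ‖(p.1, p.2.1 a, p.2.2, p.2.1)‖ ≤ ‖p‖
        simp only [Prod.norm_def]
        have h1 := p.2.1.norm_coe_le_norm a
        refine max_le_max le_rfl (max_le (h1.trans (le_max_left _ _)) ?_)
        rw [max_comm])

omit [SecondCountableTopology K] [BorelSpace K] [MeasurableSpace K] [Group K] [ChartedSpace D K]
  [LieGroup 𝓘(ℝ, D) ∞ K] [FiniteDimensional ℝ D] in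
theorem defectVars_apply (p : E × (C(K, D) × D)) (a : K) :
    defectVars D E K p a = (p.1, p.2.1 a, p.2.2, p.2.1) := rfl

/-- The map whose zeros correspond to homomorphisms: the defect at all elements of `K`, together
with the normalization at `1`. -/
def defectMap (Γ : LocalGroupoid D E K) (c : OpenPartialHomeomorph K D) (m : Measure K)
    (p : E × (C(K, D) × D)) : C(K, D) × D :=
  (superposition (fun a (x : E × D × D × C(K, D)) =>
    Γ.defect c m a x.1 x.2.1 x.2.2.1 x.2.2.2) (defectVars D E K p), p.2.1 1)

theorem exists_open_smoothFamilyAt_defect (Γ : LocalGroupoid D E K) (hc : IsUnitChart c) :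
    ∃ r : Set (E × D × D × C(K, D)), IsOpen r ∧ 0 ∈ r ∧ ∀ a, ∀ x ∈ r, SmoothFamilyAt D
      (fun (a : K) (x : E × D × D × C(K, D)) => Γ.defect c m a x.1 x.2.1 x.2.2.1 x.2.2.2) a x := by
  refine exists_open_smoothFamilyAt fun a₀ => ?_
  have e1 := hc.eventually_mul_inv_mem a₀
  refine eventually_smoothFamilyAt (c := fun a => c (a * a₀⁻¹))
    (Hh := fun p : D × (E × D × D × C(K, D)) =>
      Γ.defect c m (c.symm p.1 * a₀) p.2.1 p.2.2.1 p.2.2.2.1 p.2.2.2.2) ?_ ?_ ?_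
  · filter_upwards [e1] with a ha
    exact c.continuousAt_mul_inv ha
  · simp only [mul_inv_cancel, hc.map_one]
    exact Γ.smoothNear_defect m hc a₀
  · filter_upwards [(continuous_fst.tendsto _).eventually e1] with p h1
    simp only [c.left_inv h1, inv_mul_cancel_right]

/-- A second superposition operator, now with the point `a` of `K` as parameter, assembles the
defects at all `a` into an element of `C(K, D)`. The second conclusion is needed because
`superposition` has the default value `0` when the pointwise formula is not continuous. -/
theorem smoothNear_defectMap (Γ : LocalGroupoid D E K) (hc : IsUnitChart c) :
    SmoothNear 𝓘(ℝ, C(K, D) × D) (Γ.defectMap c m) 0 ∧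
    ∀ᶠ p in 𝓝 (0 : E × (C(K, D) × D)), ∀ a,
      (Γ.defectMap c m p).1 a = Γ.defect c m a p.1 (p.2.1 a) p.2.2 p.2.1 := by
  obtain ⟨r, hr, h0r, hH⟩ := Γ.exists_open_smoothFamilyAt_defect m hc
  have hopen : IsOpen {p | ∀ z, defectVars D E K p z ∈ r} :=
    (isOpen_setOf_forall_mem hr).preimage (defectVars D E K).continuous
  have hmem : ∀ᶠ p in 𝓝 0, ∀ z, defectVars D E K p z ∈ r :=
    hopen.mem_nhds fun z => by simpa using h0r
  constructor
  · refine SmoothNear.of_contDiffAt ?_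
    filter_upwards [hmem] with p hp
    refine ContDiffAt.prodMk (ContDiffAt.comp p (g := superposition _) ?_ (defectVars D E K).contDiff.contDiffAt) ?_
    · exact (contDiffOn_superposition hr hH).contDiffAt ((isOpen_setOf_forall_mem hr).mem_nhds hp)
    · exact ((ContinuousMap.evalCLM (M := D) ℝ (1 : K)).contDiff.comp
        (contDiff_fst.comp contDiff_snd)).contDiffAt
  · filter_upwards [hmem] with p hp a
    simp only [defectMap, superposition_apply hH hp, defectVars_apply]

end LocalGroupoid

end
-- The linearization of the defect and its invertibility
noncomputable section

open MeasureTheory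

section Adjoint

variable {D : Type*} [NormedAddCommGroup D] [NormedSpace ℝ D]
  {K : Type*} [TopologicalSpace K] [Group K] [ChartedSpace D K] [LieGroup 𝓘(ℝ, D) ∞ K]
  {c : OpenPartialHomeomorph K D}

/-- The adjoint action of `a` on the model space, in the chart `c` at `1`. -/
def adjointCLM (c : OpenPartialHomeomorph K D) (a : K) : D →L[ℝ] D :=
  fderiv ℝ (fun w => c (a * c.symm w * a⁻¹)) 0

theorem IsUnitChart.smoothNear_conj (hc : IsUnitChart c) (a : K) :
    SmoothNear 𝓘(ℝ, D) (fun w => c (a * c.symm w * a⁻¹)) 0 := by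
  refine hc.smoothNear (((smoothNear_const a _).mul
    (hc.smoothNear_symm (ContDiff.smoothNear contDiff_id _) hc.zero_mem)).mul
      (smoothNear_const _ _)) ?_
  simpa [hc.symm_zero] using hc.one_mem

theorem IsUnitChart.hasFDerivAt_conj (hc : IsUnitChart c) (a : K) :
    HasFDerivAt (fun w => c (a * c.symm w * a⁻¹)) (adjointCLM c a) 0 :=
  ((hc.smoothNear_conj a).contDiffAt.self_of_nhds.differentiableAt (by simp)).hasFDerivAt

/-- Conjugation by `a` undoes conjugation by `a⁻¹` near `1`; the chain rule at `0` gives the claim.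
-/
theorem IsUnitChart.adjointCLM_apply_inv (hc : IsUnitChart c) (a : K) (v : D) :
    adjointCLM c a (adjointCLM c a⁻¹ v) = v := by
  have := topologicalGroup_of_lieGroup 𝓘(ℝ, D) ∞ (G := K)
  have h0 : c (a⁻¹ * c.symm 0 * a⁻¹⁻¹) = 0 := by simp [hc.symm_zero, hc.map_one]
  have h1 : HasFDerivAt (fun w => c (a * c.symm w * a⁻¹)) (adjointCLM c a)
      (c (a⁻¹ * c.symm 0 * a⁻¹⁻¹)) := by rw [h0]; exact hc.hasFDerivAt_conj a
  have h2 := h1.comp (0 : D) (hc.hasFDerivAt_conj a⁻¹)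
  have h3 : ((fun w => c (a * c.symm w * a⁻¹)) ∘ fun w => c (a⁻¹ * c.symm w * a⁻¹⁻¹)) =ᶠ[𝓝 0]
      id := by
    have hcont : ContinuousAt (fun w => a⁻¹ * c.symm w * a⁻¹⁻¹) 0 :=
      (continuousAt_const.mul (c.continuousAt_symm hc.zero_mem)).mul continuousAt_const
    filter_upwards [hcont.eventually_mem (c.open_source.mem_nhds
      (by simpa [hc.symm_zero] using hc.one_mem)), c.open_target.mem_nhds hc.zero_mem] with w hw hw'
    have : a * (a⁻¹ * c.symm w * a⁻¹⁻¹) * a⁻¹ = c.symm w := by group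
    simp only [Function.comp_apply, c.left_inv hw, this, c.right_inv hw', id]
  have h4 := (h2.congr_of_eventuallyEq h3.symm).unique (hasFDerivAt_id (0 : D))
  exact congrArg (fun L => L v) h4

theorem IsUnitChart.adjointCLM_injective (hc : IsUnitChart c) (a : K) :
    Function.Injective (adjointCLM c a) := by
  refine Function.LeftInverse.injective (g := adjointCLM c a⁻¹) fun v => ?_
  simpa using hc.adjointCLM_apply_inv a⁻¹ v

/-- Conjugation is a smooth family with parameter `a`, and derivatives of such families are jointly
continuous. This makes `a ↦ Ad_{a⁻¹} (χ a)` continuous in the proof of surjectivity. -/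
theorem IsUnitChart.continuous_adjointCLM (hc : IsUnitChart c) :
    Continuous (adjointCLM c : K → D →L[ℝ] D) := by
  rw [continuous_iff_continuousAt]
  intro a₀
  have h : ∀ᶠ p in 𝓝 ((0 : D), a₀), SmoothFamilyAt D
      (fun (a : K) w => c (a * c.symm w * a⁻¹)) p.2 p.1 := by
    have : IsTopologicalGroup K := topologicalGroup_of_lieGroup 𝓘(ℝ, D) ∞
    have e1 : ∀ᶠ a in 𝓝 a₀, a * a₀⁻¹ ∈ c.source :=
      ContinuousAt.eventually_mem (f := fun a => a * a₀⁻¹) (by fun_prop)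
        (c.open_source.mem_nhds (by simpa using hc.one_mem))
    refine eventually_smoothFamilyAt (c := fun a => c (a * a₀⁻¹))
      (Hh := fun p : D × D => c (c.symm p.1 * a₀ * c.symm p.2 * (c.symm p.1 * a₀)⁻¹)) ?_ ?_ ?_
    · filter_upwards [e1] with a ha
      exact ContinuousAt.comp (f := fun b => b * a₀⁻¹) (c.continuousAt ha) (by fun_prop)
    · simp only [mul_inv_cancel, hc.map_one]
      have sa : SmoothNear 𝓘(ℝ, D) (fun p : D × D => c.symm p.1 * a₀) (0, 0) :=
        (hc.smoothNear_symm (ContDiff.smoothNear contDiff_fst _) hc.zero_mem).mul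
          (smoothNear_const _ _)
      refine hc.smoothNear ((sa.mul (hc.smoothNear_symm (ContDiff.smoothNear contDiff_snd _)
        hc.zero_mem)).mul sa.inv) ?_
      simpa [hc.symm_zero] using hc.one_mem
    · filter_upwards [(continuous_fst.tendsto _).eventually e1] with p h1
      simp only [c.left_inv h1, inv_mul_cancel_right]
  exact ContinuousAt.comp (f := fun a => (a, (0 : D))) (x := a₀)
    h.self_of_nhds.fderiv.continuousAt (by fun_prop)

/-- The linearization of the defect in the variables `w`, `γ`, `e`. -/
theorem IsUnitChart.hasFDerivAt_twisted (hc : IsUnitChart c) (a : K) :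
    SmoothNear 𝓘(ℝ, D) (fun p : D × D × D =>
      c (a * c.symm p.1 * c.symm p.2.1 * (a * c.symm p.2.2)⁻¹)) 0 ∧
    ∀ p : D × D × D, fderiv ℝ (fun p : D × D × D =>
      c (a * c.symm p.1 * c.symm p.2.1 * (a * c.symm p.2.2)⁻¹)) 0 p =
        adjointCLM c a (p.1 + p.2.1 - p.2.2) := by
  have s : SmoothNear 𝓘(ℝ, D) (fun p : D × D × D =>
      c (a * c.symm p.1 * c.symm p.2.1 * (a * c.symm p.2.2)⁻¹)) 0 := by
    have s1 : SmoothNear 𝓘(ℝ, D) (fun p : D × D × D => p.1) 0 := ContDiff.smoothNear (by fun_prop) _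
    have s2 : SmoothNear 𝓘(ℝ, D) (fun p : D × D × D => p.2.1) 0 :=
      ContDiff.smoothNear (by fun_prop) _
    have s3 : SmoothNear 𝓘(ℝ, D) (fun p : D × D × D => p.2.2) 0 :=
      ContDiff.smoothNear (by fun_prop) _
    refine hc.smoothNear ((((smoothNear_const a _).mul (hc.smoothNear_symm s1 hc.zero_mem)).mul
      (hc.smoothNear_symm s2 hc.zero_mem)).mul
        ((smoothNear_const a _).mul (hc.smoothNear_symm s3 hc.zero_mem)).inv) ?_
    simpa [hc.symm_zero] using hc.one_mem
  refine ⟨s, ?_⟩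
  set q : D × D × D → D := fun p => c (a * c.symm p.1 * c.symm p.2.1 * (a * c.symm p.2.2)⁻¹)
  have hq : HasFDerivAt q (fderiv ℝ q 0) 0 :=
    (s.contDiffAt.self_of_nhds.differentiableAt (by simp)).hasFDerivAt
  have along : ∀ (J : D →L[ℝ] D × D × D), HasFDerivAt (fun w => q (J w)) ((fderiv ℝ q 0).comp J) 0 :=
    fun J => by
      have h1 : HasFDerivAt q (fderiv ℝ q 0) (J 0) := by rw [map_zero]; exact hq
      exact h1.comp (0 : D) J.hasFDerivAt
  have h1 : ∀ w, fderiv ℝ q 0 (w, 0, 0) = adjointCLM c a w := by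
    intro w
    have := along (ContinuousLinearMap.inl ℝ D (D × D))
    have h2 : (fun w => q (ContinuousLinearMap.inl ℝ D (D × D) w)) =
        fun w => c (a * c.symm w * a⁻¹) := by
      funext w; simp [q, hc.symm_zero]
    rw [h2] at this
    exact congrArg (fun L => L w) (this.unique (hc.hasFDerivAt_conj a))
  have h2 : ∀ w, fderiv ℝ q 0 (0, w, 0) = adjointCLM c a w := by
    intro w
    have := along ((ContinuousLinearMap.inr ℝ D (D × D)).comp (ContinuousLinearMap.inl ℝ D D))
    have h2 : (fun w => q ((ContinuousLinearMap.inr ℝ D (D × D)).comp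
        (ContinuousLinearMap.inl ℝ D D) w)) = fun w => c (a * c.symm w * a⁻¹) := by
      funext w; simp [q, hc.symm_zero]
    rw [h2] at this
    exact congrArg (fun L => L w) (this.unique (hc.hasFDerivAt_conj a))
  -- Along `w = e` with `γ = 0` the expression is constantly `c 1`. Hence the partial derivative in
  -- `e` is minus the one in `w`, with no need to differentiate an inverse.
  have h3 : ∀ w, fderiv ℝ q 0 (w, 0, w) = 0 := by
    intro w
    have := along ((ContinuousLinearMap.id ℝ D).prod (ContinuousLinearMap.inr ℝ D D))
    have h2 : (fun w => q (((ContinuousLinearMap.id ℝ D).prod (ContinuousLinearMap.inr ℝ D D)) w)) =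
        fun w => 0 := by
      funext w; simp [q, hc.symm_zero, hc.map_one]
    rw [h2] at this
    exact congrArg (fun L => L w) (this.unique (hasFDerivAt_const (0 : D) (0 : D)))
  rintro ⟨w, γ, e⟩
  have h4 : ((w, γ, e) : D × D × D) = (w - e, 0, 0) + (0, γ, 0) + (e, 0, e) := by simp
  rw [h4, map_add, map_add, h1, h2, h3, add_zero, ← map_add]
  congr 1
  simp only [Prod.fst_add, Prod.snd_add]
  abel

end Adjoint

namespace LocalGroupoid

variable {D : Type*} [NormedAddCommGroup D] [NormedSpace ℝ D] [FiniteDimensional ℝ D]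
  {E : Type*} [NormedAddCommGroup E] [NormedSpace ℝ E]
  {K : Type*} [TopologicalSpace K] [Group K] [ChartedSpace D K] [LieGroup 𝓘(ℝ, D) ∞ K]
  [CompactSpace K] {c : OpenPartialHomeomorph K D}
  [SecondCountableTopology K] [MeasurableSpace K] [BorelSpace K]
  (m : Measure K) [IsProbabilityMeasure m] [m.IsMulLeftInvariant] [m.IsMulRightInvariant]

/-- The variables `w`, `γ`, `e` of the defect at `a` on the fibre over `0`. -/
def fibreVars (D : Type*) {K : Type*} [NormedAddCommGroup D] [NormedSpace ℝ D]
    [TopologicalSpace K] [CompactSpace K] [Group K] [IsTopologicalGroup K] (a : K) :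
    (C(K, D) × D) →L[ℝ] C(K, D × D × D) :=
  LinearMap.mkContinuous
    { toFun := fun p => ⟨fun b => (p.1 (b * a), p.2, p.1 a), by fun_prop⟩
      map_add' := fun p q => by ext z <;> simp
      map_smul' := fun s p => by ext z <;> simp } 1 (fun p => by
        rw [ContinuousMap.norm_le _ (by positivity), _root_.one_mul]
        intro b
        change ‖(p.1 (b * a), p.2, p.1 a)‖ ≤ ‖p‖
        simp only [Prod.norm_def]
        have h1 := p.1.norm_coe_le_norm a
        have h2 := p.1.norm_coe_le_norm (b * a)
        exact max_le (h2.trans (le_max_left _ _))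
          (max_le (le_max_right _ _) (h1.trans (le_max_left _ _))))

/-- Over `y = 0` the product is that of `K`, and `b⁻¹ (b a) = a`, so `b` enters only through `η(b
a)`. Differentiating under the integral and using right invariance leaves `∫ η`. -/
theorem fderiv_defectMap_fst (Γ : LocalGroupoid D E K) (hc : IsUnitChart c)
    {f' : (C(K, D) × D) →L[ℝ] (C(K, D) × D)}
    (hf' : HasFDerivAt (fun v => Γ.defectMap c m (0, v)) f' 0) (η : C(K, D)) (γ : D) (a : K) :
    (f' (η, γ)).1 a = adjointCLM c a (∫ b, η b ∂m + γ - η a) := by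
  have := topologicalGroup_of_lieGroup 𝓘(ℝ, D) ∞ (G := K)
  obtain ⟨hs, hq⟩ := hc.hasFDerivAt_twisted a
  set q : D × D × D → D := fun p => c (a * c.symm p.1 * c.symm p.2.1 * (a * c.symm p.2.2)⁻¹)
  obtain ⟨r, hr, h0r, hH⟩ : ∃ r : Set (D × D × D), IsOpen r ∧ 0 ∈ r ∧
      ∀ b : K, ∀ x ∈ r, SmoothFamilyAt D (fun (_ : K) x => q x) b x := by
    refine exists_open_smoothFamilyAt fun b => ?_
    refine eventually_smoothFamilyAt (c := fun _ => (0 : D)) (Hh := fun p : D × (D × D × D) => q p.2)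
      (Eventually.of_forall fun _ => continuousAt_const) ?_ (Eventually.of_forall fun _ => rfl)
    exact SmoothNear.of_contDiffAt (((continuous_snd.tendsto ((0 : D), (0 : D × D × D))).eventually
        hs.contDiffAt).mono fun p hp => ContDiffAt.comp (g := q) p hp contDiffAt_snd)
  have hζ0 : ∀ b, (fibreVars D a (0 : C(K, D) × D)) b ∈ r := fun b => by simpa using h0r
  have h1 := hasFDerivAt_superposition hr hH hζ0
  have h2 := ((integralCLM (W := D) m).hasFDerivAt.comp _ h1).comp (0 : C(K, D) × D)
    (fibreVars D a).hasFDerivAt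
  have h3 : HasFDerivAt (fun v => (Γ.defectMap c m (0, v)).1 a)
      ((ContinuousMap.evalCLM (M := D) ℝ a).comp ((ContinuousLinearMap.fst ℝ C(K, D) D).comp f')) 0 :=
    (((ContinuousMap.evalCLM (M := D) ℝ a).comp
      (ContinuousLinearMap.fst ℝ C(K, D) D)).hasFDerivAt.comp (0 : C(K, D) × D) hf')
  have h4 : (fun v => (Γ.defectMap c m (0, v)).1 a) =ᶠ[𝓝 0]
      fun v => integralCLM m (superposition (fun (_ : K) x => q x) (fibreVars D a v)) := by
    have hopen : IsOpen {v | ∀ b, fibreVars D a v b ∈ r} :=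
      (isOpen_setOf_forall_mem hr).preimage (fibreVars D a).continuous
    have t : Tendsto (fun v : C(K, D) × D => ((0 : E), v)) (𝓝 0) (𝓝 0) :=
      Continuous.tendsto' (by fun_prop) _ _ rfl
    filter_upwards [t.eventually (Γ.smoothNear_defectMap m hc).2, hopen.mem_nhds hζ0] with v hv hvr
    rw [hv a, integralCLM_apply, defect]
    refine integral_congr_ae (Eventually.of_forall fun b => ?_)
    change _ = superposition (fun (_ : K) x => q x) (fibreVars D a v) b
    rw [superposition_apply hH hvr]
    change c (defectArg c a b (Γ.mul b a 0) (v.1 a) v.2 (v.1 (Γ.mul b a 0))) =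
      c (a * c.symm (v.1 (b * a)) * c.symm v.2 * (a * c.symm (v.1 a))⁻¹)
    rw [Γ.mul_at_zero, defectArg]
    congr 1
    group
  have h5 := (h2.congr_of_eventuallyEq h4).unique h3
  have h6 := congrArg (fun L => L (η, γ)) h5
  have hH' : ∀ b : K, ∀ x ∈ r, SmoothFamilyAt D (fun (_ : K) x => fderiv ℝ q x) b x :=
    fun b x hx => (hH b x hx).fderiv
  have h7 : (f' (η, γ)).1 a = ∫ b, adjointCLM c a (η (b * a) + γ - η a) ∂m := by
    refine Eq.trans h6.symm ?_
    refine integral_congr_ae (Eventually.of_forall fun b => ?_)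
    change superposition (fun (_ : K) x => fderiv ℝ q x) (fibreVars D a (0 : C(K, D) × D)) b
      (η (b * a), γ, η a) = _
    rw [superposition_apply hH' hζ0]
    have : fibreVars D a (0 : C(K, D) × D) b = 0 := by simp
    rw [this, hq]
  have i1 : Integrable (fun b => η (b * a)) m :=
    (η.comp ⟨fun b => b * a, by fun_prop⟩).integrable_of_compactSpace m
  have i2 : Integrable (fun b => η (b * a) + γ) m := i1.add (integrable_const γ)
  have i3 : Integrable (fun b => η (b * a) + γ - η a) m := i2.sub (integrable_const _)
  rw [h7, ContinuousLinearMap.integral_comp_comm _ i3, integral_sub i2 (integrable_const _),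
    integral_add i1 (integrable_const γ), integral_mul_right_eq_self (fun b => η b)]
  simp

/-- As `Ad_a` is invertible, the question is about `(η, γ) ↦ (∫ η + γ - η(a), η(1))`. If this
vanishes then `η` is constant, hence zero by its value at `1`, and then `γ = 0`. -/
theorem fderiv_defectMap_bijective (Γ : LocalGroupoid D E K) (hc : IsUnitChart c)
    {f' : (C(K, D) × D) →L[ℝ] (C(K, D) × D)}
    (hf' : HasFDerivAt (fun v => Γ.defectMap c m (0, v)) f' 0) :
    Function.Bijective f' := by
  have hfst := Γ.fderiv_defectMap_fst m hc hf'
  have hsnd : ∀ η γ, (f' (η, γ)).2 = η 1 := by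
    intro η γ
    have h1 := (ContinuousLinearMap.snd ℝ C(K, D) D).hasFDerivAt.comp (0 : C(K, D) × D) hf'
    have h2 : HasFDerivAt (fun v : C(K, D) × D => v.1 1)
        ((ContinuousMap.evalCLM (M := D) ℝ (1 : K)).comp (ContinuousLinearMap.fst ℝ C(K, D) D)) 0 :=
      ((ContinuousMap.evalCLM (M := D) ℝ (1 : K)).comp
        (ContinuousLinearMap.fst ℝ C(K, D) D)).hasFDerivAt
    exact congrArg (fun L => L (η, γ)) (h1.unique h2)
  constructor
  · rw [injective_iff_map_eq_zero]
    rintro ⟨η, γ⟩ h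
    have h1 : ∀ a, ∫ b, η b ∂m + γ - η a = 0 := by
      intro a
      apply hc.adjointCLM_injective a
      rw [← hfst, h, map_zero]
      rfl
    have h2 : η 1 = 0 := by rw [← hsnd η γ, h]; rfl
    have h3 : η = 0 := by
      ext a
      have := h1 a
      rw [← h1 1, h2] at this
      simpa using this
    have h4 := h1 1
    subst h3
    simp at h4
    simp [h4]
  · rintro ⟨χ, δ⟩
    let χ' : C(K, D) := ⟨fun a => adjointCLM c a⁻¹ (χ a), by
      have := topologicalGroup_of_lieGroup 𝓘(ℝ, D) ∞ (G := K)
      exact (hc.continuous_adjointCLM.comp continuous_inv).clm_apply χ.continuous⟩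
    -- Solving `∫ η + γ - η(a) = χ'(a)` determines `η` up to a constant, which is fixed by `η(1) =
    -- δ`; `γ` is then read off.
    let η : C(K, D) := ContinuousMap.const K (δ + χ' 1) - χ'
    refine ⟨(η, χ' 1 + δ - ∫ b, η b ∂m), Prod.ext ?_ ?_⟩
    · ext a
      rw [hfst]
      have : ∫ b, η b ∂m + (χ' 1 + δ - ∫ b, η b ∂m) - η a = χ' a := by
        have : η a = δ + χ' 1 - χ' a := rfl
        rw [this]; abel
      rw [this]
      exact hc.adjointCLM_apply_inv a (χ a)
    · rw [hsnd]
      change δ + χ' 1 - χ' 1 = δ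
      abel

end LocalGroupoid

end
-- The solution of the defect equation and its regularity
noncomputable section

open MeasureTheory

namespace LocalGroupoid

variable {D : Type*} [NormedAddCommGroup D] [NormedSpace ℝ D] [FiniteDimensional ℝ D]
  {E : Type*} [NormedAddCommGroup E] [NormedSpace ℝ E] [CompleteSpace E]
  {K : Type*} [TopologicalSpace K] [Group K] [ChartedSpace D K] [LieGroup 𝓘(ℝ, D) ∞ K]
  [CompactSpace K] {c : OpenPartialHomeomorph K D}
  [SecondCountableTopology K] [MeasurableSpace K] [BorelSpace K]
  (m : Measure K) [IsProbabilityMeasure m] [m.IsMulLeftInvariant] [m.IsMulRightInvariant]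

/-- For `y` near `0`, the equation for the homomorphism has a unique solution near the
inclusion of `K`, which depends smoothly on `y`. -/
theorem exists_solution (Γ : LocalGroupoid D E K) (hc : IsUnitChart c) :
    ∃ φ : E → C(K, D) × D, φ 0 = 0 ∧ (∀ᶠ y in 𝓝 0, ContDiffAt ℝ ∞ φ y) ∧
      (∀ᶠ y in 𝓝 0, (∀ a, Γ.defect c m a y ((φ y).1 a) (φ y).2 (φ y).1 = 0) ∧ (φ y).1 1 = 0) ∧
      ∀ᶠ p in 𝓝 (0 : E × (C(K, D) × D)),
        (∀ a, Γ.defect c m a p.1 (p.2.1 a) p.2.2 p.2.1 = 0) → p.2.1 1 = 0 → p.2 = φ p.1 := by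
  obtain ⟨hs, he⟩ := Γ.smoothNear_defectMap m hc
  have h0 : Γ.defectMap c m (0, 0) = 0 := by
    refine Prod.ext ?_ rfl
    ext a
    have := he.self_of_nhds a
    refine this.trans ?_
    simp [defect, defectArg, Γ.mul_at_zero, hc.symm_zero, hc.map_one]
  have hd : HasFDerivAt (fun v => Γ.defectMap c m (0, v))
      ((fderiv ℝ (Γ.defectMap c m) (0, 0)).comp (ContinuousLinearMap.inr ℝ E (C(K, D) × D))) 0 :=
    ((hs.contDiffAt.self_of_nhds.differentiableAt (by simp)).hasFDerivAt).comp
      (0 : C(K, D) × D) (hasFDerivAt_prodMk_right (0 : E) (0 : C(K, D) × D))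
  obtain ⟨φ, hφ0, hφs, hφ, hφu⟩ := ContDiffAt.exists_implicit (x₀ := (0 : E))
    (v₀ := (0 : C(K, D) × D)) hs.contDiffAt h0 hd (Γ.fderiv_defectMap_bijective m hc hd)
  refine ⟨φ, hφ0, hφs, ?_, ?_⟩
  · have t : Tendsto (fun y => (y, φ y)) (𝓝 0) (𝓝 (0 : E × (C(K, D) × D))) := by
      have := continuousAt_id.prodMk hφs.self_of_nhds.continuousAt
      simp only [ContinuousAt, hφ0] at this
      exact this
    filter_upwards [hφ, t.eventually he] with y h1 h2
    exact ⟨fun a => by rw [← h2 a, h1]; rfl, congrArg Prod.snd h1⟩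
  · filter_upwards [hφu, he] with p h1 h2 h3 h4
    refine h1 (Prod.ext ?_ h4)
    ext a
    rw [h2 a, h3 a]
    rfl

/-- With `φ(y)` regarded as known, the equation at `a` is a finite dimensional equation for the
single vector `e = η(a)`, with data smooth in `(a, y)`. Its derivative in `e` is `-Ad_a`, so the
implicit function theorem makes `e` smooth in `(a, y)` jointly. -/
theorem eventually_contMDiffAt_solution (Γ : LocalGroupoid D E K) (hc : IsUnitChart c)
    {φ : E → C(K, D) × D} (hφ0 : φ 0 = 0) (hφs : ∀ᶠ y in 𝓝 0, ContDiffAt ℝ ∞ φ y)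
    (hφ : ∀ᶠ y in 𝓝 0, ∀ a, Γ.defect c m a y ((φ y).1 a) (φ y).2 (φ y).1 = 0) :
    ∀ᶠ y in 𝓝 (0 : E), ∀ a, ContMDiffAt (𝓘(ℝ, D).prod 𝓘(ℝ, E)) 𝓘(ℝ, D) ∞
      (fun p : K × E => p.1 * c.symm ((φ p.2).1 p.1)) (a, y) := by
  have := topologicalGroup_of_lieGroup 𝓘(ℝ, D) ∞ (G := K)
  suffices h : ∀ᶠ y in 𝓝 (0 : E), ∀ a ∈ (univ : Set K),
      ContMDiffAt (𝓘(ℝ, D).prod 𝓘(ℝ, E)) 𝓘(ℝ, D) ∞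
        (fun p : K × E => p.1 * c.symm ((φ p.2).1 p.1)) (a, y) from
    h.mono fun y hy a => hy a (mem_univ a)
  refine isCompact_univ.eventually_forall_of_forall_eventually fun a₀ _ => ?_
  -- the value at `a` solves a finite dimensional equation
  let N : (D × E) × D → D := fun p =>
    Γ.defect c m (c.symm p.1.1 * a₀) p.1.2 p.2 (φ p.1.2).2 (φ p.1.2).1
  have hφn : SmoothNear 𝓘(ℝ, C(K, D) × D) (fun p : (D × E) × D => φ p.1.2) ((0, 0), 0) := by
    refine SmoothNear.comp (f := fun p : (D × E) × D => p.1.2) (g := φ) (I := 𝓘(ℝ, E)) ?_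
      (ContDiff.smoothNear (by fun_prop) _)
    exact hφs.mono fun y hy => hy.contMDiffAt
  have hN : SmoothNear 𝓘(ℝ, D) N ((0, 0), 0) := by
    refine SmoothNear.of_contDiffAt ?_
    have hj : ∀ᶠ p in 𝓝 (((0, 0), 0) : (D × E) × D), ContDiffAt ℝ ∞ (fun p : (D × E) × D =>
        ((p.1.1, (p.1.2, p.2, (φ p.1.2).2, (φ p.1.2).1)) : D × (E × D × D × C(K, D)))) p := by
      filter_upwards [hφn.contDiffAt] with p hp
      have h1 : ContDiffAt ℝ ∞ (fun p : (D × E) × D => (φ p.1.2).1) p := contDiffAt_fst.comp p hp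
      have h2 : ContDiffAt ℝ ∞ (fun p : (D × E) × D => (φ p.1.2).2) p := contDiffAt_snd.comp p hp
      fun_prop
    have hj0 : ((((0, 0), 0) : (D × E) × D).1.1, ((((0, 0), 0) : (D × E) × D).1.2,
        (((0, 0), 0) : (D × E) × D).2, (φ 0).2, (φ 0).1)) =
        (0 : D × (E × D × D × C(K, D))) := by rw [hφ0]; rfl
    have hjc := hj.self_of_nhds.continuousAt
    have t : Tendsto (fun p : (D × E) × D =>
        ((p.1.1, (p.1.2, p.2, (φ p.1.2).2, (φ p.1.2).1)) : D × (E × D × D × C(K, D))))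
        (𝓝 ((0, 0), 0)) (𝓝 0) := by
      rw [← hj0]; exact hjc
    filter_upwards [hj, t.eventually (Γ.smoothNear_defect m hc a₀).contDiffAt] with p h1 h2
    exact ContDiffAt.comp (g := fun p : D × (E × D × D × C(K, D)) =>
      Γ.defect c m (c.symm p.1 * a₀) p.2.1 p.2.2.1 p.2.2.2.1 p.2.2.2.2) p h2 h1
  obtain ⟨hqs, hq⟩ := hc.hasFDerivAt_twisted a₀
  let J : D →L[ℝ] D × D × D :=
    (ContinuousLinearMap.inr ℝ D (D × D)).comp (ContinuousLinearMap.inr ℝ D D)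
  -- At `y = 0` both `η` and `γ` vanish and the integrand `c (a₀ (a₀ e(e))⁻¹)` does not depend on
  -- `b`, so the integral disappears.
  have hNe : (fun e => N ((0, 0), e)) = fun e =>
      (fun p : D × D × D => c (a₀ * c.symm p.1 * c.symm p.2.1 * (a₀ * c.symm p.2.2)⁻¹)) (J e) := by
    funext e
    have h1 : ∀ b : K, defectArg c a₀ b (b * a₀) e 0 0 = a₀ * (a₀ * c.symm e)⁻¹ := by
      intro b; simp only [defectArg, hc.symm_zero]; group
    simp [N, J, hφ0, defect, hc.symm_zero, Γ.mul_at_zero, h1]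
  have hNd : HasFDerivAt (fun e => N ((0, 0), e)) ((fderiv ℝ (fun p : D × D × D =>
      c (a₀ * c.symm p.1 * c.symm p.2.1 * (a₀ * c.symm p.2.2)⁻¹)) 0).comp J) 0 := by
    rw [hNe]
    have h1 := (hqs.contDiffAt.self_of_nhds.differentiableAt (by simp)).hasFDerivAt
    have h2 : (0 : D × D × D) = J 0 := (map_zero J).symm
    rw [h2] at h1 ⊢
    exact h1.comp (0 : D) J.hasFDerivAt
  have hN0 : N ((0, 0), 0) = 0 := by
    have : N ((0, 0), 0) = (fun e => N ((0, 0), e)) 0 := rfl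
    rw [this, hNe]
    simp [hc.symm_zero, hc.map_one]
  have hb : Function.Bijective ((fderiv ℝ (fun p : D × D × D =>
      c (a₀ * c.symm p.1 * c.symm p.2.1 * (a₀ * c.symm p.2.2)⁻¹)) 0).comp J) := by
    have h1 : ∀ e, ((fderiv ℝ (fun p : D × D × D =>
        c (a₀ * c.symm p.1 * c.symm p.2.1 * (a₀ * c.symm p.2.2)⁻¹)) 0).comp J) e =
          adjointCLM c a₀ (-e) := by
      intro e
      rw [ContinuousLinearMap.comp_apply, hq]
      simp [J]
    refine ⟨fun e e' h => ?_, fun v => ⟨-adjointCLM c a₀⁻¹ v, ?_⟩⟩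
    · rw [h1, h1] at h
      simpa using hc.adjointCLM_injective a₀ h
    · rw [h1, neg_neg, hc.adjointCLM_apply_inv]
  obtain ⟨ψ, hψ0, hψs, -, hψu⟩ := ContDiffAt.exists_implicit (x₀ := ((0, 0) : D × E))
    (v₀ := (0 : D)) hN.contDiffAt hN0 hNd hb
  have hφc : ContinuousAt φ 0 := hφs.self_of_nhds.continuousAt
  have hηc : ContinuousAt (fun p : E × K => (φ p.1).1 p.2) (0, a₀) :=
    ContinuousAt.comp (f := fun p : E × K => ((φ p.1).1, p.2))
      (g := fun q : C(K, D) × K => q.1 q.2) (ContinuousEval.continuous_eval.continuousAt)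
      ((ContinuousAt.comp (f := fun p : E × K => p.1) (g := fun y => (φ y).1)
        (continuousAt_fst.comp hφc) continuousAt_fst).prodMk continuousAt_snd)
  have e1 : ∀ᶠ p : E × K in 𝓝 (0, a₀), p.2 * a₀⁻¹ ∈ c.source :=
    (continuous_snd.tendsto ((0 : E), a₀)).eventually (hc.eventually_mul_inv_mem a₀)
  have hcc : ContinuousAt (fun p : E × K => c (p.2 * a₀⁻¹)) (0, a₀) :=
    ContinuousAt.comp (f := fun p : E × K => p.2) (g := fun a => c (a * a₀⁻¹))
      (c.continuousAt_mul_inv (by simpa using hc.one_mem)) continuousAt_snd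
  have t1 : Tendsto (fun p : E × K => ((c (p.2 * a₀⁻¹), p.1) : D × E)) (𝓝 (0, a₀))
      (𝓝 (0, 0)) := by
    have := (hcc.prodMk continuousAt_fst).tendsto
    simpa [hc.map_one] using this
  have t2 : Tendsto (fun p : E × K => (((c (p.2 * a₀⁻¹), p.1), (φ p.1).1 p.2) : (D × E) × D))
      (𝓝 (0, a₀)) (𝓝 ((0, 0), 0)) := by
    refine t1.prodMk_nhds ?_
    simpa [ContinuousAt, hφ0] using hηc
  -- Continuity of `η` in `(y, a)` keeps the value in the region of uniqueness, where it must equal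
  -- the smooth solution `ψ`.
  have hψ : ∀ᶠ p : E × K in 𝓝 (0, a₀), (φ p.1).1 p.2 = ψ (c (p.2 * a₀⁻¹), p.1) := by
    filter_upwards [t2.eventually hψu, e1, (continuous_fst.tendsto _).eventually hφ] with p h1 h2 h3
    refine h1 ?_
    simp only [N, c.left_inv h2, inv_mul_cancel_right]
    exact h3 p.2
  have e3 : ∀ᶠ p : E × K in 𝓝 (0, a₀), ψ (c (p.2 * a₀⁻¹), p.1) ∈ c.target := by
    have h1 : ContinuousAt (fun p : E × K => ψ (c (p.2 * a₀⁻¹), p.1)) (0, a₀) := by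
      refine ContinuousAt.comp (g := ψ) ?_ (hcc.prodMk continuousAt_fst)
      simpa [hc.map_one] using hψs.self_of_nhds.continuousAt
    exact h1.eventually_mem (c.open_target.mem_nhds (by simpa [hc.map_one, hψ0] using hc.zero_mem))
  filter_upwards [hψ.eventually_nhds, t1.eventually hψs, e1, e3] with p h1 h2 h3 h4
  have hsw : Tendsto (fun q : K × E => (q.2, q.1)) (𝓝 (p.2, p.1)) (𝓝 p) :=
    Continuous.tendsto (by fun_prop) _
  have h5 : (fun q : K × E => q.1 * c.symm ((φ q.2).1 q.1)) =ᶠ[𝓝 (p.2, p.1)]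
      fun q => q.1 * c.symm (ψ (c (q.1 * a₀⁻¹), q.2)) := by
    filter_upwards [hsw.eventually h1] with q hq
    rw [hq]
  refine ContMDiffAt.congr_of_eventuallyEq ?_ h5
  have s1 : ContMDiffAt (𝓘(ℝ, D).prod 𝓘(ℝ, E)) 𝓘(ℝ, D) ∞
      (fun q : K × E => c (q.1 * a₀⁻¹)) (p.2, p.1) :=
    ContMDiffAt.comp (g := c) (f := fun q : K × E => q.1 * a₀⁻¹) _ (hc.smooth _ h3)
      (contMDiffAt_fst.mul contMDiffAt_const)
  have s2 : ContMDiffAt (𝓘(ℝ, D).prod 𝓘(ℝ, E)) 𝓘(ℝ, D) ∞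
      (fun q : K × E => ψ (c (q.1 * a₀⁻¹), q.2)) (p.2, p.1) :=
    ContMDiffAt.comp (I' := 𝓘(ℝ, D × E)) (g := ψ) (f := fun q : K × E => (c (q.1 * a₀⁻¹), q.2)) _
      h2.contMDiffAt (s1.prodMk_space contMDiffAt_snd)
  exact contMDiffAt_fst.mul (ContMDiffAt.comp (g := c.symm)
    (f := fun q : K × E => ψ (c (q.1 * a₀⁻¹), q.2)) _ (hc.smooth_symm _ h4) s2)

end LocalGroupoid

end
-- Bi-invariant measure and multiplicativity of the solution
noncomputable section

open MeasureTheory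

/-- Right translates of Haar measure are again left invariant, hence multiples of it; both have
total mass `1`, so the factor is `1`. -/
theorem exists_biinvariant_measure (K : Type*) [TopologicalSpace K] [Group K]
    [IsTopologicalGroup K] [CompactSpace K] [MeasurableSpace K] [BorelSpace K] :
    ∃ m : Measure K, IsProbabilityMeasure m ∧ m.IsMulLeftInvariant ∧ m.IsMulRightInvariant := by
  let m : Measure K := Measure.haarMeasure ⊤
  have h1 : IsProbabilityMeasure m := ⟨by
    simpa using Measure.haarMeasure_self (K₀ := (⊤ : TopologicalSpace.PositiveCompacts K))⟩
  refine ⟨m, h1, inferInstance, ⟨fun g => ?_⟩⟩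
  have h2 : (m.map (· * g)).IsMulLeftInvariant := by infer_instance
  have h3 : IsProbabilityMeasure (m.map (· * g)) :=
    Measure.isProbabilityMeasure_map (by fun_prop)
  have h4 := Measure.isMulInvariant_eq_smul_of_compactSpace (m.map (· * g)) m
  have h5 := congrArg (fun μ : Measure K => μ univ) h4
  simp only [measure_univ, Measure.smul_apply] at h5
  rw [h4]
  have h6 : Measure.haarScalarFactor (m.map (· * g)) m = 1 := by
    have : (1 : ENNReal) = (Measure.haarScalarFactor (m.map (· * g)) m : ENNReal) := by
      simpa [ENNReal.smul_def] using h5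
    exact_mod_cast this.symm
  rw [h6, one_smul]

namespace LocalGroupoid

variable {D : Type*} [NormedAddCommGroup D] [NormedSpace ℝ D] [FiniteDimensional ℝ D]
  {E : Type*} [NormedAddCommGroup E] [NormedSpace ℝ E] [CompleteSpace E]
  {K : Type*} [TopologicalSpace K] [Group K] [ChartedSpace D K] [LieGroup 𝓘(ℝ, D) ∞ K]
  [CompactSpace K] [SecondCountableTopology K]

/-- A local groupoid admits a smooth homomorphism to `K` which is the identity on `K`. -/
theorem exists_homomorphism (Γ : LocalGroupoid D E K) :
    ∃ r : K → E → K, (∀ a, r a 0 = a) ∧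
      (∀ᶠ y in 𝓝 (0 : E), ∀ a, ContMDiffAt (𝓘(ℝ, D).prod 𝓘(ℝ, E)) 𝓘(ℝ, D) ∞
        (fun p : K × E => r p.1 p.2) (a, y)) ∧
      ∀ᶠ y in 𝓝 (0 : E), ∀ a b, r (Γ.mul b a y) y = r b (Γ.tgt a y) * r a y := by
  have := topologicalGroup_of_lieGroup 𝓘(ℝ, D) ∞ (G := K)
  have : IsManifold 𝓘(ℝ, D) ∞ K := inferInstance
  borelize K
  obtain ⟨m, _, _, _⟩ := exists_biinvariant_measure K
  obtain ⟨c, hc⟩ := exists_isUnitChart D K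
  obtain ⟨φ, hφ0, hφs, hφ, hφu⟩ := Γ.exists_solution m hc
  have hsm := Γ.eventually_contMDiffAt_solution m hc hφ0 hφs (hφ.mono fun y hy => hy.1)
  let r : K → E → K := fun a y => a * c.symm ((φ y).1 a)
  have hr0 : ∀ a, r a 0 = a := fun a => by simp [r, hφ0, hc.symm_zero]
  refine ⟨r, hr0, hsm, ?_⟩
  -- `ε` is the radius of the region of uniqueness. The bounds below use `ε / 2` since pointwise
  -- strict bounds give only a weak inequality for the sup norm.
  obtain ⟨ε, hε, hU⟩ := Metric.eventually_nhds_iff_ball.1 hφu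
  have hrc : ∀ a, ContinuousAt (fun p : K × E => r p.1 p.2) (a, 0) :=
    fun a => (hsm.self_of_nhds a).continuousAt
  -- everything is uniformly small for `y` small
  have key : ∀ᶠ y in 𝓝 (0 : E), ∀ w ∈ (univ : Set (K × K)),
      (w.2⁻¹ * r (Γ.mul w.2 w.1 y) y * (r w.1 y)⁻¹ ∈ c.source ∧
        ‖c (w.2⁻¹ * r (Γ.mul w.2 w.1 y) y * (r w.1 y)⁻¹)‖ < ε / 2) ∧
      (r w.1 y * c.symm (φ y).2 * (r w.1 y)⁻¹ ∈ c.source ∧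
        ‖c (r w.1 y * c.symm (φ y).2 * (r w.1 y)⁻¹)‖ < ε / 2) ∧ ‖Γ.tgt w.1 y‖ < ε / 2 := by
    refine isCompact_univ.eventually_forall_of_forall_eventually ?_
    rintro ⟨a, b⟩ -
    have h1 : ContinuousAt (fun p : E × (K × K) => r p.2.1 p.1) (0, (a, b)) :=
      ContinuousAt.comp (f := fun p : E × (K × K) => (p.2.1, p.1))
        (g := fun p : K × E => r p.1 p.2) (hrc a) (by fun_prop)
    have h2 : ContinuousAt (fun p : E × (K × K) => Γ.mul p.2.2 p.2.1 p.1) (0, (a, b)) :=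
      ContinuousAt.comp (f := fun p : E × (K × K) => (p.2.2, p.2.1, p.1))
        (Γ.continuousAt_mul Γ.zero_mem) (by fun_prop)
    have h3 : ContinuousAt (fun p : E × (K × K) => r (Γ.mul p.2.2 p.2.1 p.1) p.1) (0, (a, b)) :=
      ContinuousAt.comp (f := fun p : E × (K × K) => (Γ.mul p.2.2 p.2.1 p.1, p.1))
        (g := fun p : K × E => r p.1 p.2) (hrc _) (h2.prodMk continuousAt_fst)
    have h4 : ContinuousAt (fun p : E × (K × K) =>
        p.2.2⁻¹ * r (Γ.mul p.2.2 p.2.1 p.1) p.1 * (r p.2.1 p.1)⁻¹) (0, (a, b)) :=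
      (ContinuousAt.mul (by fun_prop) h3).mul h1.inv
    have h5 : ContinuousAt (fun p : E × (K × K) => c.symm (φ p.1).2) (0, (a, b)) := by
      have hφc : ContinuousAt φ 0 := hφs.self_of_nhds.continuousAt
      have h6 : ContinuousAt (fun y => c.symm (φ y).2) 0 :=
        ContinuousAt.comp (f := fun y => (φ y).2) (g := c.symm)
          (by simpa [hφ0] using c.continuousAt_symm hc.zero_mem) (continuousAt_snd.comp hφc)
      exact ContinuousAt.comp (f := fun p : E × (K × K) => p.1) (g := fun y => c.symm (φ y).2) h6
        continuousAt_fst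
    have h6 : ContinuousAt (fun p : E × (K × K) =>
        r p.2.1 p.1 * c.symm (φ p.1).2 * (r p.2.1 p.1)⁻¹) (0, (a, b)) := (h1.mul h5).mul h1.inv
    have h7 : ContinuousAt (fun p : E × (K × K) => Γ.tgt p.2.1 p.1) (0, (a, b)) :=
      ContinuousAt.comp (f := fun p : E × (K × K) => (p.1, p.2.1))
        (g := fun p : E × K => Γ.tgt p.2 p.1) (Γ.continuousAt_tgt a) (by fun_prop)
    have e4 : b⁻¹ * r (Γ.mul b a 0) 0 * (r a 0)⁻¹ = 1 := by
      rw [hr0, hr0, Γ.mul_at_zero]; group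
    have e6 : r a 0 * c.symm (φ 0).2 * (r a 0)⁻¹ = 1 := by
      rw [hφ0, Prod.snd_zero, hc.symm_zero]; group
    have small : ∀ {f : E × (K × K) → K}, ContinuousAt f (0, (a, b)) → f (0, (a, b)) = 1 →
        ∀ᶠ p in 𝓝 (0, (a, b)), f p ∈ c.source ∧ ‖c (f p)‖ < ε / 2 := by
      intro f hf hf1
      have h8 : ContinuousAt (fun p => c (f p)) (0, (a, b)) :=
        ContinuousAt.comp (g := c) (c.continuousAt (by rw [hf1]; exact hc.one_mem)) hf
      refine (hf.eventually_mem (c.open_source.mem_nhds (by rw [hf1]; exact hc.one_mem))).and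
        (h8.norm.eventually_mem (Iio_mem_nhds ?_))
      rw [hf1, hc.map_one, norm_zero]
      exact half_pos hε
    refine (small h4 e4).and ((small h6 e6).and (h7.norm.eventually_mem (Iio_mem_nhds ?_)))
    rw [Γ.tgt_at_zero, norm_zero]
    exact half_pos hε
  have hdom : ∀ᶠ y in 𝓝 (0 : E), y ∈ Γ.dom := Γ.isOpen_dom.mem_nhds Γ.zero_mem
  filter_upwards [key, hφ, hsm, hdom, Γ.mul_assoc_near, Γ.one_mul_near] with y hk hφy hsy hd has h1m a
  have hkb := fun b => (hk (a, b) (mem_univ _)).1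
  have hka := (hk (a, 1) (mem_univ _)).2
  have hcont : Continuous fun b => b⁻¹ * r (Γ.mul b a y) y * (r a y)⁻¹ := by
    refine (continuous_inv.mul ?_).mul continuous_const
    refine continuous_iff_continuousAt.2 fun b => ?_
    have h2 : ContinuousAt (fun b => Γ.mul b a y) b :=
      ContinuousAt.comp (f := fun b => (b, a, y)) (Γ.continuousAt_mul hd) (by fun_prop)
    exact ContinuousAt.comp (f := fun b => (Γ.mul b a y, y)) (g := fun p : K × E => r p.1 p.2)
      (hsy _).continuousAt (h2.prodMk continuousAt_const)
  -- For the arrow `(a, y)`, these data encode `b e(η b) = r(b a, y) r(a, y)⁻¹` and `e(γ)`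
  -- conjugated by `r(a, y)`, a candidate solution at the target of the arrow.
  let η : C(K, D) := ⟨fun b => c (b⁻¹ * r (Γ.mul b a y) y * (r a y)⁻¹),
    continuous_iff_continuousAt.2 fun b =>
      ContinuousAt.comp (g := c) (c.continuousAt (hkb b).1) hcont.continuousAt⟩
  let γ : D := c (r a y * c.symm (φ y).2 * (r a y)⁻¹)
  have hη : ∀ b, b * c.symm (η b) = r (Γ.mul b a y) y * (r a y)⁻¹ := by
    intro b
    change b * c.symm (c _) = _
    rw [c.left_inv (hkb b).1]
    group
  have hγ : c.symm γ = r a y * c.symm (φ y).2 * (r a y)⁻¹ := c.left_inv hka.1.1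
  have hball : ((Γ.tgt a y, (η, γ)) : E × (C(K, D) × D)) ∈ Metric.ball 0 ε := by
    rw [mem_ball_zero_iff]
    have h1 : ‖η‖ ≤ ε / 2 := (ContinuousMap.norm_le _ (half_pos hε).le).2 fun b => (hkb b).2.le
    have h2 : ‖γ‖ ≤ ε / 2 := hka.1.2.le
    have h3 : ‖((Γ.tgt a y, (η, γ)) : E × (C(K, D) × D))‖ ≤ ε / 2 :=
      max_le hka.2.le (max_le h1 h2)
    linarith
  have hsol : ((η, γ) : C(K, D) × D) = φ (Γ.tgt a y) := by
    refine hU _ hball (fun b => ?_) ?_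
    -- In the equation at the target the factors `r(a, y)` cancel, and by associativity what remains
    -- is the equation over `y` at the product `b a`.
    · rw [← hφy.1 (Γ.mul b a y)]
      simp only [defect]
      refine integral_congr_ae (Eventually.of_forall fun d => ?_)
      simp only [defectArg, hη, hγ]
      congr 1
      rw [← has a b d]
      simp only [r]
      group
    · change c (1⁻¹ * r (Γ.mul 1 a y) y * (r a y)⁻¹) = 0
      rw [h1m a, inv_one, _root_.one_mul, mul_inv_cancel, hc.map_one]
  intro b
  have h2 : r b (Γ.tgt a y) = b * c.symm (η b) := by
    simp only [r, ← hsol]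
  rw [h2, hη, inv_mul_cancel_right]

end LocalGroupoid

end
-- Smooth charts adapted to the source map
noncomputable section

namespace OpenPartialHomeomorph

variable {E₁ : Type*} [NormedAddCommGroup E₁] [NormedSpace ℝ E₁] {H₁ : Type*} [TopologicalSpace H₁]
  {I₁ : ModelWithCorners ℝ E₁ H₁} {N₁ : Type*} [TopologicalSpace N₁] [ChartedSpace H₁ N₁]
  {E₂ : Type*} [NormedAddCommGroup E₂] [NormedSpace ℝ E₂] {H₂ : Type*} [TopologicalSpace H₂]
  {I₂ : ModelWithCorners ℝ E₂ H₂} {N₂ : Type*} [TopologicalSpace N₂] [ChartedSpace H₂ N₂]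
  {E₃ : Type*} [NormedAddCommGroup E₃] [NormedSpace ℝ E₃] {H₃ : Type*} [TopologicalSpace H₃]
  {I₃ : ModelWithCorners ℝ E₃ H₃} {N₃ : Type*} [TopologicalSpace N₃] [ChartedSpace H₃ N₃]

/-- An open partial homeomorphism which is smooth in both directions. -/
structure IsDiffeo (I₁ : ModelWithCorners ℝ E₁ H₁) (I₂ : ModelWithCorners ℝ E₂ H₂)
    (c : OpenPartialHomeomorph N₁ N₂) : Prop where
  smooth : ContMDiffOn I₁ I₂ ∞ c c.source
  smooth_symm : ContMDiffOn I₂ I₁ ∞ c.symm c.target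

theorem IsDiffeo.contMDiffAt {c : OpenPartialHomeomorph N₁ N₂} (h : c.IsDiffeo I₁ I₂) {p : N₁}
    (hp : p ∈ c.source) : ContMDiffAt I₁ I₂ ∞ c p :=
  h.smooth.contMDiffAt (c.open_source.mem_nhds hp)

theorem IsDiffeo.contMDiffAt_symm {c : OpenPartialHomeomorph N₁ N₂} (h : c.IsDiffeo I₁ I₂) {p : N₂}
    (hp : p ∈ c.target) : ContMDiffAt I₂ I₁ ∞ c.symm p :=
  h.smooth_symm.contMDiffAt (c.open_target.mem_nhds hp)

theorem IsDiffeo.symm {c : OpenPartialHomeomorph N₁ N₂} (h : c.IsDiffeo I₁ I₂) :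
    c.symm.IsDiffeo I₂ I₁ := ⟨h.smooth_symm, h.smooth⟩

theorem IsDiffeo.trans {c : OpenPartialHomeomorph N₁ N₂} {c' : OpenPartialHomeomorph N₂ N₃}
    (h : c.IsDiffeo I₁ I₂) (h' : c'.IsDiffeo I₂ I₃) : (c.trans c').IsDiffeo I₁ I₃ := by
  constructor
  · rw [trans_source]
    exact h'.smooth.comp (h.smooth.mono inter_subset_left) fun p hp => hp.2
  · rw [trans_target]
    exact h.smooth_symm.comp (h'.smooth_symm.mono inter_subset_left) fun p hp => hp.2

theorem isDiffeo_of_mem_maximalAtlas [IsManifold I₁ ∞ N₁] {c : OpenPartialHomeomorph N₁ H₁}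
    (hc : c ∈ IsManifold.maximalAtlas I₁ ∞ N₁) : c.IsDiffeo I₁ I₁ :=
  ⟨contMDiffOn_of_mem_maximalAtlas hc, contMDiffOn_symm_of_mem_maximalAtlas hc⟩

theorem IsDiffeo.prod_refl {E D : Type*} [NormedAddCommGroup E] [NormedSpace ℝ E]
    [NormedAddCommGroup D] [NormedSpace ℝ D] {c : OpenPartialHomeomorph E E}
    (h : c.IsDiffeo 𝓘(ℝ, E) 𝓘(ℝ, E)) :
    (c.prod (OpenPartialHomeomorph.refl D)).IsDiffeo 𝓘(ℝ, E × D) 𝓘(ℝ, E × D) := by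
  constructor
  · refine ContMDiffOn.prodMk_space (h.smooth.comp contMDiff_fst'.contMDiffOn ?_) ?_
    · exact fun p hp => hp.1
    · exact contDiff_snd.contMDiff.contMDiffOn
  · refine ContMDiffOn.prodMk_space (h.smooth_symm.comp contMDiff_fst'.contMDiffOn ?_) ?_
    · exact fun p hp => hp.1
    · exact contDiff_snd.contMDiff.contMDiffOn
where
  contMDiff_fst' {E D : Type _} [NormedAddCommGroup E] [NormedSpace ℝ E]
    [NormedAddCommGroup D] [NormedSpace ℝ D] :
    ContMDiff 𝓘(ℝ, E × D) 𝓘(ℝ, E) ∞ (Prod.fst : E × D → E) := contDiff_fst.contMDiff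

theorem isDiffeo_toOpenPartialHomeomorph {V W : Type*} [NormedAddCommGroup V] [NormedSpace ℝ V]
    [NormedAddCommGroup W] [NormedSpace ℝ W] (e : V ≃ₜ W) (h : ContDiff ℝ ∞ e)
    (h' : ContDiff ℝ ∞ e.symm) : e.toOpenPartialHomeomorph.IsDiffeo 𝓘(ℝ, V) 𝓘(ℝ, W) :=
  ⟨h.contMDiff.contMDiffOn, h'.contMDiff.contMDiffOn⟩

end OpenPartialHomeomorph

section centeredChart

variable (E : Type*) [NormedAddCommGroup E] {M : Type*} [TopologicalSpace M] [ChartedSpace E M]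

/-- The preferred chart at `x`, translated so that it maps `x` to the origin. -/
def centeredChart (x : M) : OpenPartialHomeomorph M E :=
  (chartAt E x).trans (Homeomorph.addRight (-(chartAt E x x))).toOpenPartialHomeomorph

theorem centeredChart_source (x : M) : (centeredChart E x).source = (chartAt E x).source := by
  simp [centeredChart]

theorem mem_centeredChart_source (x : M) : x ∈ (centeredChart E x).source := by
  rw [centeredChart_source]; exact mem_chart_source E x

theorem centeredChart_apply (x y : M) : centeredChart E x y = chartAt E x y - chartAt E x x := by
  simp [centeredChart, sub_eq_add_neg]

@[simp] theorem centeredChart_self (x : M) : centeredChart E x x = 0 := by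
  simp [centeredChart_apply]

theorem zero_mem_centeredChart_target (x : M) : (0 : E) ∈ (centeredChart E x).target := by
  rw [← centeredChart_self E x]
  exact (centeredChart E x).map_source (mem_centeredChart_source E x)

@[simp] theorem centeredChart_symm_zero (x : M) : (centeredChart E x).symm 0 = x := by
  rw [← centeredChart_self E x]
  exact (centeredChart E x).left_inv (mem_centeredChart_source E x)

theorem isDiffeo_centeredChart [NormedSpace ℝ E] [IsManifold 𝓘(ℝ, E) ∞ M] (x : M) :
    (centeredChart E x).IsDiffeo 𝓘(ℝ, E) 𝓘(ℝ, E) := by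
  refine (OpenPartialHomeomorph.isDiffeo_of_mem_maximalAtlas
    (IsManifold.chart_mem_maximalAtlas x)).trans
    (OpenPartialHomeomorph.isDiffeo_toOpenPartialHomeomorph _ ?_ ?_)
  · exact contDiff_id.add contDiff_const
  · exact contDiff_id.add contDiff_const

end centeredChart

namespace LieGroupoid

variable {E : Type*} [NormedAddCommGroup E] [NormedSpace ℝ E]
  {F : Type*} [NormedAddCommGroup F] [NormedSpace ℝ F]
  {M : Type*} [TopologicalSpace M] [ChartedSpace E M]
  {G : Type*} [TopologicalSpace G] [ChartedSpace F G]

/-- The model space of the fibres of the source map. -/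
abbrev FibreModel (E F : Type*) [NormedAddCommGroup E] [NormedSpace ℝ E]
    [NormedAddCommGroup F] [NormedSpace ℝ F] : Type :=
  EuclideanSpace ℝ (Fin (Module.finrank ℝ F - Module.finrank ℝ E))

/-- A chart of arrows whose first component is the source, in the chart of `M` centered at `x`. -/
structure IsAdapted (𝒢 : LieGroupoid E F M G) (x : M)
    (Θ : OpenPartialHomeomorph G (E × FibreModel E F)) : Prop where
  isDiffeo : Θ.IsDiffeo 𝓘(ℝ, F) 𝓘(ℝ, E × FibreModel E F)
  s_mem : ∀ h ∈ Θ.source, 𝒢.s h ∈ (centeredChart E x).source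
  fst_apply : ∀ h ∈ Θ.source, (Θ h).1 = centeredChart E x (𝒢.s h)

theorem exists_isAdapted [FiniteDimensional ℝ E] [FiniteDimensional ℝ F]
    [IsManifold 𝓘(ℝ, E) ∞ M] [IsManifold 𝓘(ℝ, F) ∞ G]
    (𝒢 : LieGroupoid E F M G) {x : M} {g : G} (hg : 𝒢.s g = x) :
    ∃ Θ, 𝒢.IsAdapted x Θ ∧ g ∈ Θ.source := by
  have h := 𝒢.submersion_s.isSubmersionAt g
  have hfd : FiniteDimensional ℝ h.complement :=
    Module.Finite.of_surjective
      ((LinearMap.snd ℝ E h.complement).comp (h.equiv.toLinearEquiv : F →ₗ[ℝ] E × h.complement))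
      (Prod.snd_surjective.comp h.equiv.surjective)
  have hrank : Module.finrank ℝ h.complement
      = Module.finrank ℝ (FibreModel E F) := by
    have h1 := h.equiv.toLinearEquiv.finrank_eq
    rw [Module.finrank_prod] at h1
    rw [finrank_euclideanSpace, Fintype.card_fin]
    omega
  -- The complement supplied by the submersion may vary with the arrow. Identifying it with a
  -- Euclidean space of the same dimension provides one model for all charts of the fibre.
  let L : h.complement ≃L[ℝ] FibreModel E F := ContinuousLinearEquiv.ofFinrankEq hrank
  let e : F ≃L[ℝ] E × FibreModel E F :=
    h.equiv.trans ((ContinuousLinearEquiv.refl ℝ E).prodCongr L)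
  let Θ := (h.domChart.trans e.toHomeomorph.toOpenPartialHomeomorph).trans
    ((h.codChart.symm.trans (centeredChart E x)).prod (OpenPartialHomeomorph.refl (FibreModel E F)))
  have hfst : ∀ k ∈ h.domChart.source, (e (h.domChart k)).1 = h.codChart (𝒢.s k) := by
    intro k hk
    have hz' : h.domChart k ∈ (h.domChart.extend 𝓘(ℝ, F)).target := by
      simpa using h.domChart.map_source hk
    have := h.writtenInCharts hz'
    simp [h.domChart.left_inv hk] at this
    rw [this]
    rfl
  have hsrc : ∀ k, k ∈ Θ.source ↔ k ∈ h.domChart.source ∧ 𝒢.s k ∈ (centeredChart E x).source := by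
    intro k
    constructor
    · rintro ⟨⟨h1, -⟩, ⟨h2, h3⟩, -⟩
      refine ⟨h1, ?_⟩
      change h.codChart.symm (e (h.domChart k)).1 ∈ (centeredChart E x).source at h3
      rw [hfst k h1, h.codChart.left_inv (h.source_subset_preimage_source h1)] at h3
      exact h3
    · rintro ⟨h1, h2⟩
      refine ⟨⟨h1, mem_univ _⟩, ⟨?_, ?_⟩, mem_univ _⟩
      · change (e (h.domChart k)).1 ∈ h.codChart.target
        rw [hfst k h1]
        exact h.codChart.map_source (h.source_subset_preimage_source h1)
      · change h.codChart.symm (e (h.domChart k)).1 ∈ (centeredChart E x).source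
        rw [hfst k h1, h.codChart.left_inv (h.source_subset_preimage_source h1)]
        exact h2
  refine ⟨Θ, ⟨?_, fun k hk => ((hsrc k).1 hk).2, fun k hk => ?_⟩, (hsrc g).2
    ⟨h.mem_domChart_source, by rw [hg]; exact mem_centeredChart_source E x⟩⟩
  · refine ((OpenPartialHomeomorph.isDiffeo_of_mem_maximalAtlas h.domChart_mem_maximalAtlas).trans
      (OpenPartialHomeomorph.isDiffeo_toOpenPartialHomeomorph _ e.contDiff e.symm.contDiff)).trans
      (OpenPartialHomeomorph.IsDiffeo.prod_refl ?_)
    exact (OpenPartialHomeomorph.isDiffeo_of_mem_maximalAtlas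
      h.codChart_mem_maximalAtlas).symm.trans (isDiffeo_centeredChart E x)
  · have h1 := ((hsrc k).1 hk).1
    change centeredChart E x (h.codChart.symm (e (h.domChart k)).1) = _
    rw [hfst k h1, h.codChart.left_inv (h.source_subset_preimage_source h1)]

end LieGroupoid

end
-- The fibre over the fixed point as a Lie group, and properness
noncomputable section

namespace LieGroupoid

variable {E : Type*} [NormedAddCommGroup E] [NormedSpace ℝ E]
  {F : Type*} [NormedAddCommGroup F] [NormedSpace ℝ F]
  {M : Type*} [TopologicalSpace M] [ChartedSpace E M]
  {G : Type*} [TopologicalSpace G] [ChartedSpace F G]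

/-- The fibre of the source map over `x`, which is the isotropy group if `x` is a fixed point. -/
@[ext] structure SourceFibre (𝒢 : LieGroupoid E F M G) (x : M) where
  /-- the underlying arrow -/
  arrow : G
  s_arrow : 𝒢.s arrow = x

namespace SourceFibre

variable {𝒢 : LieGroupoid E F M G} {x : M}

attribute [simp] s_arrow

instance : TopologicalSpace (𝒢.SourceFibre x) := TopologicalSpace.induced arrow inferInstance

theorem isInducing_arrow : IsInducing (arrow : 𝒢.SourceFibre x → G) := ⟨rfl⟩

theorem continuous_arrow : Continuous (arrow : 𝒢.SourceFibre x → G) := isInducing_arrow.continuous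

theorem injective_arrow : Function.Injective (arrow : 𝒢.SourceFibre x → G) :=
  fun _ _ h => SourceFibre.ext h

instance [T2Space G] : T2Space (𝒢.SourceFibre x) :=
  T2Space.of_injective_continuous injective_arrow continuous_arrow

instance [SecondCountableTopology G] : SecondCountableTopology (𝒢.SourceFibre x) :=
  isInducing_arrow.secondCountableTopology

/-- The chart of a fibre of the source map which is induced by an adapted chart. -/
def chart {Θ : OpenPartialHomeomorph G (E × FibreModel E F)} (h : 𝒢.IsAdapted x Θ) :
    OpenPartialHomeomorph (𝒢.SourceFibre x) (FibreModel E F) where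
  toFun k := (Θ k.arrow).2
  invFun d := open Classical in
    if hd : ((0, d) : E × FibreModel E F) ∈ Θ.target then
      ⟨Θ.symm (0, d), by
        have h1 := h.fst_apply _ (Θ.map_target hd)
        rw [Θ.right_inv hd] at h1
        have h2 := (centeredChart E x).left_inv (h.s_mem _ (Θ.map_target hd))
        rw [← h1, centeredChart_symm_zero] at h2
        exact h2.symm⟩
    else ⟨𝒢.u x, 𝒢.s_u x⟩
  source := {k | k.arrow ∈ Θ.source}
  target := {d | ((0, d) : E × FibreModel E F) ∈ Θ.target}
  map_source' k hk := by
    change (0, (Θ k.arrow).2) ∈ Θ.target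
    have : Θ k.arrow = (0, (Θ k.arrow).2) := Prod.ext (by
      rw [h.fst_apply _ hk, k.s_arrow, centeredChart_self]) rfl
    rw [← this]
    exact Θ.map_source hk
  map_target' d hd := by
    rw [dif_pos (by exact hd)]
    exact Θ.map_target hd
  left_inv' k hk := by
    have : Θ k.arrow = (0, (Θ k.arrow).2) := Prod.ext (by
      rw [h.fst_apply _ hk, k.s_arrow, centeredChart_self]) rfl
    rw [dif_pos (by rw [← this]; exact Θ.map_source hk)]
    apply SourceFibre.ext
    change Θ.symm ((0, (Θ k.arrow).2) : E × FibreModel E F) = _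
    rw [← this, Θ.left_inv hk]
  right_inv' d hd := by
    rw [dif_pos (by exact hd)]
    change (Θ (Θ.symm (0, d))).2 = d
    rw [Θ.right_inv hd]
  open_source := Θ.open_source.preimage continuous_arrow
  open_target := Θ.open_target.preimage (by fun_prop)
  continuousOn_toFun := continuous_snd.comp_continuousOn
    (Θ.continuousOn.comp continuous_arrow.continuousOn fun _ hk => hk)
  continuousOn_invFun := by
    rw [isInducing_arrow.continuousOn_iff]
    have h1 : ContinuousOn (fun d : FibreModel E F => Θ.symm (0, d))
        {d | ((0, d) : E × FibreModel E F) ∈ Θ.target} :=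
      Θ.continuousOn_symm.comp (by fun_prop) fun _ hd => hd
    refine h1.congr fun d hd => ?_
    simp only [Function.comp_apply]
    rw [dif_pos (by exact hd)]

section chart

variable {Θ : OpenPartialHomeomorph G (E × FibreModel E F)} (h : 𝒢.IsAdapted x Θ)

theorem arrow_chart_symm {d : FibreModel E F} (hd : ((0, d) : E × FibreModel E F) ∈ Θ.target) :
    ((chart h).symm d).arrow = Θ.symm (0, d) := by
  change arrow (@dite _ _ (Classical.propDecidable _) _ _) = _
  rw [dif_pos hd]

theorem apply_arrow {k : 𝒢.SourceFibre x} (hk : k.arrow ∈ Θ.source) :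
    Θ k.arrow = (0, chart h k) :=
  Prod.ext (by rw [h.fst_apply _ hk, k.s_arrow, centeredChart_self]) rfl

end chart

variable [FiniteDimensional ℝ E] [FiniteDimensional ℝ F]
  [IsManifold 𝓘(ℝ, E) ∞ M] [IsManifold 𝓘(ℝ, F) ∞ G]

instance : ChartedSpace (FibreModel E F) (𝒢.SourceFibre x) where
  atlas := {c | ∃ (Θ : OpenPartialHomeomorph G (E × FibreModel E F)) (h : 𝒢.IsAdapted x Θ),
    c = chart h}
  chartAt a := chart (𝒢.exists_isAdapted a.s_arrow).choose_spec.1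
  mem_chart_source a := (𝒢.exists_isAdapted a.s_arrow).choose_spec.2
  chart_mem_atlas _ := ⟨_, _, rfl⟩

theorem chart_mem_atlas {Θ : OpenPartialHomeomorph G (E × FibreModel E F)}
    (h : 𝒢.IsAdapted x Θ) : chart h ∈ atlas (FibreModel E F) (𝒢.SourceFibre x) := ⟨_, _, rfl⟩

instance : IsManifold 𝓘(ℝ, FibreModel E F) ∞ (𝒢.SourceFibre x) := by
  refine isManifold_of_contDiffOn _ _ _ ?_
  rintro _ _ ⟨Θ, h, rfl⟩ ⟨Θ', h', rfl⟩
  have h1 : ContMDiffOn 𝓘(ℝ, FibreModel E F) 𝓘(ℝ, FibreModel E F) ∞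
      (fun d => (Θ' (Θ.symm ((0, d) : E × FibreModel E F))).2)
      {d | ((0, d) : E × FibreModel E F) ∈ Θ.target ∧
        Θ.symm ((0, d) : E × FibreModel E F) ∈ Θ'.source} := by
    refine contDiff_snd.contMDiff.comp_contMDiffOn
      (ContMDiffOn.comp h'.isDiffeo.smooth (ContMDiffOn.comp h.isDiffeo.smooth_symm
        (ContDiff.contMDiff (contDiff_const.prodMk contDiff_id)).contMDiffOn ?_) ?_)
    · exact fun d hd => hd.1
    · exact fun d hd => hd.2
  have h2 : ∀ d ∈ ((chart h).symm.trans (chart h')).source,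
      ((0, d) : E × FibreModel E F) ∈ Θ.target ∧
        Θ.symm ((0, d) : E × FibreModel E F) ∈ Θ'.source := by
    rintro d ⟨hd, hd'⟩
    refine ⟨hd, ?_⟩
    rw [← arrow_chart_symm h hd]
    exact hd'
  refine (h1.contDiffOn.mono (fun d hd => h2 d ?_)).congr fun d hd => ?_
  · simpa using hd
  · change (Θ' ((chart h).symm d).arrow).2 = _
    rw [arrow_chart_symm h (h2 d (by simpa using hd)).1]

theorem isDiffeo_chart {Θ : OpenPartialHomeomorph G (E × FibreModel E F)} (h : 𝒢.IsAdapted x Θ) :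
    (chart h).IsDiffeo 𝓘(ℝ, FibreModel E F) 𝓘(ℝ, FibreModel E F) :=
  OpenPartialHomeomorph.isDiffeo_of_mem_maximalAtlas
    (IsManifold.subset_maximalAtlas (chart_mem_atlas h))

theorem contMDiff_arrow : ContMDiff 𝓘(ℝ, FibreModel E F) 𝓘(ℝ, F) ∞
    (arrow : 𝒢.SourceFibre x → G) := by
  intro a
  obtain ⟨Θ, h, ha⟩ := 𝒢.exists_isAdapted a.s_arrow
  have h1 : ContMDiffAt 𝓘(ℝ, FibreModel E F) 𝓘(ℝ, F) ∞
      (fun k : 𝒢.SourceFibre x => Θ.symm (0, chart h k)) a := by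
    refine ContMDiffAt.comp a (h.isDiffeo.contMDiffAt_symm ?_)
      (contMDiffAt_const.prodMk_space ((isDiffeo_chart h).contMDiffAt ha))
    rw [← apply_arrow h ha]
    exact Θ.map_source ha
  refine h1.congr_of_eventuallyEq ?_
  filter_upwards [(chart h).open_source.mem_nhds ha] with k hk
  rw [← apply_arrow h hk, Θ.left_inv hk]

variable {D' : Type*} [NormedAddCommGroup D'] [NormedSpace ℝ D'] {H' : Type*} [TopologicalSpace H']
  {I' : ModelWithCorners ℝ D' H'} {N : Type*} [TopologicalSpace N] [ChartedSpace H' N]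

/-- The fibre is embedded in `G`: in an adapted chart it is the slice over `0`, so smoothness into
it can be tested in `G`. -/
theorem contMDiffAt_of_arrow {f : N → 𝒢.SourceFibre x} {p : N}
    (hf : ContMDiffAt I' 𝓘(ℝ, F) ∞ (fun q => (f q).arrow) p) :
    ContMDiffAt I' 𝓘(ℝ, FibreModel E F) ∞ f p := by
  obtain ⟨Θ, h, ha⟩ := 𝒢.exists_isAdapted (f p).s_arrow
  have hc : ContinuousAt f p := isInducing_arrow.continuousAt_iff.2 hf.continuousAt
  have h1 : ContMDiffAt I' 𝓘(ℝ, FibreModel E F) ∞ (fun q => (Θ (f q).arrow).2) p :=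
    contDiff_snd.contMDiff.contMDiffAt.comp p (ContMDiffAt.comp p (h.isDiffeo.contMDiffAt ha) hf)
  have h2 : ContMDiffAt I' 𝓘(ℝ, FibreModel E F) ∞ (fun q => (chart h).symm (chart h (f q))) p :=
    ContMDiffAt.comp p (g := (chart h).symm) (f := fun q => chart h (f q))
      ((isDiffeo_chart h).contMDiffAt_symm ((chart h).map_source ha)) h1
  refine h2.congr_of_eventuallyEq ?_
  filter_upwards [hc ((chart h).open_source.mem_nhds ha)] with q hq
  exact ((chart h).left_inv hq).symm

theorem contMDiff_of_arrow {f : N → 𝒢.SourceFibre x}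
    (hf : ContMDiff I' 𝓘(ℝ, F) ∞ (fun q => (f q).arrow)) :
    ContMDiff I' 𝓘(ℝ, FibreModel E F) ∞ f := fun p => contMDiffAt_of_arrow (hf p)

end SourceFibre

theorem continuous_s (𝒢 : LieGroupoid E F M G) : Continuous 𝒢.s :=
  𝒢.submersion_s.contMDiff.continuous

theorem continuous_t (𝒢 : LieGroupoid E F M G) : Continuous 𝒢.t := 𝒢.smooth_t.continuous

/-- The multiplication is smooth only on the set of composable pairs; composability throughout a
neighbourhood of `p` removes this restriction. -/
theorem contMDiffAt_mul {D' : Type*} [NormedAddCommGroup D'] [NormedSpace ℝ D'] {H' : Type*}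
    [TopologicalSpace H'] {I' : ModelWithCorners ℝ D' H'} {N : Type*} [TopologicalSpace N]
    [ChartedSpace H' N] (𝒢 : LieGroupoid E F M G) {f g : N → G} {p : N}
    (hf : ContMDiffAt I' 𝓘(ℝ, F) ∞ f p) (hg : ContMDiffAt I' 𝓘(ℝ, F) ∞ g p)
    (hfg : ∀ᶠ q in 𝓝 p, 𝒢.s (f q) = 𝒢.t (g q)) :
    ContMDiffAt I' 𝓘(ℝ, F) ∞ (fun q => 𝒢.mul (f q) (g q)) p := by
  have h1 : ContMDiffWithinAt I' 𝓘(ℝ, F) ∞ (fun q => 𝒢.mul (f q) (g q))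
      {q | 𝒢.s (f q) = 𝒢.t (g q)} p :=
    (𝒢.smooth_mul (f p, g p) hfg.self_of_nhds).comp p (hf.prodMk hg).contMDiffWithinAt
      fun q hq => hq
  exact h1.contMDiffAt hfg

theorem IsFixedPoint.t_eq {𝒢 : LieGroupoid E F M G} {x : M} (hfix : 𝒢.IsFixedPoint x) {g : G}
    (hg : 𝒢.s g = x) : 𝒢.t g = x := by
  have h : 𝒢.t g ∈ 𝒢.orbit x := ⟨g, hg, rfl⟩
  rw [hfix] at h
  exact h

theorem mul_mul_inv_cancel (𝒢 : LieGroupoid E F M G) {g h : G} (hgh : 𝒢.s g = 𝒢.t h) :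
    𝒢.mul (𝒢.mul g h) (𝒢.inv h) = g := by
  rw [𝒢.mul_assoc g h _ hgh (𝒢.t_inv h).symm, 𝒢.mul_inv, ← hgh, 𝒢.mul_u]

theorem mul_inv_mul_cancel (𝒢 : LieGroupoid E F M G) {g h : G} (hgh : 𝒢.s g = 𝒢.s h) :
    𝒢.mul (𝒢.mul g (𝒢.inv h)) h = g := by
  rw [𝒢.mul_assoc g _ h (hgh.trans (𝒢.t_inv h).symm) (𝒢.s_inv h), 𝒢.inv_mul, ← hgh, 𝒢.mul_u]

namespace SourceFibre

variable {𝒢 : LieGroupoid E F M G} {x : M} [hfix : Fact (𝒢.IsFixedPoint x)]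

@[simp] theorem t_arrow (a : 𝒢.SourceFibre x) : 𝒢.t a.arrow = x := hfix.out.t_eq a.s_arrow

instance : Group (𝒢.SourceFibre x) where
  mul a b := ⟨𝒢.mul a.arrow b.arrow, by rw [𝒢.s_mul _ _ (by simp), s_arrow]⟩
  one := ⟨𝒢.u x, 𝒢.s_u x⟩
  inv a := ⟨𝒢.inv a.arrow, by rw [𝒢.s_inv, t_arrow]⟩
  mul_assoc a b c := SourceFibre.ext (𝒢.mul_assoc a.arrow b.arrow c.arrow (by simp) (by simp))
  one_mul a := SourceFibre.ext (by
    have := 𝒢.u_mul a.arrow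
    rw [t_arrow] at this
    exact this)
  mul_one a := SourceFibre.ext (by
    have := 𝒢.mul_u a.arrow
    rw [s_arrow] at this
    exact this)
  inv_mul_cancel a := SourceFibre.ext (by
    have := 𝒢.inv_mul a.arrow
    rw [s_arrow] at this
    exact this)

theorem arrow_mem_isotropy (k : 𝒢.SourceFibre x) :
    k.arrow ∈ 𝒢.isotropy x := ⟨k.s_arrow, k.t_arrow⟩

theorem arrow_mul (a b : 𝒢.SourceFibre x) : (a * b).arrow = 𝒢.mul a.arrow b.arrow := rfl

theorem arrow_one : (1 : 𝒢.SourceFibre x).arrow = 𝒢.u x := rfl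

theorem arrow_inv (a : 𝒢.SourceFibre x) : (a⁻¹).arrow = 𝒢.inv a.arrow := rfl

instance [FiniteDimensional ℝ E] [FiniteDimensional ℝ F]
    [IsManifold 𝓘(ℝ, E) ∞ M] [IsManifold 𝓘(ℝ, F) ∞ G] :
    LieGroup 𝓘(ℝ, FibreModel E F) ∞ (𝒢.SourceFibre x) where
  contMDiff_mul := by
    refine contMDiff_of_arrow ?_
    refine 𝒢.smooth_mul.comp_contMDiff (f := fun p : 𝒢.SourceFibre x × 𝒢.SourceFibre x =>
      (p.1.arrow, p.2.arrow)) ?_ (fun p => ?_)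
    · exact (contMDiff_arrow.comp contMDiff_fst).prodMk (contMDiff_arrow.comp contMDiff_snd)
    · simp
  contMDiff_inv := contMDiff_of_arrow (𝒢.smooth_inv.comp contMDiff_arrow)

end SourceFibre

/-- An open set of arrows which contains the fibre over a fixed point at which `𝒢` is proper
contains all arrows between points near the fixed point. -/
theorem IsProperAt.exists_restrict_subset [T2Space M] [FirstCountableTopology M]
    {𝒢 : LieGroupoid E F M G} {x : M} (hp : 𝒢.IsProperAt x) {O : Set G} (hO : IsOpen O)
    (hxO : ∀ g, 𝒢.s g = x → g ∈ O) :
    ∀ᶠ q in (𝓝 x) ×ˢ (𝓝 x), ∀ g, 𝒢.s g = q.1 → 𝒢.t g = q.2 → g ∈ O := by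
  by_contra hcon
  -- Otherwise there are arrows outside `O` whose sources and targets tend to `x`. A subsequence
  -- converges to an arrow with source `x`, which lies in the open set `O`, a contradiction.
  obtain ⟨q, hq, hqO⟩ := exists_seq_forall_of_frequently (not_eventually.1 hcon)
  push Not at hqO
  choose γ hs ht hγ using hqO
  rw [tendsto_prod_iff'] at hq
  obtain ⟨k, g, hk, hg⟩ := hp γ (by simpa only [hs] using hq.1) (by simpa only [ht] using hq.2)
  have hsc : Continuous 𝒢.s := 𝒢.submersion_s.contMDiff.continuous
  have h1 : 𝒢.s g = x := tendsto_nhds_unique ((hsc.tendsto g).comp hg) (by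
    simpa only [Function.comp_def, hs] using hq.1.comp hk.tendsto_atTop)
  have h2 := hg.eventually (hO.mem_nhds (hxO g h1))
  obtain ⟨n, hn⟩ := h2.exists
  exact hγ _ hn

/-- Arrows in the fibre have constant source and target `x`, so properness gives sequential
compactness, which is compactness by second countability. -/
theorem IsProperAt.compactSpace [T2Space M] [T2Space G] [SecondCountableTopology G]
    [FiniteDimensional ℝ E] [FiniteDimensional ℝ F]
    [IsManifold 𝓘(ℝ, E) ∞ M] [IsManifold 𝓘(ℝ, F) ∞ G] {𝒢 : LieGroupoid E F M G} {x : M} (hp : 𝒢.IsProperAt x) (hfix : 𝒢.IsFixedPoint x) :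
    CompactSpace (𝒢.SourceFibre x) := by
  have hseq : SeqCompactSpace (𝒢.SourceFibre x) := by
    refine ⟨fun γ _ => ?_⟩
    obtain ⟨k, g, hk, hg⟩ := hp (fun n => (γ n).arrow)
      (by simp only [SourceFibre.s_arrow]; exact tendsto_const_nhds)
      (by simp only [fun n => hfix.t_eq (γ n).s_arrow]; exact tendsto_const_nhds)
    have hsc : Continuous 𝒢.s := 𝒢.submersion_s.contMDiff.continuous
    have h1 : 𝒢.s g = x := tendsto_nhds_unique ((hsc.tendsto g).comp hg) (by
      simpa only [Function.comp_def, SourceFibre.s_arrow] using tendsto_const_nhds)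
    exact ⟨⟨g, h1⟩, mem_univ _, k, hk, SourceFibre.isInducing_arrow.tendsto_nhds_iff.2 hg⟩
  have := Manifold.locallyCompact_of_finiteDimensional 𝓘(ℝ, FibreModel E F) (M := 𝒢.SourceFibre x)
  exact compactSpace_iff_seqCompactSpace.2 hseq

end LieGroupoid

end
-- Smooth retractions onto the isotropy group
noncomputable section

namespace LieGroupoid

variable {E : Type*} [NormedAddCommGroup E] [NormedSpace ℝ E] [FiniteDimensional ℝ E]
  {F : Type*} [NormedAddCommGroup F] [NormedSpace ℝ F] [FiniteDimensional ℝ F]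
  {M : Type*} [TopologicalSpace M] [ChartedSpace E M] [IsManifold 𝓘(ℝ, E) ∞ M]
  {G : Type*} [TopologicalSpace G] [ChartedSpace F G] [IsManifold 𝓘(ℝ, F) ∞ G]
  {𝒢 : LieGroupoid E F M G} {x : M}

/-- `f` is smooth in a neighbourhood of the arrow `g`. -/
def SmoothAround (f : G → 𝒢.SourceFibre x) (g : G) : Prop :=
  ∀ᶠ h in 𝓝 g, ContMDiffAt 𝓘(ℝ, F) 𝓘(ℝ, FibreModel E F) ∞ f h

/-- `f` is a left inverse of the inclusion of the fibre over `x` which is smooth around the fibre. -/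
structure IsRetraction (f : G → 𝒢.SourceFibre x) : Prop where
  apply_arrow : ∀ k : 𝒢.SourceFibre x, f k.arrow = k
  smooth : ∀ k : 𝒢.SourceFibre x, SmoothAround f k.arrow

/-- In an adapted chart, the projection to the fibre coordinate is a retraction near `k₀`. -/
theorem exists_local_retraction (k₀ : 𝒢.SourceFibre x) :
    ∃ f : G → 𝒢.SourceFibre x, (∀ k : 𝒢.SourceFibre x, f k.arrow = k) ∧
      SmoothAround f k₀.arrow := by
  classical
  obtain ⟨Θ, h, hk₀⟩ := 𝒢.exists_isAdapted k₀.s_arrow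
  have hk : k₀ ∈ (SourceFibre.chart h).source := hk₀
  have h1 : ∀ᶠ g in 𝓝 k₀.arrow, g ∈ Θ.source ∧ (Θ g).2 ∈ (SourceFibre.chart h).target := by
    refine Eventually.and (Θ.open_source.mem_nhds hk₀) ?_
    have h2 : ContinuousAt (fun g => (Θ g).2) k₀.arrow :=
      continuous_snd.continuousAt.comp (Θ.continuousAt hk₀)
    exact h2.eventually_mem ((SourceFibre.chart h).open_target.mem_nhds
      ((SourceFibre.chart h).map_source hk))
  -- The case distinction makes the map the identity on the whole fibre, even outside the chart;
  -- inside the chart the two branches agree on the fibre.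
  refine ⟨fun g => if hg : 𝒢.s g = x then ⟨g, hg⟩ else (SourceFibre.chart h).symm (Θ g).2,
    fun k => ?_, ?_⟩
  · simp only [SourceFibre.s_arrow, dite_true]
  · filter_upwards [h1.eventually_nhds] with g hg
    have h2 : ContMDiffAt 𝓘(ℝ, F) 𝓘(ℝ, FibreModel E F) ∞
        (fun g => (SourceFibre.chart h).symm (Θ g).2) g := by
      refine ContMDiffAt.comp g ((SourceFibre.isDiffeo_chart h).contMDiffAt_symm
        hg.self_of_nhds.2) ?_
      exact contDiff_snd.contMDiff.contMDiffAt.comp g (h.isDiffeo.contMDiffAt hg.self_of_nhds.1)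
    refine h2.congr_of_eventuallyEq ?_
    filter_upwards [hg] with g' hg'
    split_ifs with hx
    · exact ((SourceFibre.chart h).left_inv (x := (⟨g', hx⟩ : 𝒢.SourceFibre x)) hg'.1).symm
    · rfl

variable [Fact (𝒢.IsFixedPoint x)] [T2Space G] [SecondCountableTopology G]

/-- The group structure of the fibre replaces convex combinations: `f₁ e(χ c(f₁⁻¹ f₂))` interpolates
between the two retractions, since `f₁⁻¹ f₂` is close to `1` where both are continuous near the
fibre. The cutoff `χ` is `0` near the points of `C₁` where `f₂` is bad and `1` near the points of
`C₂` where `f₁` is bad. -/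
theorem exists_retraction_union {f₁ f₂ : G → 𝒢.SourceFibre x}
    (h₁ : ∀ k : 𝒢.SourceFibre x, f₁ k.arrow = k) (h₂ : ∀ k : 𝒢.SourceFibre x, f₂ k.arrow = k)
    {C₁ C₂ : Set (𝒢.SourceFibre x)} (hC₁ : IsCompact C₁) (hC₂ : IsCompact C₂)
    (hs₁ : ∀ k ∈ C₁, SmoothAround f₁ k.arrow) (hs₂ : ∀ k ∈ C₂, SmoothAround f₂ k.arrow) :
    ∃ f : G → 𝒢.SourceFibre x, (∀ k : 𝒢.SourceFibre x, f k.arrow = k) ∧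
      ∀ k ∈ C₁ ∪ C₂, SmoothAround f k.arrow := by
  classical
  obtain ⟨c, hc⟩ := exists_isUnitChart (FibreModel E F) (𝒢.SourceFibre x)
  have htg : IsTopologicalGroup (𝒢.SourceFibre x) :=
    topologicalGroup_of_lieGroup 𝓘(ℝ, FibreModel E F) ∞
  have hlc := Manifold.locallyCompact_of_finiteDimensional 𝓘(ℝ, F) (M := G)
  have hopen : ∀ f : G → 𝒢.SourceFibre x, IsOpen {g | SmoothAround f g} := fun f =>
    isOpen_setOfPred_eventually_nhds
  obtain ⟨χ, hχ0, hχ1, -⟩ := exists_contMDiffMap_zero_one_nhds_of_isClosed (n := (⊤ : ℕ∞)) 𝓘(ℝ, F)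
    (s := SourceFibre.arrow '' C₁ \ {g | SmoothAround f₂ g})
    (t := SourceFibre.arrow '' C₂ \ {g | SmoothAround f₁ g})
    ((hC₁.image SourceFibre.continuous_arrow).isClosed.sdiff (hopen f₂))
    ((hC₂.image SourceFibre.continuous_arrow).isClosed.sdiff (hopen f₁)) (by
      rw [disjoint_left]
      rintro _ ⟨⟨k, hk, rfl⟩, -⟩ ⟨-, h⟩
      exact h (hs₁ k hk))
  -- Where `χ = 1` the value is set to `f₂` directly, since the interpolation formula returns `f₂`
  -- only if `f₁⁻¹ f₂` is in the chart. Where `χ = 0` the formula gives `f₁` unconditionally.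
  let f : G → 𝒢.SourceFibre x := fun g =>
    if χ g = 1 then f₂ g else f₁ g * c.symm (χ g • c ((f₁ g)⁻¹ * f₂ g))
  have hoverlap : ∀ k : 𝒢.SourceFibre x, SmoothAround f₁ k.arrow → SmoothAround f₂ k.arrow →
      SmoothAround f k.arrow := by
    intro k hk₁ hk₂
    have hq : ContinuousAt (fun g => (f₁ g)⁻¹ * f₂ g) k.arrow :=
      (hk₁.self_of_nhds.continuousAt.inv).mul hk₂.self_of_nhds.continuousAt
    have hq1 : (f₁ k.arrow)⁻¹ * f₂ k.arrow = 1 := by rw [h₁, h₂, inv_mul_cancel]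
    have hqs : ∀ᶠ g in 𝓝 k.arrow, (f₁ g)⁻¹ * f₂ g ∈ c.source :=
      hq.eventually_mem (by rw [hq1]; exact c.open_source.mem_nhds hc.one_mem)
    have hqt : ∀ᶠ g in 𝓝 k.arrow, χ g • c ((f₁ g)⁻¹ * f₂ g) ∈ c.target := by
      have h1 : ContinuousAt (fun g => χ g • c ((f₁ g)⁻¹ * f₂ g)) k.arrow :=
        χ.contMDiff.continuous.continuousAt.smul (ContinuousAt.comp (g := c)
          (c.continuousAt (by rw [hq1]; exact hc.one_mem)) hq)
      refine h1.eventually_mem (c.open_target.mem_nhds ?_)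
      rw [hq1, hc.map_one, smul_zero]
      exact hc.zero_mem
    filter_upwards [hk₁, hk₂, hqs.eventually_nhds, hqt] with g hg₁ hg₂ hgs hgt
    have h1 : ContMDiffAt 𝓘(ℝ, F) 𝓘(ℝ, FibreModel E F) ∞
        (fun g => f₁ g * c.symm (χ g • c ((f₁ g)⁻¹ * f₂ g))) g := by
      refine hg₁.mul (ContMDiffAt.comp (g := c.symm) g (hc.smooth_symm _ hgt) ?_)
      exact χ.contMDiff.contMDiffAt.smul (ContMDiffAt.comp (g := c) g
        (hc.smooth _ hgs.self_of_nhds) (hg₁.inv.mul hg₂))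
    refine h1.congr_of_eventuallyEq ?_
    filter_upwards [hgs] with g' hg'
    simp only [f]
    split_ifs with h2
    · rw [h2, one_smul, c.left_inv hg', mul_inv_cancel_left]
    · rfl
  refine ⟨f, fun k => ?_, ?_⟩
  · simp only [f, h₁, h₂, inv_mul_cancel, hc.map_one, smul_zero, hc.symm_zero, _root_.mul_one,
      ite_self]
  · rintro k (hk | hk)
    · by_cases hk₂ : SmoothAround f₂ k.arrow
      · exact hoverlap k (hs₁ k hk) hk₂
      · have h0 : ∀ᶠ g in 𝓝 k.arrow, χ g = 0 :=
          hχ0.filter_mono (nhds_le_nhdsSet (mem_sdiff_of_mem (mem_image_of_mem _ hk) hk₂))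
        filter_upwards [hs₁ k hk, h0.eventually_nhds] with g hg hg0
        refine hg.congr_of_eventuallyEq ?_
        filter_upwards [hg0] with g' hg'
        simp only [f, hg', zero_smul, hc.symm_zero, _root_.mul_one, zero_ne_one, if_false]
    · by_cases hk₁ : SmoothAround f₁ k.arrow
      · exact hoverlap k hk₁ (hs₂ k hk)
      · have h0 : ∀ᶠ g in 𝓝 k.arrow, χ g = 1 :=
          hχ1.filter_mono (nhds_le_nhdsSet (mem_sdiff_of_mem (mem_image_of_mem _ hk) hk₁))
        filter_upwards [hs₂ k hk, h0.eventually_nhds] with g hg hg0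
        refine hg.congr_of_eventuallyEq ?_
        filter_upwards [hg0] with g' hg'
        simp only [f, hg', if_true]

variable [CompactSpace (𝒢.SourceFibre x)]

/-- Local retractions are glued by compact induction. Smoothness is demanded on closures so that the
pieces being glued are compact. -/
theorem exists_isRetraction (𝒢 : LieGroupoid E F M G) (x : M) [Fact (𝒢.IsFixedPoint x)]
    [CompactSpace (𝒢.SourceFibre x)] :
    ∃ f : G → 𝒢.SourceFibre x, IsRetraction f ∧ ∀ y, f (𝒢.u y) = 1 := by
  have h : ∃ f : G → 𝒢.SourceFibre x, (∀ k : 𝒢.SourceFibre x, f k.arrow = k) ∧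
      ∀ k ∈ closure (univ : Set (𝒢.SourceFibre x)), SmoothAround f k.arrow := by
    refine isCompact_univ.induction_on (p := fun S : Set (𝒢.SourceFibre x) =>
      ∃ f : G → 𝒢.SourceFibre x, (∀ k : 𝒢.SourceFibre x, f k.arrow = k) ∧
      ∀ k ∈ closure S, SmoothAround f k.arrow) ?_ ?_ ?_ ?_
    · obtain ⟨f, hf, -⟩ := exists_local_retraction (1 : 𝒢.SourceFibre x)
      exact ⟨f, hf, by simp⟩
    · rintro s t hst ⟨f, hf, hf'⟩
      exact ⟨f, hf, fun k hk => hf' k (closure_mono hst hk)⟩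
    · rintro s t ⟨f₁, h₁, hs₁⟩ ⟨f₂, h₂, hs₂⟩
      rw [closure_union]
      exact exists_retraction_union h₁ h₂ isClosed_closure.isCompact isClosed_closure.isCompact
        hs₁ hs₂
    · intro k _
      obtain ⟨f, hf, hf'⟩ := exists_local_retraction k
      have h1 : {k' : 𝒢.SourceFibre x | SmoothAround f k'.arrow} ∈ 𝓝 k :=
        (isOpen_setOfPred_eventually_nhds.preimage SourceFibre.continuous_arrow).mem_nhds hf'
      obtain ⟨t, ht, htc, hts⟩ := exists_mem_nhds_isClosed_subset h1
      exact ⟨t, mem_nhdsWithin_of_mem_nhds ht, f, hf, fun k' hk' => hts (htc.closure_subset hk')⟩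
  obtain ⟨f, hf, hf'⟩ := h
  have htg : IsTopologicalGroup (𝒢.SourceFibre x) :=
    topologicalGroup_of_lieGroup 𝓘(ℝ, FibreModel E F) ∞
  -- Dividing by the value at the unit of the target normalizes `f` on units; on the fibre this unit
  -- is `u x`, so nothing changes there.
  refine ⟨fun g => (f (𝒢.u (𝒢.t g)))⁻¹ * f g, ⟨fun k => ?_, fun k => ?_⟩, fun y => ?_⟩
  · simp only [SourceFibre.t_arrow, ← SourceFibre.arrow_one, hf, inv_one, one_mul]
  · have hut : ContMDiff 𝓘(ℝ, F) 𝓘(ℝ, F) ∞ (fun g => 𝒢.u (𝒢.t g)) := 𝒢.smooth_u.comp 𝒢.smooth_t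
    have h1 : ∀ᶠ g in 𝓝 k.arrow,
        ContMDiffAt 𝓘(ℝ, F) 𝓘(ℝ, FibreModel E F) ∞ f (𝒢.u (𝒢.t g)) := by
      refine hut.continuous.continuousAt.eventually (p := fun g =>
        ContMDiffAt 𝓘(ℝ, F) 𝓘(ℝ, FibreModel E F) ∞ f g) ?_
      simp only [SourceFibre.t_arrow, ← SourceFibre.arrow_one]
      exact hf' 1 (by simp)
    filter_upwards [h1, hf' k (by simp)] with g hg1 hg2
    exact (ContMDiffAt.comp g hg1 hut.contMDiffAt).inv.mul hg2
  · simp only [𝒢.t_u, inv_mul_cancel]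

end LieGroupoid

end
-- Coordinates given by a retraction and the source
noncomputable section

namespace LieGroupoid

variable {E : Type*} [NormedAddCommGroup E] [NormedSpace ℝ E] [FiniteDimensional ℝ E]
  {F : Type*} [NormedAddCommGroup F] [NormedSpace ℝ F] [FiniteDimensional ℝ F]
  {M : Type*} [TopologicalSpace M] [ChartedSpace E M] [IsManifold 𝓘(ℝ, E) ∞ M]
  {G : Type*} [TopologicalSpace G] [ChartedSpace F G] [IsManifold 𝓘(ℝ, F) ∞ G]
  {𝒢 : LieGroupoid E F M G} {x : M}

/-- The pair formed by `f` and the source is a local diffeomorphism: in an adapted chart its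
derivative is block triangular, with identity blocks because the first coordinate is the source and
`f` is the identity on the fibre. -/
theorem IsRetraction.exists_local_section {f : G → 𝒢.SourceFibre x} (hf : IsRetraction f)
    (a₀ : 𝒢.SourceFibre x) :
    ∃ T : 𝒢.SourceFibre x × E → G, T (a₀, 0) = a₀.arrow ∧
      (∀ᶠ p in 𝓝 (a₀, (0 : E)),
        ContMDiffAt (𝓘(ℝ, FibreModel E F).prod 𝓘(ℝ, E)) 𝓘(ℝ, F) ∞ T p ∧ f (T p) = p.1 ∧
          𝒢.s (T p) = (centeredChart E x).symm p.2) ∧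
      ∀ᶠ g in 𝓝 a₀.arrow, T (f g, centeredChart E x (𝒢.s g)) = g := by
  obtain ⟨Θ, h, ha₀⟩ := 𝒢.exists_isAdapted a₀.s_arrow
  let D := FibreModel E F
  let κ := SourceFibre.chart h
  have hκ : κ.IsDiffeo 𝓘(ℝ, D) 𝓘(ℝ, D) := SourceFibre.isDiffeo_chart h
  have hz₀ : Θ a₀.arrow = (0, κ a₀) := SourceFibre.apply_arrow h ha₀
  have hz₀t : ((0, κ a₀) : E × D) ∈ Θ.target := hz₀ ▸ Θ.map_source ha₀
  have hsz₀ : Θ.symm (0, κ a₀) = a₀.arrow := by rw [← hz₀, Θ.left_inv ha₀]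
  have hcΘ : ContinuousAt Θ.symm ((0, κ a₀) : E × D) := Θ.symm.continuousAt hz₀t
  have hfc : ContinuousAt f a₀.arrow := (hf.smooth a₀).self_of_nhds.continuousAt
  have hfκ : ∀ᶠ g in 𝓝 a₀.arrow, f g ∈ κ.source :=
    hfc.eventually_mem (κ.open_source.mem_nhds (by rw [hf.apply_arrow]; exact ha₀))
  -- the retraction in coordinates
  let b : E × D → D := fun z => κ (f (Θ.symm z))
  have hb : ∀ᶠ z in 𝓝 ((0, κ a₀) : E × D), ContDiffAt ℝ ∞ b z := by
    have h1 := hcΘ.eventually (p := fun g => ContMDiffAt 𝓘(ℝ, F) 𝓘(ℝ, D) ∞ f g ∧ f g ∈ κ.source)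
      (by rw [hsz₀]; exact (hf.smooth a₀).and hfκ)
    filter_upwards [h1, Θ.open_target.mem_nhds hz₀t] with z hz hzt
    refine ContMDiffAt.contDiffAt ?_
    exact ContMDiffAt.comp (g := κ) z (hκ.contMDiffAt hz.2)
      (ContMDiffAt.comp z hz.1 (h.isDiffeo.contMDiffAt_symm hzt))
  have hb0 : ∀ᶠ d in 𝓝 (κ a₀), b (0, d) = d := by
    filter_upwards [κ.open_target.mem_nhds (κ.map_source ha₀)] with d hd
    change κ (f (Θ.symm (0, d))) = d
    rw [← SourceFibre.arrow_chart_symm h hd, hf.apply_arrow]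
    exact κ.right_inv hd
  have hbz₀ : b (0, κ a₀) = κ a₀ := hb0.self_of_nhds
  let L : E × D →L[ℝ] D := fderiv ℝ b (0, κ a₀)
  have hL : HasFDerivAt b L (0, κ a₀) :=
    (hb.self_of_nhds.differentiableAt (by simp)).hasFDerivAt
  have hL0 : ∀ δ : D, L (0, δ) = δ := by
    intro δ
    have h1 : HasFDerivAt (fun d : D => b (0, d)) (L ∘L .inr ℝ E D) (κ a₀) :=
      hL.comp (κ a₀) (hasFDerivAt_prodMk_right (0 : E) (κ a₀))
    have h2 : HasFDerivAt (fun d : D => b (0, d)) (.id ℝ D) (κ a₀) :=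
      (hasFDerivAt_id _).congr_of_eventuallyEq hb0
    exact congrArg (fun A : D →L[ℝ] D => A δ) (h1.unique h2)
  -- The equation `Q = 0` says that the point `q.2` has the source coordinate and retraction
  -- coordinate prescribed by `q.1`; solving it for `q.2` inverts the pair.
  let Q : (E × D) × (E × D) → E × D := fun q => (q.2.1 - q.1.1, b q.2 - q.1.2)
  obtain ⟨φ, hφ0, hφs, hφe, hφu⟩ := ContDiffAt.exists_implicit (f := Q)
    (x₀ := ((0, κ a₀) : E × D)) (v₀ := ((0, κ a₀) : E × D))
    (f' := (ContinuousLinearMap.fst ℝ E D).prod L) (by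
      have h1 : ContinuousAt (Prod.snd : (E × D) × (E × D) → E × D) ((0, κ a₀), (0, κ a₀)) :=
        continuousAt_snd
      filter_upwards [h1.eventually hb] with q hq
      have h2 : ContDiffAt ℝ ∞ (fun q : (E × D) × (E × D) => b q.2) q :=
        ContDiffAt.comp (g := b) q hq contDiffAt_snd
      refine ContDiffAt.prodMk ?_ ?_
      · exact (contDiff_snd.fst.sub contDiff_fst.fst).contDiffAt
      · exact h2.sub contDiff_fst.snd.contDiffAt)
    (by simp [Q, hbz₀])
    (by exact (hasFDerivAt_fst.sub_const (0 : E)).prodMk (hL.sub_const (κ a₀)))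
    (by
      have hadd : ∀ (u : E) (δ : D), L (u, δ) = L (u, 0) + δ := by
        intro u δ
        have : ((u, δ) : E × D) = (u, 0) + (0, δ) := by simp
        rw [this, map_add, hL0]
      constructor
      · rintro ⟨u, δ⟩ ⟨u', δ'⟩ huv
        have h1 : u = u' := congrArg Prod.fst huv
        have h2 : L (u, δ) = L (u', δ') := congrArg Prod.snd huv
        subst h1
        rw [hadd, hadd u δ', add_right_inj] at h2
        rw [h2]
      · rintro ⟨u, w⟩
        refine ⟨(u, w - L (u, 0)), Prod.ext rfl ?_⟩
        change L (u, w - L (u, 0)) = w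
        rw [hadd, add_sub_cancel])
  let P : 𝒢.SourceFibre x × E → E × D := fun p => (p.2, κ p.1)
  have hP0 : P (a₀, 0) = (0, κ a₀) := rfl
  have hPs : ∀ p : 𝒢.SourceFibre x × E, p.1 ∈ κ.source →
      ContMDiffAt (𝓘(ℝ, D).prod 𝓘(ℝ, E)) 𝓘(ℝ, E × D) ∞ P p := fun p hp =>
    contMDiffAt_snd.prodMk_space (ContMDiffAt.comp p (hκ.contMDiffAt hp) contMDiffAt_fst)
  have hκs : ∀ᶠ p in 𝓝 (a₀, (0 : E)), p.1 ∈ κ.source :=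
    continuousAt_fst.eventually_mem (κ.open_source.mem_nhds ha₀)
  have hPc : ContinuousAt P (a₀, 0) := (hPs (a₀, 0) ha₀).continuousAt
  have hφc : ContinuousAt (fun p => φ (P p)) (a₀, 0) :=
    ContinuousAt.comp (g := φ) (by rw [hP0]; exact hφs.self_of_nhds.continuousAt) hPc
  have hφP0 : φ (P (a₀, 0)) = (0, κ a₀) := by rw [hP0, hφ0]
  have hφt : ∀ᶠ p in 𝓝 (a₀, (0 : E)), φ (P p) ∈ Θ.target :=
    hφc.eventually_mem (by rw [hφP0]; exact Θ.open_target.mem_nhds hz₀t)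
  refine ⟨fun p => Θ.symm (φ (P p)), ?_, ?_, ?_⟩
  · beta_reduce
    rw [hφP0, hsz₀]
  · have h1 : ∀ᶠ p in 𝓝 (a₀, (0 : E)), f (Θ.symm (φ (P p))) ∈ κ.source := by
      have h2 : ContinuousAt (fun p => Θ.symm (φ (P p))) (a₀, (0 : E)) :=
        ContinuousAt.comp (g := Θ.symm) (by rw [hφP0]; exact hcΘ) hφc
      refine h2.eventually (p := fun g => f g ∈ κ.source) ?_
      beta_reduce
      rw [hφP0, hsz₀]
      exact hfκ
    filter_upwards [hκs, hφt, h1, hPc.eventually (hP0 ▸ hφs), hPc.eventually (hP0 ▸ hφe)]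
      with p hp hpt hpf hps hpe
    have h3 : (φ (P p)).1 - p.2 = 0 := congrArg Prod.fst hpe
    have h4 : κ (f (Θ.symm (φ (P p)))) - κ p.1 = 0 := congrArg Prod.snd hpe
    refine ⟨?_, κ.injOn hpf hp (sub_eq_zero.1 h4), ?_⟩
    · exact ContMDiffAt.comp p (h.isDiffeo.contMDiffAt_symm hpt)
        (ContMDiffAt.comp p hps.contMDiffAt (hPs p hp))
    · have h5 := h.fst_apply _ (Θ.map_target hpt)
      rw [Θ.right_inv hpt, sub_eq_zero.1 h3] at h5
      rw [h5, (centeredChart E x).left_inv (h.s_mem _ (Θ.map_target hpt))]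
  · have h1 : ContinuousAt (fun g => (((Θ g).1, κ (f g)), Θ g)) a₀.arrow := by
      have h2 : ContinuousAt Θ a₀.arrow := Θ.continuousAt ha₀
      have h3 : ContinuousAt (fun g => κ (f g)) a₀.arrow :=
        ContinuousAt.comp (g := κ) (κ.continuousAt (by rw [hf.apply_arrow]; exact ha₀)) hfc
      exact ((continuous_fst.continuousAt.comp h2).prodMk h3).prodMk h2
    have h2 := h1.eventually (p := fun q => Q q = 0 → q.2 = φ q.1) (by
      beta_reduce; rw [hf.apply_arrow, hz₀]; exact hφu)
    filter_upwards [h2, Θ.open_source.mem_nhds ha₀] with g hg hgs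
    have h3 := hg (by
      change ((Θ g).1 - (Θ g).1, κ (f (Θ.symm (Θ g))) - κ (f g)) = 0
      rw [Θ.left_inv hgs, sub_self, sub_self]
      rfl)
    change Θ.symm (φ (centeredChart E x (𝒢.s g), κ (f g))) = g
    rw [← h.fst_apply g hgs]
    change Θ g = φ ((Θ g).1, κ (f g)) at h3
    rw [← h3, Θ.left_inv hgs]

/-- A smooth retraction `f`, together with the source, gives coordinates on the neighbourhood `O` of
the fibre over `x`; the inverse is `T`. -/
structure IsSection (f : G → 𝒢.SourceFibre x) (T : 𝒢.SourceFibre x → E → G) (O : Set G) : Prop where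
  isOpen : IsOpen O
  arrow_mem : ∀ k : 𝒢.SourceFibre x, k.arrow ∈ O
  s_mem : ∀ g ∈ O, 𝒢.s g ∈ (centeredChart E x).source
  smooth_retraction : ∀ g ∈ O, ContMDiffAt 𝓘(ℝ, F) 𝓘(ℝ, FibreModel E F) ∞ f g
  apply_eq : ∀ g ∈ O, T (f g) (centeredChart E x (𝒢.s g)) = g
  apply_zero : ∀ a, T a 0 = a.arrow
  near : ∀ᶠ y in 𝓝 (0 : E), ∀ a, ContMDiffAt (𝓘(ℝ, FibreModel E F).prod 𝓘(ℝ, E)) 𝓘(ℝ, F) ∞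
    (fun p : 𝒢.SourceFibre x × E => T p.1 p.2) (a, y) ∧ T a y ∈ O ∧ f (T a y) = a ∧
      𝒢.s (T a y) = (centeredChart E x).symm y

/-- The pair formed by `f` and the source is injective on the compact fibre and injective near each
of its points, hence injective on a neighbourhood of the whole fibre. The local inverses therefore
agree and form one map `T`. -/
theorem IsRetraction.exists_section [T2Space G] [CompactSpace (𝒢.SourceFibre x)]
    {f : G → 𝒢.SourceFibre x} (hf : IsRetraction f) :
    ∃ (T : 𝒢.SourceFibre x → E → G) (O : Set G), IsSection f T O := by
  classical
  let S : G → 𝒢.SourceFibre x × E := fun g => (f g, centeredChart E x (𝒢.s g))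
  have hsc : Continuous 𝒢.s := 𝒢.submersion_s.contMDiff.continuous
  have hS0 : ∀ k : 𝒢.SourceFibre x, S k.arrow = (k, 0) := fun k =>
    Prod.ext (hf.apply_arrow k) (by
      change centeredChart E x (𝒢.s k.arrow) = 0
      rw [k.s_arrow, centeredChart_self])
  obtain ⟨O₁, hO₁, hKO₁, hinj⟩ := Set.InjOn.exists_isOpen_superset (f := S)
    (s := range (SourceFibre.arrow : 𝒢.SourceFibre x → G)) (by
      rintro _ ⟨k, rfl⟩ _ ⟨k', rfl⟩ hkk
      rw [hS0, hS0] at hkk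
      exact congrArg (fun p => p.1.arrow) hkk) (isCompact_range SourceFibre.continuous_arrow)
    (by
      rintro _ ⟨k, rfl⟩
      refine (hf.smooth k).self_of_nhds.continuousAt.prodMk ?_
      exact ContinuousAt.comp (g := centeredChart E x) ((centeredChart E x).continuousAt (by
        rw [k.s_arrow]; exact mem_centeredChart_source E x)) hsc.continuousAt)
    (by
      rintro _ ⟨k, rfl⟩
      obtain ⟨T, -, -, hT⟩ := hf.exists_local_section k
      refine ⟨_, hT, fun g hg g' hg' hgg => ?_⟩
      rw [← mem_ofPred.1 hg, ← mem_ofPred.1 hg']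
      exact congrArg T hgg)
  let O : Set G := O₁ ∩ (𝒢.s ⁻¹' (centeredChart E x).source ∩ {g | SmoothAround f g})
  have hO : IsOpen O := hO₁.inter (((centeredChart E x).open_source.preimage hsc).inter
    isOpen_setOfPred_eventually_nhds)
  have hKO : ∀ k : 𝒢.SourceFibre x, k.arrow ∈ O := fun k => ⟨hKO₁ ⟨k, rfl⟩, by
    change 𝒢.s k.arrow ∈ (centeredChart E x).source
    rw [k.s_arrow]; exact mem_centeredChart_source E x, hf.smooth k⟩
  -- The chosen arrow is unique by injectivity on `O₁`; the other branch is only a default value.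
  let T : 𝒢.SourceFibre x → E → G := fun a y =>
    if h : ∃ g ∈ O, S g = (a, y) then h.choose else a.arrow
  have hT : ∀ g ∈ O, ∀ a y, S g = (a, y) → T a y = g := by
    intro g hg a y hgS
    have h : ∃ g ∈ O, S g = (a, y) := ⟨g, hg, hgS⟩
    simp only [T, dif_pos h]
    exact hinj h.choose_spec.1.1 hg.1 (h.choose_spec.2.trans hgS.symm)
  refine ⟨T, O, hO, hKO, fun g hg => hg.2.1, fun g hg => hg.2.2.self_of_nhds,
    fun g hg => hT g hg _ _ rfl, fun a => hT _ (hKO a) _ _ (hS0 a), ?_⟩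
  have key : ∀ᶠ y in 𝓝 (0 : E), ∀ a ∈ (univ : Set (𝒢.SourceFibre x)),
      ContMDiffAt (𝓘(ℝ, FibreModel E F).prod 𝓘(ℝ, E)) 𝓘(ℝ, F) ∞
        (fun p : 𝒢.SourceFibre x × E => T p.1 p.2) (a, y) ∧ T a y ∈ O ∧ f (T a y) = a ∧
        𝒢.s (T a y) = (centeredChart E x).symm y := by
    refine isCompact_univ.eventually_forall_of_forall_eventually fun a _ => ?_
    obtain ⟨T₀, hT₀a, hT₀, -⟩ := hf.exists_local_section a
    have hmem : ∀ᶠ p in 𝓝 (a, (0 : E)), T₀ p ∈ O :=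
      hT₀.self_of_nhds.1.continuousAt.eventually_mem (hO.mem_nhds (hT₀a ▸ hKO a))
    have htar : ∀ᶠ p in 𝓝 (a, (0 : E)), p.2 ∈ (centeredChart E x).target :=
      continuousAt_snd.eventually_mem
        ((centeredChart E x).open_target.mem_nhds (zero_mem_centeredChart_target E x))
    have heq : ∀ᶠ p in 𝓝 (a, (0 : E)), T p.1 p.2 = T₀ p := by
      filter_upwards [hmem, hT₀, htar] with p hp hp' hpt
      refine hT _ hp _ _ (Prod.ext hp'.2.1 ?_)
      change centeredChart E x (𝒢.s (T₀ p)) = p.2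
      rw [hp'.2.2, (centeredChart E x).right_inv hpt]
    have h1 : ∀ᶠ p in 𝓝 (a, (0 : E)),
        ContMDiffAt (𝓘(ℝ, FibreModel E F).prod 𝓘(ℝ, E)) 𝓘(ℝ, F) ∞
        (fun p : 𝒢.SourceFibre x × E => T p.1 p.2) p ∧ T p.1 p.2 ∈ O ∧ f (T p.1 p.2) = p.1 ∧
        𝒢.s (T p.1 p.2) = (centeredChart E x).symm p.2 := by
      filter_upwards [heq.eventually_nhds, hmem, hT₀] with p hp hpO hp'
      rw [hp.self_of_nhds]
      exact ⟨hp'.1.congr_of_eventuallyEq hp, hpO, hp'.2⟩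
    exact (continuous_swap.tendsto ((0 : E), a)).eventually h1
  filter_upwards [key] with y hy a using hy a (mem_univ a)

end LieGroupoid

end
-- Products and quotients of arrows in these coordinates
noncomputable section

namespace LieGroupoid

variable {E : Type*} [NormedAddCommGroup E] [NormedSpace ℝ E] [FiniteDimensional ℝ E]
  {F : Type*} [NormedAddCommGroup F] [NormedSpace ℝ F] [FiniteDimensional ℝ F]
  {M : Type*} [TopologicalSpace M] [ChartedSpace E M] [IsManifold 𝓘(ℝ, E) ∞ M]
  {G : Type*} [TopologicalSpace G] [ChartedSpace F G] [IsManifold 𝓘(ℝ, F) ∞ G]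
  {𝒢 : LieGroupoid E F M G} {x : M}

/-- The target, in the chart centered at `x`. -/
def tgtMap (T : 𝒢.SourceFibre x → E → G) (a : 𝒢.SourceFibre x) (y : E) : E :=
  centeredChart E x (𝒢.t (T a y))

/-- The product of two arrows. -/
def prodArrow (T : 𝒢.SourceFibre x → E → G) (b a : 𝒢.SourceFibre x) (y : E) : G :=
  𝒢.mul (T b (tgtMap T a y)) (T a y)

/-- The quotient of two arrows. -/
def quotArrow (T : 𝒢.SourceFibre x → E → G) (b a : 𝒢.SourceFibre x) (y : E) : G :=
  𝒢.mul (T b y) (𝒢.inv (T a y))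

namespace IsSection

variable {f : G → 𝒢.SourceFibre x} {T : 𝒢.SourceFibre x → E → G} {O : Set G}
  (hT : IsSection f T O)
include hT

theorem continuousAt_zero (a : 𝒢.SourceFibre x) :
    ContinuousAt (fun p : 𝒢.SourceFibre x × E => T p.1 p.2) (a, 0) :=
  (hT.near.self_of_nhds a).1.continuousAt

variable [CompactSpace (𝒢.SourceFibre x)]

/-- Since `T a 0` is the arrow `a` itself, a property holding near every point of the compact fibre
holds along `T a y` for all `a` at once when `y` is small. -/
theorem eventually_of_arrow {P : G → Prop}
    (hP : ∀ k : 𝒢.SourceFibre x, ∀ᶠ g in 𝓝 k.arrow, P g) :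
    ∀ᶠ y in 𝓝 (0 : E), ∀ a, P (T a y) := by
  have key : ∀ᶠ y in 𝓝 (0 : E), ∀ a ∈ (univ : Set (𝒢.SourceFibre x)), P (T a y) := by
    refine isCompact_univ.eventually_forall_of_forall_eventually fun a _ => ?_
    have h1 : ContinuousAt (fun p : E × 𝒢.SourceFibre x => T p.2 p.1) (0, a) :=
      ContinuousAt.comp (f := fun p : E × 𝒢.SourceFibre x => (p.2, p.1))
        (g := fun p : 𝒢.SourceFibre x × E => T p.1 p.2) (hT.continuousAt_zero a) (by fun_prop)
    refine h1.eventually (p := P) ?_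
    beta_reduce
    rw [hT.apply_zero]
    exact hP a
  filter_upwards [key] with y hy a using hy a (mem_univ a)

variable [hfix : Fact (𝒢.IsFixedPoint x)]

omit [CompactSpace (𝒢.SourceFibre x)] in
theorem tgtMap_zero (a : 𝒢.SourceFibre x) : tgtMap T a 0 = 0 := by
  rw [tgtMap, hT.apply_zero, SourceFibre.t_arrow, centeredChart_self]

theorem eventually_tgtMap {P : E → Prop} (hP : ∀ᶠ y in 𝓝 (0 : E), P y) :
    ∀ᶠ y in 𝓝 (0 : E), ∀ a, P (tgtMap T a y) := by
  refine hT.eventually_of_arrow (P := fun g => P (centeredChart E x (𝒢.t g))) fun k => ?_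
  have h1 : ContinuousAt (fun g => centeredChart E x (𝒢.t g)) k.arrow :=
    ContinuousAt.comp (g := centeredChart E x) ((centeredChart E x).continuousAt (by
      rw [k.t_arrow]; exact mem_centeredChart_source E x)) 𝒢.continuous_t.continuousAt
  refine h1.eventually (p := P) ?_
  beta_reduce
  rw [k.t_arrow, centeredChart_self]
  exact hP

theorem eventually_t_mem : ∀ᶠ y in 𝓝 (0 : E), ∀ a, 𝒢.t (T a y) ∈ (centeredChart E x).source :=
  hT.eventually_of_arrow (P := fun g => 𝒢.t g ∈ (centeredChart E x).source) fun k =>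
    𝒢.continuous_t.continuousAt.eventually_mem ((centeredChart E x).open_source.mem_nhds (by
      rw [k.t_arrow]; exact mem_centeredChart_source E x))

theorem smooth_tgtMap : ∀ᶠ y in 𝓝 (0 : E), ∀ a,
    ContMDiffAt (𝓘(ℝ, FibreModel E F).prod 𝓘(ℝ, E)) 𝓘(ℝ, E) ∞
      (fun p : 𝒢.SourceFibre x × E => tgtMap T p.1 p.2) (a, y) := by
  filter_upwards [hT.near, hT.eventually_t_mem] with y hy hy' a
  exact ContMDiffAt.comp (g := centeredChart E x) (a, y)
    ((isDiffeo_centeredChart E x).contMDiffAt (hy' a))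
    (ContMDiffAt.comp (g := 𝒢.t) (a, y) 𝒢.smooth_t.contMDiffAt (hy a).1)

/-- Near `0`, the arrows `T b (tgtMap T a y)` and `T a y` are composable. -/
theorem eventually_composable :
    ∀ᶠ y in 𝓝 (0 : E), ∀ b a, 𝒢.s (T b (tgtMap T a y)) = 𝒢.t (T a y) := by
  filter_upwards [hT.eventually_tgtMap hT.near, hT.eventually_t_mem] with y hy hy' b a
  rw [(hy a b).2.2.2, tgtMap, (centeredChart E x).left_inv (hy' a)]

theorem smooth_prodArrow : ∀ᶠ y in 𝓝 (0 : E), ∀ b a,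
    ContMDiffAt (𝓘(ℝ, FibreModel E F).prod (𝓘(ℝ, FibreModel E F).prod 𝓘(ℝ, E))) 𝓘(ℝ, F) ∞
      (fun p : 𝒢.SourceFibre x × 𝒢.SourceFibre x × E => prodArrow T p.1 p.2.1 p.2.2) (b, a, y) := by
  filter_upwards [hT.near, hT.smooth_tgtMap, hT.eventually_tgtMap hT.near,
    hT.eventually_composable.eventually_nhds] with y h1 h2 h3 h4 b a
  have e1 : ContMDiffAt (𝓘(ℝ, FibreModel E F).prod (𝓘(ℝ, FibreModel E F).prod 𝓘(ℝ, E))) 𝓘(ℝ, F) ∞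
      (fun p : 𝒢.SourceFibre x × 𝒢.SourceFibre x × E => T p.2.1 p.2.2) (b, a, y) :=
    ContMDiffAt.comp (g := fun p : 𝒢.SourceFibre x × E => T p.1 p.2) (b, a, y) (h1 a).1
      contMDiffAt_snd
  have e2 : ContMDiffAt (𝓘(ℝ, FibreModel E F).prod (𝓘(ℝ, FibreModel E F).prod 𝓘(ℝ, E))) 𝓘(ℝ, E) ∞
      (fun p : 𝒢.SourceFibre x × 𝒢.SourceFibre x × E => tgtMap T p.2.1 p.2.2) (b, a, y) :=
    ContMDiffAt.comp (g := fun p : 𝒢.SourceFibre x × E => tgtMap T p.1 p.2) (b, a, y) (h2 a)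
      contMDiffAt_snd
  have e3 : ContMDiffAt (𝓘(ℝ, FibreModel E F).prod (𝓘(ℝ, FibreModel E F).prod 𝓘(ℝ, E))) 𝓘(ℝ, F) ∞
      (fun p : 𝒢.SourceFibre x × 𝒢.SourceFibre x × E => T p.1 (tgtMap T p.2.1 p.2.2)) (b, a, y) :=
    ContMDiffAt.comp (g := fun p : 𝒢.SourceFibre x × E => T p.1 p.2) (b, a, y) (h3 a b).1
      (contMDiffAt_fst.prodMk e2)
  refine 𝒢.contMDiffAt_mul e3 e1 ?_
  have h5 : ContinuousAt (fun p : 𝒢.SourceFibre x × 𝒢.SourceFibre x × E => p.2.2) (b, a, y) := by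
    fun_prop
  filter_upwards [h5.eventually h4] with p hp using hp p.1 p.2.1

omit [CompactSpace (𝒢.SourceFibre x)] hfix in
theorem smooth_quotArrow : ∀ᶠ y in 𝓝 (0 : E), ∀ b a,
    ContMDiffAt (𝓘(ℝ, FibreModel E F).prod (𝓘(ℝ, FibreModel E F).prod 𝓘(ℝ, E))) 𝓘(ℝ, F) ∞
      (fun p : 𝒢.SourceFibre x × 𝒢.SourceFibre x × E => quotArrow T p.1 p.2.1 p.2.2) (b, a, y) := by
  filter_upwards [hT.near, hT.near.eventually_nhds] with y h1 h4 b a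
  have e1 : ContMDiffAt (𝓘(ℝ, FibreModel E F).prod (𝓘(ℝ, FibreModel E F).prod 𝓘(ℝ, E))) 𝓘(ℝ, F) ∞
      (fun p : 𝒢.SourceFibre x × 𝒢.SourceFibre x × E => T p.2.1 p.2.2) (b, a, y) :=
    ContMDiffAt.comp (g := fun p : 𝒢.SourceFibre x × E => T p.1 p.2) (b, a, y) (h1 a).1
      contMDiffAt_snd
  have e3 : ContMDiffAt (𝓘(ℝ, FibreModel E F).prod (𝓘(ℝ, FibreModel E F).prod 𝓘(ℝ, E))) 𝓘(ℝ, F) ∞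
      (fun p : 𝒢.SourceFibre x × 𝒢.SourceFibre x × E => T p.1 p.2.2) (b, a, y) :=
    ContMDiffAt.comp (g := fun p : 𝒢.SourceFibre x × E => T p.1 p.2) (b, a, y) (h1 b).1
      (contMDiffAt_fst.prodMk contMDiffAt_snd.snd)
  refine 𝒢.contMDiffAt_mul e3 (ContMDiffAt.comp (g := 𝒢.inv) (b, a, y)
    𝒢.smooth_inv.contMDiffAt e1) ?_
  have h5 : ContinuousAt (fun p : 𝒢.SourceFibre x × 𝒢.SourceFibre x × E => p.2.2) (b, a, y) := by
    fun_prop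
  filter_upwards [h5.eventually h4] with p hp
  rw [𝒢.t_inv, (hp p.1).2.2.2, (hp p.2.1).2.2.2]

omit hfix hT [FiniteDimensional ℝ E] [FiniteDimensional ℝ F] [IsManifold 𝓘(ℝ, E) ∞ M]
  [IsManifold 𝓘(ℝ, F) ∞ G] in
theorem eventually_mem_of_continuousAt {q : 𝒢.SourceFibre x → 𝒢.SourceFibre x → E → G} {O : Set G}
    (hO : IsOpen O) (hq : ∀ b a, ContinuousAt
      (fun p : 𝒢.SourceFibre x × 𝒢.SourceFibre x × E => q p.1 p.2.1 p.2.2) (b, a, 0))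
    (hq0 : ∀ b a, q b a 0 ∈ O) : ∀ᶠ y in 𝓝 (0 : E), ∀ b a, q b a y ∈ O := by
  have key : ∀ᶠ y in 𝓝 (0 : E), ∀ w ∈ (univ : Set (𝒢.SourceFibre x × 𝒢.SourceFibre x)),
      q w.1 w.2 y ∈ O := by
    refine isCompact_univ.eventually_forall_of_forall_eventually fun w _ => ?_
    have h1 : ContinuousAt (fun p : E × (𝒢.SourceFibre x × 𝒢.SourceFibre x) => q p.2.1 p.2.2 p.1)
        (0, w) :=
      ContinuousAt.comp (f := fun p : E × (𝒢.SourceFibre x × 𝒢.SourceFibre x) =>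
          (p.2.1, p.2.2, p.1))
        (g := fun p : 𝒢.SourceFibre x × 𝒢.SourceFibre x × E => q p.1 p.2.1 p.2.2)
        (hq w.1 w.2) (by fun_prop)
    exact h1.eventually_mem (hO.mem_nhds (hq0 w.1 w.2))
  filter_upwards [key] with y hy b a using hy (b, a) (mem_univ _)

omit [CompactSpace (𝒢.SourceFibre x)] in
theorem prodArrow_zero (b a : 𝒢.SourceFibre x) : prodArrow T b a 0 = (b * a).arrow := by
  rw [prodArrow, hT.tgtMap_zero, hT.apply_zero, hT.apply_zero, SourceFibre.arrow_mul]

omit [CompactSpace (𝒢.SourceFibre x)] in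
theorem quotArrow_zero (b a : 𝒢.SourceFibre x) : quotArrow T b a 0 = (b * a⁻¹).arrow := by
  rw [quotArrow, hT.apply_zero, hT.apply_zero, SourceFibre.arrow_mul, SourceFibre.arrow_inv]

theorem eventually_prodArrow_mem {O' : Set G} (hO' : IsOpen O')
    (hK : ∀ k : 𝒢.SourceFibre x, k.arrow ∈ O') :
    ∀ᶠ y in 𝓝 (0 : E), ∀ b a, prodArrow T b a y ∈ O' :=
  eventually_mem_of_continuousAt hO'
    (fun b a => (hT.smooth_prodArrow.self_of_nhds b a).continuousAt)
    fun b a => by rw [hT.prodArrow_zero]; exact hK _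

theorem eventually_quotArrow_mem {O' : Set G} (hO' : IsOpen O')
    (hK : ∀ k : 𝒢.SourceFibre x, k.arrow ∈ O') :
    ∀ᶠ y in 𝓝 (0 : E), ∀ b a, quotArrow T b a y ∈ O' :=
  eventually_mem_of_continuousAt hO'
    (fun b a => (hT.smooth_quotArrow.self_of_nhds b a).continuousAt)
    fun b a => by rw [hT.quotArrow_zero]; exact hK _

end IsSection

end LieGroupoid

end
-- The local groupoid of a section and the multiplicative retraction
noncomputable section

namespace LieGroupoid

variable {E : Type*} [NormedAddCommGroup E] [NormedSpace ℝ E] [FiniteDimensional ℝ E]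
  {F : Type*} [NormedAddCommGroup F] [NormedSpace ℝ F] [FiniteDimensional ℝ F]
  {M : Type*} [TopologicalSpace M] [ChartedSpace E M] [IsManifold 𝓘(ℝ, E) ∞ M]
  {G : Type*} [TopologicalSpace G] [ChartedSpace F G] [IsManifold 𝓘(ℝ, F) ∞ G]
  {𝒢 : LieGroupoid E F M G} {x : M}

namespace IsSection

variable {f : G → 𝒢.SourceFibre x} {T : 𝒢.SourceFibre x → E → G} {O : Set G}
  (hT : IsSection f T O) [CompactSpace (𝒢.SourceFibre x)] [hfix : Fact (𝒢.IsFixedPoint x)]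
include hT

omit [CompactSpace (𝒢.SourceFibre x)] hfix in
theorem retraction_arrow (k : 𝒢.SourceFibre x) : f k.arrow = k := by
  have := (hT.near.self_of_nhds k).2.2.1
  rwa [hT.apply_zero] at this

/-- Near `0`, products are again values of the section. -/
theorem eventually_prodArrow : ∀ᶠ y in 𝓝 (0 : E), ∀ b a,
    𝒢.s (T b (tgtMap T a y)) = 𝒢.t (T a y) ∧ prodArrow T b a y ∈ O ∧
      T (f (prodArrow T b a y)) y = prodArrow T b a y ∧
      tgtMap T (f (prodArrow T b a y)) y = tgtMap T b (tgtMap T a y) := by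
  filter_upwards [hT.eventually_composable, hT.eventually_prodArrow_mem hT.isOpen hT.arrow_mem,
    hT.near, (centeredChart E x).open_target.mem_nhds (zero_mem_centeredChart_target E x)]
    with y h1 h2 h3 h4 b a
  have h5 : 𝒢.s (prodArrow T b a y) = (centeredChart E x).symm y := by
    rw [prodArrow, 𝒢.s_mul _ _ (h1 b a), (h3 a).2.2.2]
  have h6 : T (f (prodArrow T b a y)) y = prodArrow T b a y := by
    have := hT.apply_eq _ (h2 b a)
    rwa [h5, (centeredChart E x).right_inv h4] at this
  refine ⟨h1 b a, h2 b a, h6, ?_⟩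
  conv_lhs => rw [tgtMap, h6, prodArrow, 𝒢.t_mul _ _ (h1 b a)]
  rfl

/-- Since `T` recovers each product from its retraction, both sides are `f` applied to the same
triple product of arrows. -/
theorem eventually_mul_assoc : ∀ᶠ y in 𝓝 (0 : E), ∀ a b c,
    f (prodArrow T c (f (prodArrow T b a y)) y) =
      f (prodArrow T (f (prodArrow T c b (tgtMap T a y))) a y) := by
  filter_upwards [hT.eventually_prodArrow, hT.eventually_tgtMap hT.eventually_prodArrow]
    with y h1 h2 a b c
  have e1 : prodArrow T c (f (prodArrow T b a y)) y
      = 𝒢.mul (T c (tgtMap T b (tgtMap T a y))) (𝒢.mul (T b (tgtMap T a y)) (T a y)) := by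
    rw [prodArrow, (h1 b a).2.2.1, (h1 b a).2.2.2]
    rfl
  have e2 : prodArrow T (f (prodArrow T c b (tgtMap T a y))) a y
      = 𝒢.mul (𝒢.mul (T c (tgtMap T b (tgtMap T a y))) (T b (tgtMap T a y))) (T a y) := by
    rw [prodArrow, (h2 a c b).2.2.1]
    rfl
  rw [e1, e2, 𝒢.mul_assoc _ _ _ (h2 a c b).1 (h1 b a).1]

theorem eventually_mul_div : ∀ᶠ y in 𝓝 (0 : E), ∀ h a,
    f (prodArrow T (f (quotArrow T h a y)) a y) = h := by
  filter_upwards [hT.near, hT.eventually_quotArrow_mem hT.isOpen hT.arrow_mem] with y h1 h2 h a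
  have h3 : 𝒢.s (T h y) = 𝒢.s (T a y) := (h1 h).2.2.2.trans (h1 a).2.2.2.symm
  have h4 := hT.apply_eq _ (h2 h a)
  have h5 : 𝒢.s (quotArrow T h a y) = 𝒢.t (T a y) := by
    rw [quotArrow, 𝒢.s_mul _ _ (h3.trans (𝒢.t_inv _).symm), 𝒢.s_inv]
  rw [h5] at h4
  rw [prodArrow, tgtMap, h4, quotArrow, 𝒢.mul_inv_mul_cancel h3, (h1 h).2.2.1]

theorem eventually_div_mul : ∀ᶠ y in 𝓝 (0 : E), ∀ b a,
    f (quotArrow T (f (prodArrow T b a y)) a y) = b := by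
  filter_upwards [hT.eventually_tgtMap hT.near, hT.eventually_prodArrow] with y h1 h2 b a
  rw [quotArrow, (h2 b a).2.2.1, prodArrow, 𝒢.mul_mul_inv_cancel (h2 b a).1, (h1 a b).2.2.1]

omit [CompactSpace (𝒢.SourceFibre x)] in
theorem eventually_one (hu : ∀ᶠ y in 𝓝 x, f (𝒢.u y) = 1) : ∀ᶠ y in 𝓝 (0 : E),
    T 1 y = 𝒢.u ((centeredChart E x).symm y) := by
  have h1 : ContinuousAt (fun y => 𝒢.u ((centeredChart E x).symm y)) 0 :=
    ContinuousAt.comp (g := 𝒢.u) 𝒢.smooth_u.continuous.continuousAt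
      ((centeredChart E x).symm.continuousAt (zero_mem_centeredChart_target E x))
  have h2 : ∀ᶠ y in 𝓝 (0 : E), 𝒢.u ((centeredChart E x).symm y) ∈ O :=
    h1.eventually_mem (hT.isOpen.mem_nhds (by
      rw [centeredChart_symm_zero, ← SourceFibre.arrow_one]; exact hT.arrow_mem 1))
  have h3 : ∀ᶠ y in 𝓝 (0 : E), f (𝒢.u ((centeredChart E x).symm y)) = 1 :=
    ((centeredChart E x).symm.continuousAt (zero_mem_centeredChart_target E x)).eventually
      (p := fun y => f (𝒢.u y) = 1) (by rw [centeredChart_symm_zero]; exact hu)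
  filter_upwards [h2, h3,
    (centeredChart E x).open_target.mem_nhds (zero_mem_centeredChart_target E x)] with y hy hy1 hyt
  have := hT.apply_eq _ hy
  rwa [hy1, 𝒢.s_u, (centeredChart E x).right_inv hyt] at this

/-- The normalization of `f` on units makes `T 1 y` the unit at `y`, so that `1` is a left identity
for the deformed product. -/
theorem eventually_one_mul (hu : ∀ᶠ y in 𝓝 x, f (𝒢.u y) = 1) : ∀ᶠ y in 𝓝 (0 : E), ∀ a,
    f (prodArrow T 1 a y) = a := by
  filter_upwards [hT.near, hT.eventually_tgtMap (hT.eventually_one hu), hT.eventually_t_mem]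
    with y h1 h2 h3 a
  rw [prodArrow, h2 a, tgtMap, (centeredChart E x).left_inv (h3 a), 𝒢.u_mul, (h1 a).2.2.1]

theorem smooth_mul_div : ∀ᶠ y in 𝓝 (0 : E), ∀ b a,
    ContMDiffAt (𝓘(ℝ, FibreModel E F).prod (𝓘(ℝ, FibreModel E F).prod 𝓘(ℝ, E)))
      𝓘(ℝ, FibreModel E F) ∞ (fun p : 𝒢.SourceFibre x × 𝒢.SourceFibre x × E =>
        f (prodArrow T p.1 p.2.1 p.2.2)) (b, a, y) ∧
    ContMDiffAt (𝓘(ℝ, FibreModel E F).prod (𝓘(ℝ, FibreModel E F).prod 𝓘(ℝ, E)))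
      𝓘(ℝ, FibreModel E F) ∞ (fun p : 𝒢.SourceFibre x × 𝒢.SourceFibre x × E =>
        f (quotArrow T p.1 p.2.1 p.2.2)) (b, a, y) := by
  filter_upwards [hT.smooth_prodArrow, hT.smooth_quotArrow,
    hT.eventually_prodArrow_mem hT.isOpen hT.arrow_mem,
    hT.eventually_quotArrow_mem hT.isOpen hT.arrow_mem] with y h1 h2 h3 h4 b a
  exact ⟨ContMDiffAt.comp (g := f) (b, a, y) (hT.smooth_retraction _ (h3 b a)) (h1 b a),
    ContMDiffAt.comp (g := f) (b, a, y) (hT.smooth_retraction _ (h4 b a)) (h2 b a)⟩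

/-- The local groupoid on `K × E`, where `K` is the fibre over the fixed point `x`, which is given
by a section. -/
def localGroupoid (hu : ∀ᶠ y in 𝓝 x, f (𝒢.u y) = 1) :
    LocalGroupoid (FibreModel E F) E (𝒢.SourceFibre x) where
  dom := interior {y | ∀ b a,
    ContMDiffAt (𝓘(ℝ, FibreModel E F).prod (𝓘(ℝ, FibreModel E F).prod 𝓘(ℝ, E)))
      𝓘(ℝ, FibreModel E F) ∞ (fun p : 𝒢.SourceFibre x × 𝒢.SourceFibre x × E =>
        f (prodArrow T p.1 p.2.1 p.2.2)) (b, a, y) ∧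
    ContMDiffAt (𝓘(ℝ, FibreModel E F).prod (𝓘(ℝ, FibreModel E F).prod 𝓘(ℝ, E)))
      𝓘(ℝ, FibreModel E F) ∞ (fun p : 𝒢.SourceFibre x × 𝒢.SourceFibre x × E =>
        f (quotArrow T p.1 p.2.1 p.2.2)) (b, a, y)}
  isOpen_dom := isOpen_interior
  zero_mem := mem_interior_iff_mem_nhds.2 hT.smooth_mul_div
  mul b a y := f (prodArrow T b a y)
  div b a y := f (quotArrow T b a y)
  tgt := tgtMap T
  smooth_mul b a _ hy := (interior_subset hy b a).1
  smooth_div b a _ hy := (interior_subset hy b a).2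
  continuousAt_tgt a := ContinuousAt.comp (f := fun p : E × 𝒢.SourceFibre x => (p.2, p.1))
    (g := fun p : 𝒢.SourceFibre x × E => tgtMap T p.1 p.2)
    (hT.smooth_tgtMap.self_of_nhds a).continuousAt (by fun_prop)
  mul_at_zero b a := by rw [hT.prodArrow_zero, hT.retraction_arrow]
  div_at_zero b a := by rw [hT.quotArrow_zero, hT.retraction_arrow]
  tgt_at_zero := hT.tgtMap_zero
  mul_assoc_near := hT.eventually_mul_assoc
  mul_div_near := hT.eventually_mul_div
  div_mul_near := hT.eventually_div_mul
  one_mul_near := hT.eventually_one_mul hu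

end IsSection

variable [T2Space G] [SecondCountableTopology G]

/-- Near the fibre over a fixed point there is a smooth retraction onto the fibre which is
multiplicative. -/
theorem exists_multiplicative_retraction (𝒢 : LieGroupoid E F M G) (x : M)
    [hfix : Fact (𝒢.IsFixedPoint x)] [CompactSpace (𝒢.SourceFibre x)] :
    ∃ (r : G → 𝒢.SourceFibre x) (O : Set G), IsRetraction r ∧ IsOpen O ∧
      (∀ k : 𝒢.SourceFibre x, k.arrow ∈ O) ∧
      ∀ᶠ y in 𝓝 x, ∀ g ∈ O, ∀ h ∈ O, 𝒢.s g = 𝒢.t h → 𝒢.s h = y → r (𝒢.mul g h) = r g * r h := by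
  obtain ⟨f, hf, hu⟩ := exists_isRetraction 𝒢 x
  obtain ⟨T, O, hT⟩ := hf.exists_section
  obtain ⟨r, hr0, hrs, hrm⟩ := (hT.localGroupoid (Eventually.of_forall hu)).exists_homomorphism
  have hψ0 : ContinuousAt (centeredChart E x) x :=
    (centeredChart E x).continuousAt (mem_centeredChart_source E x)
  -- The homomorphism found in coordinates is carried back to arrows; it is still the identity on
  -- the fibre because `r a 0 = a`.
  refine ⟨fun g => r (f g) (centeredChart E x (𝒢.s g)), O, ⟨fun k => ?_, fun k => ?_⟩, hT.isOpen,
    hT.arrow_mem, ?_⟩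
  · simp only [k.s_arrow, centeredChart_self, hr0, hf.apply_arrow]
  · have h1 : ContinuousAt (fun g => centeredChart E x (𝒢.s g)) k.arrow :=
      ContinuousAt.comp (g := centeredChart E x) (by rw [k.s_arrow]; exact hψ0)
        𝒢.continuous_s.continuousAt
    have h2 := h1.eventually (p := fun y => ∀ a,
      ContMDiffAt (𝓘(ℝ, FibreModel E F).prod 𝓘(ℝ, E)) 𝓘(ℝ, FibreModel E F) ∞
        (fun p : 𝒢.SourceFibre x × E => r p.1 p.2) (a, y)) (by
          beta_reduce; rw [k.s_arrow, centeredChart_self]; exact hrs)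
    filter_upwards [h2, hT.isOpen.mem_nhds (hT.arrow_mem k)] with g hg hgO
    have h3 : ContMDiffAt 𝓘(ℝ, F) 𝓘(ℝ, E) ∞ (fun g => centeredChart E x (𝒢.s g)) g :=
      ContMDiffAt.comp (g := centeredChart E x) g
        ((isDiffeo_centeredChart E x).contMDiffAt (hT.s_mem g hgO))
        𝒢.submersion_s.contMDiff.contMDiffAt
    exact ContMDiffAt.comp (g := fun p : 𝒢.SourceFibre x × E => r p.1 p.2) g (hg (f g))
      ((hT.smooth_retraction g hgO).prodMk h3)
  · have h1 := hψ0.eventually (p := fun y => ∀ a b,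
      r (f (prodArrow T b a y)) y = r b (tgtMap T a y) * r a y) (by
        rw [centeredChart_self]; exact hrm)
    filter_upwards [h1] with y hy g hg h hh hgh hhy
    subst hhy
    have e1 := hy (f h) (f g)
    have e2 : tgtMap T (f h) (centeredChart E x (𝒢.s h)) = centeredChart E x (𝒢.s g) := by
      rw [tgtMap, hT.apply_eq h hh, hgh]
    rw [prodArrow, e2, hT.apply_eq h hh, hT.apply_eq g hg] at e1
    rw [𝒢.s_mul g h hgh]
    exact e1

end LieGroupoid

end
-- Linearization of a compact group action near a fixed point
noncomputable section

open MeasureTheory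

section LocalAction

variable {D : Type*} [NormedAddCommGroup D] [NormedSpace ℝ D]
  {E : Type*} [NormedAddCommGroup E] [NormedSpace ℝ E]
  {K : Type*} [TopologicalSpace K] [Group K] [ChartedSpace D K] [LieGroup 𝓘(ℝ, D) ∞ K]
  [CompactSpace K]

/-- A smooth action of `K` on a neighbourhood of the fixed point `0` in `E`. -/
structure IsLocalAction (D : Type*) [NormedAddCommGroup D] [NormedSpace ℝ D]
    {E : Type*} [NormedAddCommGroup E] [NormedSpace ℝ E]
    {K : Type*} [TopologicalSpace K] [Group K] [ChartedSpace D K] (A : K → E → E) : Prop where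
  map_zero : ∀ a, A a 0 = 0
  smooth : ∀ᶠ y in 𝓝 (0 : E), ∀ a,
    ContMDiffAt (𝓘(ℝ, D).prod 𝓘(ℝ, E)) 𝓘(ℝ, E) ∞ (fun p : K × E => A p.1 p.2) (a, y)
  mul_apply : ∀ᶠ y in 𝓝 (0 : E), ∀ b a, A b (A a y) = A (b * a) y
  one_apply : ∀ᶠ y in 𝓝 (0 : E), A 1 y = y

namespace IsLocalAction

variable {A : K → E → E} (hA : IsLocalAction D A)
include hA

omit [LieGroup 𝓘(ℝ, D) ∞ K] [CompactSpace K] in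
theorem differentiableAt (a : K) : DifferentiableAt ℝ (A a) 0 := by
  have h : ContMDiffAt 𝓘(ℝ, E) 𝓘(ℝ, E) ∞ (A a) 0 :=
    ContMDiffAt.comp (g := fun p : K × E => A p.1 p.2) (0 : E) (hA.smooth.self_of_nhds a)
      (contMDiffAt_const.prodMk contMDiffAt_id)
  exact h.contDiffAt.differentiableAt (by simp)

omit [LieGroup 𝓘(ℝ, D) ∞ K] [CompactSpace K] in
theorem hasFDerivAt (a : K) : HasFDerivAt (A a) (fderiv ℝ (A a) 0) 0 :=
  (hA.differentiableAt a).hasFDerivAt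

omit [LieGroup 𝓘(ℝ, D) ∞ K] [CompactSpace K] in
theorem fderiv_mul_apply (b a : K) (v : E) :
    fderiv ℝ (A b) 0 (fderiv ℝ (A a) 0 v) = fderiv ℝ (A (b * a)) 0 v := by
  have h1 : HasFDerivAt (A b) (fderiv ℝ (A b) 0) (A a 0) := by
    rw [hA.map_zero]; exact hA.hasFDerivAt b
  have h2 := h1.comp (0 : E) (hA.hasFDerivAt a)
  have h3 : A b ∘ A a =ᶠ[𝓝 0] A (b * a) := hA.mul_apply.mono fun y hy => hy b a
  have h4 := (h2.congr_of_eventuallyEq h3.symm).unique (hA.hasFDerivAt (b * a))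
  exact congrArg (fun L => L v) h4

omit [LieGroup 𝓘(ℝ, D) ∞ K] [CompactSpace K] in
theorem fderiv_one_apply (v : E) : fderiv ℝ (A 1) 0 v = v := by
  have h1 : HasFDerivAt (A 1) (.id ℝ E) 0 := (hasFDerivAt_id _).congr_of_eventuallyEq hA.one_apply
  rw [h1.fderiv]
  rfl

theorem exists_smoothFamilyAt : ∃ r : Set E, IsOpen r ∧ 0 ∈ r ∧
    ∀ a, ∀ y ∈ r, SmoothFamilyAt D A a y := by
  refine exists_open_smoothFamilyAt fun a₀ => ?_
  let c := chartAt D a₀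
  have ha₀ : a₀ ∈ c.source := mem_chart_source D a₀
  refine eventually_smoothFamilyAt (c := c) (Hh := fun p : D × E => A (c.symm p.1) p.2) ?_ ?_ ?_
  · filter_upwards [c.open_source.mem_nhds ha₀] with a ha using c.continuousAt ha
  · have h1 : ContinuousAt (fun p : D × E => p.2) (c a₀, 0) := continuousAt_snd
    have h2 : ContinuousAt (fun p : D × E => p.1) (c a₀, 0) := continuousAt_fst
    filter_upwards [h1.eventually hA.smooth,
      h2.eventually_mem (c.open_target.mem_nhds (c.map_source ha₀))] with p hp hpt
    refine ContMDiffAt.comp (g := fun p : K × E => A p.1 p.2)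
      (f := fun p : D × E => (c.symm p.1, p.2)) p (hp _) (ContMDiffAt.prodMk ?_ ?_)
    · exact ContMDiffAt.comp (g := c.symm) p
        (contMDiffOn_chart_symm.contMDiffAt (c.open_target.mem_nhds hpt))
        contDiff_fst.contMDiff.contMDiffAt
    · exact contDiff_snd.contMDiff.contMDiffAt
  · have h1 : ContinuousAt (fun p : K × E => p.1) (a₀, 0) := continuousAt_fst
    filter_upwards [h1.eventually_mem (c.open_source.mem_nhds ha₀)] with p hp
    rw [c.left_inv hp]

omit [LieGroup 𝓘(ℝ, D) ∞ K] in
theorem eventually_forall {P : E → Prop} (hP : ∀ᶠ y in 𝓝 (0 : E), P y) :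
    ∀ᶠ y in 𝓝 (0 : E), ∀ a, P (A a y) := by
  have key : ∀ᶠ y in 𝓝 (0 : E), ∀ a ∈ (univ : Set K), P (A a y) := by
    refine isCompact_univ.eventually_forall_of_forall_eventually fun a _ => ?_
    have h1 : ContinuousAt (fun p : E × K => A p.2 p.1) (0, a) :=
      ContinuousAt.comp (f := fun p : E × K => (p.2, p.1)) (g := fun p : K × E => A p.1 p.2)
        (hA.smooth.self_of_nhds a).continuousAt (by fun_prop)
    exact h1.eventually (p := P) (by beta_reduce; rw [hA.map_zero]; exact hP)
  filter_upwards [key] with y hy a using hy a (mem_univ a)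

/-- A smooth action of a compact group is linear near a fixed point, in suitable coordinates. -/
theorem exists_linearization [CompleteSpace E] : ∃ φ : E → E, φ 0 = 0 ∧
    (∀ᶠ y in 𝓝 (0 : E), ContDiffAt ℝ ∞ φ y) ∧ HasFDerivAt φ (.id ℝ E) 0 ∧
    ∀ᶠ y in 𝓝 (0 : E), ∀ a, φ (A a y) = fderiv ℝ (A a) 0 (φ y) := by
  have htg := topologicalGroup_of_lieGroup 𝓘(ℝ, D) ∞ (G := K)
  borelize K
  obtain ⟨m, _, _, _⟩ := exists_biinvariant_measure K
  obtain ⟨r, hr, h0r, hfam⟩ := hA.exists_smoothFamilyAt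
  have hρ : Continuous fun a : K => fderiv ℝ (A a) 0 :=
    continuous_iff_continuousAt.2 fun a =>
      ContinuousAt.comp (f := fun a : K => (a, (0 : E)))
        (g := fun p : K × E => fderiv ℝ (A p.1) p.2)
        (hfam a 0 h0r).fderiv.continuousAt (by fun_prop)
  let R : C(K, E →L[ℝ] E) := ⟨fun a => fderiv ℝ (A a⁻¹) 0, hρ.comp continuous_inv⟩
  let C : E →L[ℝ] C(K, E) := LinearMap.mkContinuous
    { toFun := ContinuousMap.const K, map_add' := fun _ _ => rfl, map_smul' := fun _ _ => rfl } 1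
    (fun v => by
      rw [one_mul]
      exact (ContinuousMap.norm_le _ (norm_nonneg _)).2 fun _ => le_rfl)
  have hC : ∀ y a, C y a = y := fun _ _ => rfl
  let Λ : C(K, E) →L[ℝ] E := (integralCLM m).comp (pointwiseCLM K E E R)
  have hΛ : ∀ ξ : C(K, E), Λ ξ = ∫ a, fderiv ℝ (A a⁻¹) 0 (ξ a) ∂m := fun ξ => rfl
  -- This is the average of `A'(a⁻¹) (A a y)` over `a`, where `A'(a)` is the derivative of `A a` at
  -- `0`. Writing it as a superposition operator between two continuous linear maps shows that it is
  -- smooth.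
  let φ : E → E := fun y => Λ (superposition A (C y))
  have hφ : ∀ y ∈ r, φ y = ∫ a, fderiv ℝ (A a⁻¹) 0 (A a y) ∂m := by
    intro y hy
    simp only [φ, hΛ]
    refine integral_congr_ae (Eventually.of_forall fun a => ?_)
    beta_reduce
    rw [superposition_apply hfam (fun _ => hy), hC]
  refine ⟨φ, ?_, ?_, ?_, ?_⟩
  · rw [hφ 0 h0r]
    simp [hA.map_zero]
  · filter_upwards [hr.mem_nhds h0r] with y hy
    refine Λ.contDiff.contDiffAt.comp y (ContDiffAt.comp (g := superposition A) y ?_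
      C.contDiff.contDiffAt)
    exact (contDiffOn_superposition hr hfam).contDiffAt
      ((isOpen_setOf_forall_mem hr).mem_nhds fun _ => hy)
  · have h1 := (hasFDerivAt_superposition hr hfam (ξ := C 0) (fun _ => h0r)).comp (0 : E)
      C.hasFDerivAt
    have h2 := Λ.hasFDerivAt.comp (0 : E) h1
    refine h2.congr_fderiv ?_
    ext v
    change Λ (pointwiseCLM K E E _ (C v)) = v
    rw [hΛ]
    -- The derivatives at `0` form a representation, so each integrand has derivative `A'(a⁻¹) A'(a)
    -- = id` at `0`.
    have h3 : ∀ a, fderiv ℝ (A a⁻¹) 0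
        (pointwiseCLM K E E (superposition (fun z x => fderiv ℝ (A z) x) (C 0)) (C v) a) = v := by
      intro a
      change fderiv ℝ (A a⁻¹) 0 ((superposition (fun z x => fderiv ℝ (A z) x) (C 0) a) (C v a)) = v
      rw [superposition_apply (fun z x hx => (hfam z x hx).fderiv) (fun _ => h0r), hC, hC,
        hA.fderiv_mul_apply, inv_mul_cancel, hA.fderiv_one_apply]
    simp only [h3, integral_const, probReal_univ, one_smul]
  · filter_upwards [hr.mem_nhds h0r, hA.eventually_forall (hr.mem_nhds h0r), hA.mul_apply]
      with y hy hy' hm b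
    rw [hφ _ (hy' b), hφ y hy]
    have hcont : Continuous fun a => fderiv ℝ (A a⁻¹) 0 (A a y) :=
      (hρ.comp continuous_inv).clm_apply (continuous_iff_continuousAt.2 fun a =>
        ContinuousAt.comp (f := fun a : K => (a, y)) (g := fun p : K × E => A p.1 p.2)
          (hfam a y hy).continuousAt (by fun_prop))
    have hint : Integrable (fun a => fderiv ℝ (A a⁻¹) 0 (A a y)) m :=
      ContinuousMap.integrable_of_compactSpace ⟨_, hcont⟩ m
    -- Replacing `a` by `a b` in the integral for `A'(b) (φ y)` turns `A'(b) A'((a b)⁻¹)` into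
    -- `A'(a⁻¹)`, which gives equivariance.
    rw [← ContinuousLinearMap.integral_comp_comm _ hint,
      ← integral_mul_right_eq_self (fun a => fderiv ℝ (A b) 0 (fderiv ℝ (A a⁻¹) 0 (A a y))) b]
    refine integral_congr_ae (Eventually.of_forall fun a => ?_)
    beta_reduce
    rw [hm, hA.fderiv_mul_apply, mul_inv_rev, mul_inv_cancel_left]

end IsLocalAction

end LocalAction

end
-- The isotropy action as a derivative, and reduction to a local action
noncomputable section

/-- Tangent vectors at `x` are represented in the preferred chart there, of which the centered chart
is a translate. The derivative in coordinates is therefore the intrinsic isotropy action, with no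
conjugation. -/
theorem hasMFDerivAt_centeredChart {E : Type*} [NormedAddCommGroup E] [NormedSpace ℝ E]
    {M : Type*} [TopologicalSpace M] [ChartedSpace E M] {x y : M} (h : y = x) :
    HasMFDerivAt 𝓘(ℝ, E) 𝓘(ℝ, E) (centeredChart E x) y (ContinuousLinearMap.id ℝ E) := by
  subst h
  refine ⟨(centeredChart E y).continuousAt (mem_centeredChart_source E y), ?_⟩
  have h1 : HasFDerivAt (fun v : E => v - chartAt E y y) (ContinuousLinearMap.id ℝ E)
      (chartAt E y y) := (hasFDerivAt_id _).sub_const _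
  refine HasFDerivAt.hasFDerivWithinAt ?_
  change HasFDerivAt (centeredChart E y ∘ (chartAt E y).symm) _ (chartAt E y y)
  refine h1.congr_of_eventuallyEq ?_
  filter_upwards [(chartAt E y).open_target.mem_nhds (mem_chart_target E y)] with v hv
  simp only [Function.comp_apply, centeredChart_apply, (chartAt E y).right_inv hv]

/-- The inverse function theorem at a point with identity derivative, as a pair of inverse germs. -/
theorem exists_local_inverse {E : Type*} [NormedAddCommGroup E] [NormedSpace ℝ E] [CompleteSpace E]
    {φ : E → E} (h0 : φ 0 = 0) (hφ : ∀ᶠ y in 𝓝 (0 : E), ContDiffAt ℝ ∞ φ y)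
    (hφ' : HasFDerivAt φ (.id ℝ E) 0) :
    ∃ χ : E → E, χ 0 = 0 ∧ (∀ᶠ v in 𝓝 (0 : E), ContDiffAt ℝ ∞ χ v) ∧
      (∀ᶠ v in 𝓝 (0 : E), φ (χ v) = v) ∧ ∀ᶠ y in 𝓝 (0 : E), χ (φ y) = y := by
  obtain ⟨χ, hχ0, hχ, hφχ, hu⟩ := ContDiffAt.exists_implicit
    (f := fun p : E × E => φ p.2 - p.1) (x₀ := (0 : E)) (v₀ := (0 : E)) (f' := .id ℝ E)
    (by
      have h1 : ContinuousAt (fun p : E × E => p.2) ((0 : E), (0 : E)) := continuousAt_snd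
      filter_upwards [h1.eventually hφ] with p hp
      exact (ContDiffAt.comp (g := φ) p hp contDiffAt_snd).sub contDiffAt_fst)
    (by simp [h0]) (by exact hφ'.sub_const 0) Function.bijective_id
  refine ⟨χ, hχ0, hχ, hφχ.mono fun v hv => sub_eq_zero.1 hv, ?_⟩
  have h1 : ContinuousAt (fun y => (φ y, y)) (0 : E) :=
    hφ.self_of_nhds.continuousAt.prodMk continuousAt_id
  have h2 := h1.eventually (p := fun p => φ p.2 - p.1 = 0 → p.2 = χ p.1) (by
    beta_reduce; rw [h0]; exact hu)
  filter_upwards [h2] with y hy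
  exact (hy (sub_self _)).symm

namespace LieGroupoid

variable {E : Type*} [NormedAddCommGroup E] [NormedSpace ℝ E] [FiniteDimensional ℝ E]
  {F : Type*} [NormedAddCommGroup F] [NormedSpace ℝ F] [FiniteDimensional ℝ F]
  {M : Type*} [TopologicalSpace M] [ChartedSpace E M] [IsManifold 𝓘(ℝ, E) ∞ M]
  {G : Type*} [TopologicalSpace G] [ChartedSpace F G] [IsManifold 𝓘(ℝ, F) ∞ G]
  {𝒢 : LieGroupoid E F M G} {x : M}

/-- The isotropy action is the derivative of the target along a section. -/
theorem IsSection.fderiv_tgtMap {f : G → 𝒢.SourceFibre x} {T : 𝒢.SourceFibre x → E → G} {O : Set G}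
    (hT : IsSection f T O) [hfix : Fact (𝒢.IsFixedPoint x)] (a : 𝒢.SourceFibre x) (v : E) :
    fderiv ℝ (tgtMap T a) 0 v = 𝒢.isotropyAct a.arrow v := by
  have hTa : ContMDiffAt 𝓘(ℝ, E) 𝓘(ℝ, F) ∞ (T a) 0 :=
    ContMDiffAt.comp (g := fun p : 𝒢.SourceFibre x × E => T p.1 p.2) (0 : E)
      (hT.near.self_of_nhds a).1 (contMDiffAt_const.prodMk contMDiffAt_id)
  obtain ⟨L, hL⟩ : ∃ L : E →L[ℝ] F, HasMFDerivAt 𝓘(ℝ, E) 𝓘(ℝ, F) (T a) 0 L :=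
    ⟨_, (hTa.mdifferentiableAt (by simp)).hasMFDerivAt⟩
  have hs : HasMFDerivAt 𝓘(ℝ, F) 𝓘(ℝ, E) 𝒢.s (T a 0) (mfderiv 𝓘(ℝ, F) 𝓘(ℝ, E) 𝒢.s a.arrow) := by
    rw [hT.apply_zero]
    exact (𝒢.submersion_s.contMDiff.mdifferentiableAt (by simp)).hasMFDerivAt
  have ht : HasMFDerivAt 𝓘(ℝ, F) 𝓘(ℝ, E) 𝒢.t (T a 0) (mfderiv 𝓘(ℝ, F) 𝓘(ℝ, E) 𝒢.t a.arrow) := by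
    rw [hT.apply_zero]
    exact (𝒢.smooth_t.mdifferentiableAt (by simp)).hasMFDerivAt
  have hψs := hasMFDerivAt_centeredChart (E := E) (x := x) (y := 𝒢.s (T a 0))
    (by rw [hT.apply_zero, a.s_arrow])
  have hψt := hasMFDerivAt_centeredChart (E := E) (x := x) (y := 𝒢.t (T a 0))
    (by rw [hT.apply_zero, a.t_arrow])
  have h1 := HasMFDerivAt.comp (0 : E) hψs (HasMFDerivAt.comp (0 : E) hs hL)
  have h2 := HasMFDerivAt.comp (0 : E) hψt (HasMFDerivAt.comp (0 : E) ht hL)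
  have h3 : (centeredChart E x ∘ 𝒢.s ∘ T a) =ᶠ[𝓝 0] id := by
    filter_upwards [hT.near,
      (centeredChart E x).open_target.mem_nhds (zero_mem_centeredChart_target E x)] with y hy hyt
    simp only [Function.comp_apply, (hy a).2.2.2, (centeredChart E x).right_inv hyt, id]
  -- `T a` is a section of the source, so `L v` lifts `v` through `ds`; the isotropy action may be
  -- computed with this lift.
  have h4 : mfderiv 𝓘(ℝ, F) 𝓘(ℝ, E) 𝒢.s a.arrow (L v) = v :=
    congrArg (fun A : E →L[ℝ] E => A v)
      (hasMFDerivAt_unique (h1.congr_of_eventuallyEq h3.symm) (hasMFDerivAt_id (0 : E)))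
  have h2' : HasFDerivAt (tgtMap T a) ((ContinuousLinearMap.id ℝ E).comp
    (ContinuousLinearMap.comp (mfderiv 𝓘(ℝ, F) 𝓘(ℝ, E) 𝒢.t a.arrow : F →L[ℝ] E) L)) 0 :=
    h2.hasFDerivAt
  have h5 : fderiv ℝ (tgtMap T a) 0 v = mfderiv 𝓘(ℝ, F) 𝓘(ℝ, E) 𝒢.t a.arrow (L v) :=
    congrArg (fun A : E →L[ℝ] E => A v) h2'.fderiv
  rw [h5]
  have h6 := 𝒢.isotropyAct_eq hfix.out a.arrow_mem_isotropy (L v)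
  rw [← h6]
  exact congrArg (𝒢.isotropyAct a.arrow) h4

/-- Near a fixed point at which it is proper, a Lie groupoid has a smooth homomorphism to the
isotropy group, which identifies it with the action groupoid of a local action. -/
theorem exists_homomorphism_to_isotropy [T2Space M] [FirstCountableTopology M] [T2Space G]
    [SecondCountableTopology G] (hp : 𝒢.IsProperAt x)
    [Fact (𝒢.IsFixedPoint x)] [CompactSpace (𝒢.SourceFibre x)] :
    ∃ (r : G → 𝒢.SourceFibre x) (T : 𝒢.SourceFibre x → E → G) (O : Set G) (U : Set M),
      IsSection r T O ∧ IsLocalAction (FibreModel E F) (tgtMap T) ∧ IsOpen U ∧ x ∈ U ∧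
      𝒢.restrict U ⊆ O ∧ (∀ y ∈ U, r (𝒢.u y) = 1) ∧
      ∀ g ∈ 𝒢.restrict U, ∀ h ∈ 𝒢.restrict U, 𝒢.s g = 𝒢.t h → r (𝒢.mul g h) = r g * r h := by
  obtain ⟨r, O', hr, hO', hKO', hmul⟩ := exists_multiplicative_retraction 𝒢 x
  -- The coordinates are rebuilt from the multiplicative retraction: in these, unlike in those used
  -- to find it, the first component is multiplicative.
  obtain ⟨T, O, hT⟩ := hr.exists_section
  have h1 := hp.exists_restrict_subset (hO'.inter hT.isOpen) fun g hg =>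
    ⟨hKO' ⟨g, hg⟩, hT.arrow_mem ⟨g, hg⟩⟩
  obtain ⟨U₁, hU₁, hU₁'⟩ := (eventually_prod_self_iff
    (r := fun y z => ∀ g, 𝒢.s g = y → 𝒢.t g = z → g ∈ O' ∩ O)).1 h1
  obtain ⟨U, hU, hUo, hxU⟩ := mem_nhds_iff.1 (inter_mem hU₁ hmul)
  have hres : 𝒢.restrict U ⊆ O' ∩ O := fun g hg =>
    hU₁' _ (hU hg.1).1 _ (hU hg.2).1 g rfl rfl
  have hm : ∀ g ∈ 𝒢.restrict U, ∀ h ∈ 𝒢.restrict U, 𝒢.s g = 𝒢.t h →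
      r (𝒢.mul g h) = r g * r h := fun g hg h hh hgh =>
    (hU hh.1).2 g (hres hg).1 h (hres hh).1 hgh rfl
  have hu : ∀ y ∈ U, r (𝒢.u y) = 1 := by
    intro y hy
    have hyU : 𝒢.u y ∈ 𝒢.restrict U := by
      constructor
      · rw [𝒢.s_u]; exact hy
      · rw [𝒢.t_u]; exact hy
    -- A unit is idempotent, so its image is an idempotent of the group, hence `1`.
    have h2 := hm _ hyU _ hyU (by rw [𝒢.s_u, 𝒢.t_u])
    have h3 := 𝒢.mul_u (𝒢.u y)
    rw [𝒢.s_u] at h3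
    rw [h3] at h2
    exact left_eq_mul.1 h2
  have hTU : ∀ᶠ y in 𝓝 (0 : E), ∀ a, T a y ∈ 𝒢.restrict U := by
    refine hT.eventually_of_arrow (P := fun g => g ∈ 𝒢.restrict U) fun k => ?_
    refine Eventually.and
      (𝒢.continuous_s.continuousAt.eventually_mem (hUo.mem_nhds (by rw [k.s_arrow]; exact hxU)))
      (𝒢.continuous_t.continuousAt.eventually_mem (hUo.mem_nhds (by rw [k.t_arrow]; exact hxU)))
  refine ⟨r, T, O, U, hT, ⟨hT.tgtMap_zero, hT.smooth_tgtMap, ?_, ?_⟩, hUo, hxU,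
    fun g hg => (hres hg).2, hu, hm⟩
  · filter_upwards [hT.near, hT.eventually_tgtMap hT.near, hTU, hT.eventually_tgtMap hTU,
      hT.eventually_prodArrow] with y h2 h3 h4 h5 h6 b a
    -- Multiplicativity identifies the retraction of the product arrow with `b * a`; comparing
    -- targets then gives the action law.
    rw [← (h6 b a).2.2.2, prodArrow, hm _ (h5 a b) _ (h4 a) (h6 b a).1, (h3 a b).2.2.1,
      (h2 a).2.2.1]
  · filter_upwards [hT.eventually_one (mem_of_superset (hUo.mem_nhds hxU) hu),
      (centeredChart E x).open_target.mem_nhds (zero_mem_centeredChart_target E x)] with y hy hyt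
    rw [tgtMap, hy, 𝒢.t_u, (centeredChart E x).right_inv hyt]

end LieGroupoid

end
-- Assembly of the linearization
noncomputable section

namespace LieGroupoid

variable {E : Type*} [NormedAddCommGroup E] [NormedSpace ℝ E] [FiniteDimensional ℝ E]
  {F : Type*} [NormedAddCommGroup F] [NormedSpace ℝ F] [FiniteDimensional ℝ F]
  {M : Type*} [TopologicalSpace M] [ChartedSpace E M] [IsManifold 𝓘(ℝ, E) ∞ M]
  {G : Type*} [TopologicalSpace G] [ChartedSpace F G] [IsManifold 𝓘(ℝ, F) ∞ G]
  {𝒢 : LieGroupoid E F M G} {x : M}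

/-- A neighbourhood of the origin on which a section `T`, a linearizing map `φ` of the action
`tgtMap T` and its inverse `χ`, defined on `N`, have all the properties which we need. -/
structure IsLinearizingNhd (r : G → 𝒢.SourceFibre x) (T : 𝒢.SourceFibre x → E → G) (φ χ : E → E)
    (N : Set E) (U₀ : Set M) (W : Set E) : Prop where
  isOpen : IsOpen W
  zero_mem : (0 : E) ∈ W
  mem_target : ∀ y ∈ W, y ∈ (centeredChart E x).target
  symm_mem : ∀ y ∈ W, (centeredChart E x).symm y ∈ U₀
  smooth : ∀ y ∈ W, ContDiffAt ℝ ∞ φ y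
  apply_mem : ∀ y ∈ W, φ y ∈ N
  inverse_apply : ∀ y ∈ W, χ (φ y) = y
  inverse_apply_tgtMap : ∀ y ∈ W, ∀ a, χ (φ (tgtMap T a y)) = tgtMap T a y
  equivariant : ∀ y ∈ W, ∀ a : 𝒢.SourceFibre x, φ (tgtMap T a y) = 𝒢.isotropyAct a.arrow (φ y)
  smooth_section : ∀ y ∈ W, ∀ a, ContMDiffAt (𝓘(ℝ, FibreModel E F).prod 𝓘(ℝ, E)) 𝓘(ℝ, F) ∞
    (fun p : 𝒢.SourceFibre x × E => T p.1 p.2) (a, y)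
  retraction_section : ∀ y ∈ W, ∀ a, r (T a y) = a
  s_section : ∀ y ∈ W, ∀ a, 𝒢.s (T a y) = (centeredChart E x).symm y
  t_section_mem : ∀ y ∈ W, ∀ a, 𝒢.t (T a y) ∈ (centeredChart E x).source

variable [hfix : Fact (𝒢.IsFixedPoint x)]

/-- All the properties hold near the origin and are finite in number, those over all `a` being
already uniform; intersecting their domains yields `W`. -/
theorem IsSection.exists_isLinearizingNhd [CompactSpace (𝒢.SourceFibre x)]
    {r : G → 𝒢.SourceFibre x} {T : 𝒢.SourceFibre x → E → G} {O : Set G} (hT : IsSection r T O)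
    (hA : IsLocalAction (FibreModel E F) (tgtMap T)) {U₀ : Set M} (hU₀ : U₀ ∈ 𝓝 x) :
    ∃ (φ χ : E → E) (N W : Set E), φ 0 = 0 ∧ IsOpen N ∧ (0 : E) ∈ N ∧ χ 0 = 0 ∧
      (∀ v ∈ N, ContDiffAt ℝ ∞ χ v ∧ φ (χ v) = v) ∧ IsLinearizingNhd r T φ χ N U₀ W := by
  obtain ⟨φ, hφ0, hφ, hφ', hφA⟩ := hA.exists_linearization
  obtain ⟨χ, hχ0, hχ, hφχ, hχφ⟩ := exists_local_inverse hφ0 hφ hφ'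
  obtain ⟨N, hN, hNo, h0N⟩ := mem_nhds_iff.1 (hχ.and hφχ)
  have hφN : ∀ᶠ y in 𝓝 (0 : E), φ y ∈ N :=
    hφ.self_of_nhds.continuousAt.eventually_mem (by rw [hφ0]; exact hNo.mem_nhds h0N)
  have hsymm : ∀ᶠ y in 𝓝 (0 : E), (centeredChart E x).symm y ∈ U₀ :=
    ((centeredChart E x).symm.continuousAt (zero_mem_centeredChart_target E x)).eventually_mem
      (by rw [centeredChart_symm_zero]; exact hU₀)
  have htar : ∀ᶠ y in 𝓝 (0 : E), y ∈ (centeredChart E x).target :=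
    (centeredChart E x).open_target.mem_nhds (zero_mem_centeredChart_target E x)
  obtain ⟨W, hW, hWo, h0W⟩ := mem_nhds_iff.1 (htar.and (hsymm.and (hφ.and (hφN.and (hχφ.and
    ((hT.eventually_tgtMap hχφ).and (hφA.and (hT.near.and hT.eventually_t_mem))))))))
  refine ⟨φ, χ, N, W, hφ0, hNo, h0N, hχ0, fun v hv => hN hv, hWo, h0W, fun y hy => (hW hy).1,
    fun y hy => (hW hy).2.1, fun y hy => (hW hy).2.2.1, fun y hy => (hW hy).2.2.2.1,
    fun y hy => (hW hy).2.2.2.2.1, fun y hy => (hW hy).2.2.2.2.2.1, fun y hy a => ?_,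
    fun y hy a => ((hW hy).2.2.2.2.2.2.2.1 a).1, fun y hy a => ((hW hy).2.2.2.2.2.2.2.1 a).2.2.1,
    fun y hy a => ((hW hy).2.2.2.2.2.2.2.1 a).2.2.2, fun y hy => (hW hy).2.2.2.2.2.2.2.2⟩
  rw [(hW hy).2.2.2.2.2.2.1 a, hT.fderiv_tgtMap]

/-- An arrow `g` goes to the pair of `r g` and the linearized coordinate of its source, with inverse
`(a, v) ↦ T a (χ v)`. Equivariance of `φ` gives compatibility with targets, and multiplicativity of
`r` compatibility with products. -/
theorem IsSection.isLinearizableAt {r : G → 𝒢.SourceFibre x} {T : 𝒢.SourceFibre x → E → G}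
    {O : Set G} (hT : IsSection r T O) {U₀ : Set M} (hU₀O : 𝒢.restrict U₀ ⊆ O)
    (hu : ∀ y ∈ U₀, r (𝒢.u y) = 1)
    (hm : ∀ g ∈ 𝒢.restrict U₀, ∀ h ∈ 𝒢.restrict U₀, 𝒢.s g = 𝒢.t h → r (𝒢.mul g h) = r g * r h)
    {φ χ : E → E} {N W : Set E} (hφ0 : φ 0 = 0) (hN : IsOpen N) (h0N : (0 : E) ∈ N)
    (hχ0 : χ 0 = 0) (hχ : ∀ v ∈ N, ContDiffAt ℝ ∞ χ v ∧ φ (χ v) = v)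
    (hW : IsLinearizingNhd r T φ χ N U₀ W) : 𝒢.IsLinearizableAt x := by
  let ψ := centeredChart E x
  let U : Set M := ψ.source ∩ ψ ⁻¹' W
  let V : Set E := N ∩ χ ⁻¹' W
  have hUo : IsOpen U := ψ.continuousOn.isOpen_inter_preimage ψ.open_source hW.isOpen
  have hVo : IsOpen V := by
    refine ContinuousOn.isOpen_inter_preimage (fun v hv => ?_) hN hW.isOpen
    exact (hχ v hv).1.continuousAt.continuousWithinAt
  have hsymmU : ∀ y ∈ W, ψ.symm y ∈ U := fun y hy => by
    refine ⟨ψ.map_target (hW.mem_target y hy), ?_⟩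
    change ψ (ψ.symm y) ∈ W
    rwa [ψ.right_inv (hW.mem_target y hy)]
  have hUU₀ : U ⊆ U₀ := fun y hy => by
    have := hW.symm_mem _ hy.2
    rwa [ψ.left_inv hy.1] at this
  have hrU : 𝒢.restrict U ⊆ 𝒢.restrict U₀ := fun g hg => ⟨hUU₀ hg.1, hUU₀ hg.2⟩
  have hφV : ∀ y ∈ W, φ y ∈ V := fun y hy => ⟨hW.apply_mem y hy, by
    change χ (φ y) ∈ W
    rwa [hW.inverse_apply y hy]⟩
  have hxU : x ∈ U := ⟨mem_centeredChart_source E x, by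
    change centeredChart E x x ∈ W
    rw [centeredChart_self]; exact hW.zero_mem⟩
  -- an arrow is determined by its image under the retraction and its source
  have hTr : ∀ g ∈ 𝒢.restrict U, T (r g) (ψ (𝒢.s g)) = g := fun g hg =>
    hT.apply_eq g (hU₀O (hrU hg))
  have hact : ∀ g ∈ 𝒢.restrict U,
      𝒢.isotropyAct (r g).arrow (φ (ψ (𝒢.s g))) = φ (ψ (𝒢.t g)) := by
    intro g hg
    have h1 := hW.equivariant _ hg.1.2 (r g)
    rw [tgtMap, hTr g hg] at h1
    exact h1.symm
  have hrk : ∀ k : 𝒢.SourceFibre x, r k.arrow = k := hT.retraction_arrow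
  have hTU : ∀ (k : 𝒢.SourceFibre x), ∀ v ∈ V, 𝒢.isotropyAct k.arrow v ∈ V →
      T k (χ v) ∈ 𝒢.restrict U := by
    intro k v hv hkv
    constructor
    · rw [hW.s_section _ hv.2]
      exact hsymmU _ hv.2
    · refine ⟨hW.t_section_mem _ hv.2 k, ?_⟩
      change tgtMap T k (χ v) ∈ W
      -- The target coordinate is not yet known to lie in `W`, so `χ ∘ φ = id` is used at the target
      -- separately. It rewrites that coordinate as `χ` of the linear image of `v`, which lies in
      -- `W` because the image is in `V`.
      rw [← hW.inverse_apply_tgtMap _ hv.2, hW.equivariant _ hv.2, (hχ v hv.1).2]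
      exact hkv.2
  let φ' : PartialEquiv M E :=
    { toFun := fun y => φ (ψ y)
      invFun := fun v => ψ.symm (χ v)
      source := U
      target := V
      map_source' := fun y hy => hφV _ hy.2
      map_target' := fun v hv => hsymmU _ hv.2
      left_inv' := fun y hy => by rw [hW.inverse_apply _ hy.2, ψ.left_inv hy.1]
      right_inv' := fun v hv => by
        rw [ψ.right_inv (hW.mem_target _ hv.2), (hχ v hv.1).2] }
  let Φ : PartialEquiv G (G × E) :=
    { toFun := fun g => ((r g).arrow, φ (ψ (𝒢.s g)))
      -- Applying `r` to the arrow `p.1` recovers the corresponding element of the fibre by a map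
      -- smooth on a neighbourhood in `G`, so smoothness of the inverse can be checked in the
      -- ambient `G × E`.
      invFun := fun p => T (r p.1) (χ p.2)
      source := 𝒢.restrict U
      target := 𝒢.linArrows x V
      map_source' := fun g hg => ⟨(r g).arrow_mem_isotropy, hφV _ hg.1.2, by
        rw [hact g hg]
        exact hφV _ hg.2.2⟩
      map_target' := fun p hp => hTU _ _ hp.2.1 (by
        have : (r p.1).arrow = p.1 := congrArg SourceFibre.arrow (hrk ⟨p.1, hp.1.1⟩)
        rw [this]
        exact hp.2.2)
      left_inv' := fun g hg => by
        rw [hrk, hW.inverse_apply _ hg.1.2, hTr g hg]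
      right_inv' := fun p hp => by
        have : (r p.1).arrow = p.1 := congrArg SourceFibre.arrow (hrk ⟨p.1, hp.1.1⟩)
        rw [hW.retraction_section _ hp.2.1.2, hW.s_section _ hp.2.1.2,
          ψ.right_inv (hW.mem_target _ hp.2.1.2), (hχ _ hp.2.1.1).2, this] }
  have hψ := isDiffeo_centeredChart E x
  have hsm : ∀ y ∈ U, ContMDiffAt 𝓘(ℝ, E) 𝓘(ℝ, E) ∞ (fun y => φ (ψ y)) y := fun y hy =>
    ContMDiffAt.comp (g := φ) y (hW.smooth _ hy.2).contMDiffAt (hψ.contMDiffAt hy.1)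
  refine ⟨U, V, φ', Φ, hUo, hxU, hVo, ⟨h0N, by
    change χ 0 ∈ W
    rw [hχ0]; exact hW.zero_mem⟩, rfl, rfl, rfl, rfl, ?_, ?_, ?_, ?_, fun g _ => rfl, hact, ?_, ?_,
    ?_⟩
  · exact fun y hy => (hsm y hy).contMDiffWithinAt
  · exact fun v hv => (ContMDiffAt.comp (g := ψ.symm) v
      (hψ.contMDiffAt_symm (hW.mem_target _ hv.2)) (hχ v hv.1).1.contMDiffAt).contMDiffWithinAt
  · refine fun g hg => ContMDiffAt.contMDiffWithinAt (ContMDiffAt.prodMk ?_ ?_)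
    · exact ContMDiffAt.comp (g := SourceFibre.arrow) g SourceFibre.contMDiff_arrow.contMDiffAt
        (hT.smooth_retraction g (hU₀O (hrU hg)))
    · exact ContMDiffAt.comp (g := fun y => φ (ψ y)) g (hsm _ hg.1)
        𝒢.submersion_s.contMDiff.contMDiffAt
  · rintro ⟨a, v⟩ ⟨ha, hv, -⟩
    have haO : a ∈ O := hT.arrow_mem ⟨a, ha.1⟩
    refine ContMDiffAt.contMDiffWithinAt ?_
    refine ContMDiffAt.comp (g := fun p : 𝒢.SourceFibre x × E => T p.1 p.2) (a, v)
      (hW.smooth_section _ hv.2 _) (ContMDiffAt.prodMk ?_ ?_)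
    · exact ContMDiffAt.comp (g := r) (a, v) (hT.smooth_retraction a haO) contMDiffAt_fst
    · exact ContMDiffAt.comp (g := χ) (a, v) (hχ v hv.1).1.contMDiffAt contMDiffAt_snd
  · intro y hy
    refine Prod.ext ?_ ?_
    · change (r (𝒢.u y)).arrow = 𝒢.u x
      rw [hu y (hUU₀ hy), SourceFibre.arrow_one]
    · change φ (ψ (𝒢.s (𝒢.u y))) = φ (ψ y)
      rw [𝒢.s_u]
  · intro g hg h hh hgh
    refine Prod.ext ?_ ?_
    · change (r (𝒢.mul g h)).arrow = 𝒢.mul (r g).arrow (r h).arrow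
      rw [hm g (hrU hg) h (hrU hh) hgh, SourceFibre.arrow_mul]
    · change φ (ψ (𝒢.s (𝒢.mul g h))) = φ (ψ (𝒢.s h))
      rw [𝒢.s_mul g h hgh]
  · intro a ha
    refine Prod.ext ?_ ?_
    · exact congrArg SourceFibre.arrow (hrk ⟨a, ha.1⟩)
    · change φ (centeredChart E x (𝒢.s a)) = 0
      rw [ha.1, centeredChart_self, hφ0]

end LieGroupoid

end

theorem mainTheorem2
    {E : Type*} [NormedAddCommGroup E] [NormedSpace ℝ E] [FiniteDimensional ℝ E]
    {F : Type*} [NormedAddCommGroup F] [NormedSpace ℝ F] [FiniteDimensional ℝ F]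
    {M : Type*} [TopologicalSpace M] [T2Space M] [SecondCountableTopology M]
    [ChartedSpace E M] [IsManifold 𝓘(ℝ, E) ∞ M]
    {G : Type*} [TopologicalSpace G] [T2Space G] [SecondCountableTopology G]
    [ChartedSpace F G] [IsManifold 𝓘(ℝ, F) ∞ G]
    (𝒢 : LieGroupoid E F M G) (x : M) (hfix : 𝒢.IsFixedPoint x) (hproper : 𝒢.IsProperAt x) :
    𝒢.IsLinearizableAt x := by
  have hx : Fact (𝒢.IsFixedPoint x) := ⟨hfix⟩
  have hK : CompactSpace (𝒢.SourceFibre x) := hproper.compactSpace hfix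
  obtain ⟨r, T, O, U₀, hT, hA, hU₀, hxU₀, hU₀O, hu, hm⟩ :=
    LieGroupoid.exists_homomorphism_to_isotropy hproper
  obtain ⟨φ, χ, N, W, hφ0, hN, h0N, hχ0, hχ, hW⟩ :=
    hT.exists_isLinearizingNhd hA (hU₀.mem_nhds hxU₀)
  exact hT.isLinearizableAt hU₀O hu hm hφ0 hN h0N hχ0 hχ hW
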